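/- Let $d\ge 1$, $1<\alpha<2$, $0<\mu_-\le\mu_+<\infty$, $\Omega=[0,1)^d$. Let $\mu\in L_\infty(\mathbb R^d\times\mathbb R^d)$ be real-valued with $\mu_-\le\mu(\mathbf x,\mathbf y)\le\mu_+$, $\mu(\mathbf x,\mathbf y)=\mu(\mathbf y,\mathbf x)$ and $\mu(\mathbf x+\mathbf m,\mathbf y+\mathbf n)=\mu(\mathbf x,\mathbf y)$ for all $\mathbf m,\mathbf n\in\mathbb Z^d$ (almost everywhere). Functions on $\Omega$ are identified with their $\mathbb Z^d$-periodic extensions, and $\widetilde H^{\alpha/2}(\Omega)$ is the space of (complex-valued) functions in $H^{\alpha/2}(\Omega)$ whose periodic extension lies in $H^{\alpha/2}_{\rm loc}(\mathbb R^d)$. For $\boldsymbol\xi\in\mathbb R^d$ let $\mathbb A(\boldsymbol\xi)$ be the self-adjoint operator in the complex space $L_2(\Omega)$ generated by the closed quadratic form $$a(\boldsymbol\xi)[u,u]=\frac12\int_{\mathbb R^d}d\mathbf y\int_\Omega d\mathbf x\,\mu(\mathbf x,\mathbf y)\frac{|e^{i\langle\boldsymbol\xi,\mathbf x\rangle}u(\mathbf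 x)-e^{i\langle\boldsymbol\xi,\mathbf y\rangle}u(\mathbf y)|^2}{|\mathbf x-\mathbf y|^{d+\alpha}},\qquad u\in\widetilde H^{\alpha/2}(\Omega).$$ Put $$c_0=c_0(d,\alpha)=\int_{\mathbb R^d}\frac{1-\cos z_1}{|\mathbf z|^{d+\alpha}}\,d\mathbf z,\quad d_0=\mu_-c_0\pi^\alpha,\quad \delta_0=\pi\Bigl(\frac{\mu_-}{3\mu_+}\Bigr)^{1/\alpha},$$ $$\mu^0=\int_\Omega\int_\Omega\mu(\mathbf x,\mathbf y)\,d\mathbf x\,d\mathbf y,\quad \mu_*(\mathbf z)=\int_\Omega\mu(\mathbf x,\mathbf z+\mathbf x)\,d\mathbf x-\mu^0.$$ Let $P=(\cdot,\mathbf 1_\Omega)\mathbf 1_\Omega$ be the orthogonal projection of $L_2(\Omega)$ onto the constants, and let $F(\boldsymbol\xi)$ be the spectral projection of $\mathbb A(\boldsymbol\xi)$ for the segment $[0,d_0/3]$. For $k=1,\dots,d$ there is a unique $v_k\in\widetilde H^{\alpha/2}(\Omega)$ with $\int_\Omega v_k\,d\mathbf x=0$ and $$\int_{\mathbb R^d}d\mathbf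 y\int_\Omega d\mathbf x\,\frac{\mu(\mathbf x,\mathbf y)}{|\mathbf x-\mathbf y|^{d+\alpha}}\bigl(v_k(\mathbf x)-v_k(\mathbf y)+x_k-y_k\bigr)\overline{\bigl(\eta(\mathbf x)-\eta(\mathbf y)\bigr)}=0\quad\text{for all }\eta\in\widetilde H^{\alpha/2}(\Omega).$$ Define the matrix $g^0=\{g^0_{jk}\}_{j,k=1}^d$ by $$g^0_{jk}=\frac14\int_{\mathbb R^d}d\mathbf y\int_\Omega d\mathbf x\,\frac{\mu(\mathbf x,\mathbf y)}{|\mathbf x-\mathbf y|^{d+\alpha}}\Bigl((x_j-y_j)(v_k(\mathbf x)-v_k(\mathbf y))+(x_k-y_k)(v_j(\mathbf x)-v_j(\mathbf y))\Bigr)+\sum_{\mathbf n\in\mathbb Z^d}\int_{\Omega+\mathbf n}\frac{\mu_*(\mathbf z)z_jz_k}{2|\mathbf z|^{d+\alpha}}\,d\mathbf z .$$ **Proposition.** All these integrals and the sum over $\mathbf n$ converge absolutely, and $g^0$ is a symmetric matrix with real entries (no sign-definiteness is asserted). There are constants $C_{11},C_{12}$ depending only on $d,\alpha,\mu_-,\mu_+$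 such that $$|\langle g^0\boldsymbol\xi,\boldsymbol\xi\rangle|\le C_{12}|\boldsymbol\xi|^2,\qquad \boldsymbol\xi\in\mathbb R^d,$$ and, for $|\boldsymbol\xi|\le\delta_0$, the operator $\mathbb A(\boldsymbol\xi)F(\boldsymbol\xi)$ is everywhere defined and bounded with $$\bigl\|\mathbb A(\boldsymbol\xi)F(\boldsymbol\xi)-\bigl(\mu^0c_0(d,\alpha)|\boldsymbol\xi|^\alpha+\langle g^0\boldsymbol\xi,\boldsymbol\xi\rangle\bigr)P\bigr\|_{L_2(\Omega)\to L_2(\Omega)}\le C_{11}|\boldsymbol\xi|^{1+\alpha}.$$ -/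

import Mathlib

open MeasureTheory
open scoped ENNReal ComplexConjugate

noncomputable section

namespace LevyType

/-! ### Projection-valued measures and the spectral resolution of an unbounded operator -/

section SpectralMeasure

variable {H : Type*} [NormedAddCommGroup H] [InnerProductSpace ℂ H] [CompleteSpace H]

/-- A projection-valued Borel measure on the real line with values in the bounded operators of a
complex Hilbert space (the values on non-measurable sets are irrelevant). -/
structure ProjectionValuedMeasure (H : Type*) [NormedAddCommGroup H] [InnerProductSpace ℂ H]
    [CompleteSpace H] where
  /-- The operator attached to a set. -/
  proj : Set ℝ → H →L[ℂ] H
  isStarProjection : ∀ B, MeasurableSet B → IsStarProjection (proj B)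
  empty : proj ∅ = 0
  univ : proj Set.univ = 1
  inter : ∀ B C, MeasurableSet B → MeasurableSet C → proj (B ∩ C) = proj B * proj C
  hasSum_iUnion : ∀ B : ℕ → Set ℝ, (∀ i, MeasurableSet (B i)) →
    Pairwise (Function.onFun Disjoint B) → ∀ u, HasSum (fun i => proj (B i) u) (proj (⋃ i, B i) u)

namespace ProjectionValuedMeasure

theorem inner_proj_self (E : ProjectionValuedMeasure H) {B : Set ℝ} (hB : MeasurableSet B) (u : H) :
    inner ℂ u (E.proj B u) = ((‖E.proj B u‖ ^ 2 : ℝ) : ℂ) := by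
  have h := E.isStarProjection B hB
  have h1 : E.proj B (E.proj B u) = E.proj B u := by
    have := h.isIdempotentElem.eq
    exact congrArg (fun T : H →L[ℂ] H => T u) this
  have h2 : ContinuousLinearMap.adjoint (E.proj B) = E.proj B := h.isSelfAdjoint.star_eq
  calc inner ℂ u (E.proj B u) = inner ℂ u (E.proj B (E.proj B u)) := by rw [h1]
    _ = inner ℂ (ContinuousLinearMap.adjoint (E.proj B) u) (E.proj B u) := by
        rw [ContinuousLinearMap.adjoint_inner_left]
    _ = inner ℂ (E.proj B u) (E.proj B u) := by rw [h2]
    _ = _ := by rw [inner_self_eq_norm_sq_to_K]; norm_cast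

/-- The scalar spectral measure `B ↦ (E(B)u, u) = ‖E(B)u‖²` of a vector `u`. -/
def scalarMeasure (E : ProjectionValuedMeasure H) (u : H) : Measure ℝ :=
  Measure.ofMeasurable (fun B _ => ENNReal.ofReal (‖E.proj B u‖ ^ 2))
    (by simp [E.empty])
    (by
      intro B hB hd
      have hs := (E.hasSum_iUnion B hB hd u).mapL (innerSL ℂ u)
      simp only [innerSL_apply_apply] at hs
      have hs' : HasSum (fun i => ((‖E.proj (B i) u‖ ^ 2 : ℝ) : ℂ))
          ((‖E.proj (⋃ i, B i) u‖ ^ 2 : ℝ) : ℂ) := by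
        rw [E.inner_proj_self (MeasurableSet.iUnion hB) u] at hs
        refine hs.congr_fun ?_
        intro i
        exact (E.inner_proj_self (hB i) u).symm
      have hr := Complex.hasSum_ofReal.mp hs'
      rw [← hr.tsum_eq, ENNReal.ofReal_tsum_of_nonneg (fun i => by positivity) hr.summable])

/-- `E` is the spectral measure of the operator `A`, that is, `A = ∫ t dE(t)`: the domain of `A`
consists of the `u` with `∫ t² d(E(t)u,u) < ∞`, and `(Au, u) = ∫ t d(E(t)u,u)` for such `u`
(by polarization this determines `A`). -/
def IsSpectralMeasureOf (E : ProjectionValuedMeasure H) (A : H →ₗ.[ℂ] H) : Prop :=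
  (∀ u : H, u ∈ A.domain ↔ ∫⁻ t, ENNReal.ofReal (t ^ 2) ∂(E.scalarMeasure u) < ∞) ∧
  ∀ u : A.domain, inner ℂ (u : H) (A u) = ((∫ t, t ∂(E.scalarMeasure (u : H)) : ℝ) : ℂ)

end ProjectionValuedMeasure

end SpectralMeasure

/-! ### The periodicity cell and periodic functions -/

/-- The Euclidean space `ℝᵈ`. -/
abbrev Space (d : ℕ) : Type := EuclideanSpace ℝ (Fin d)

/-- The cell `Ω = [0,1)ᵈ` of the lattice `ℤᵈ`. -/
def cell (d : ℕ) : Set (Space d) := {x | ∀ i, x i ∈ Set.Ico (0 : ℝ) 1}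

/-- The Lebesgue measure on the cell. -/
abbrev cellMeasure (d : ℕ) : Measure (Space d) := volume.restrict (cell d)

/-- The complex Hilbert space `L₂(Ω)`. -/
abbrev L2Cell (d : ℕ) : Type := Lp ℂ 2 (cellMeasure d)

/-- The point of the lattice `ℤᵈ ⊂ ℝᵈ` with integer coordinates `n`. -/
def latticePoint {d : ℕ} (n : Fin d → ℤ) : Space d := WithLp.toLp 2 fun i => (n i : ℝ)

/-- The representative in the cell of a point modulo `ℤᵈ`. -/
def fracPart {d : ℕ} (x : Space d) : Space d := WithLp.toLp 2 fun i => Int.fract (x i)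

/-- The `ℤᵈ`-periodic extension to `ℝᵈ` of a function given on the cell. -/
def periodicExt {d : ℕ} (u : Space d → ℂ) (x : Space d) : ℂ := u (fracPart x)

theorem measurableSet_cell (d : ℕ) : MeasurableSet (cell d) := by
  have : cell d = ⋂ i, (fun x : Space d => x i) ⁻¹' Set.Ico (0 : ℝ) 1 := by
    ext x; simp [cell]
  rw [this]
  exact MeasurableSet.iInter fun i =>
    (by fun_prop : Measurable fun x : Space d => x i) measurableSet_Ico

theorem volume_cell_ne_top (d : ℕ) : volume (cell d) ≠ ∞ := by
  have hb : Bornology.IsBounded (cell d) := by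
    refine (Metric.isBounded_iff_subset_closedBall (0 : Space d)).2 ⟨Real.sqrt d, fun x hx => ?_⟩
    rw [mem_closedBall_zero_iff, EuclideanSpace.norm_eq]
    refine Real.sqrt_le_sqrt ?_
    calc ∑ i, ‖x i‖ ^ 2 ≤ ∑ _i : Fin d, (1 : ℝ) := by
          refine Finset.sum_le_sum fun i _ => ?_
          have h := hx i
          rw [Real.norm_eq_abs, sq_abs]
          nlinarith [h.1, h.2]
      _ = d := by simp
  exact hb.measure_lt_top.ne

theorem measurable_fracPart (d : ℕ) : Measurable (fracPart : Space d → Space d) := by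
  have h : Measurable fun x : Space d => fun i : Fin d => Int.fract (x i) :=
    measurable_pi_lambda _ fun i =>
      measurable_fract.comp (by fun_prop : Measurable fun x : Space d => x i)
  exact (MeasurableEquiv.toLp 2 (Fin d → ℝ)).measurable.comp h

theorem fracPart_mem_cell {d : ℕ} (x : Space d) : fracPart x ∈ cell d :=
  fun i => ⟨Int.fract_nonneg _, Int.fract_lt_one _⟩

theorem quasiMeasurePreserving_fracPart (d : ℕ) :
    Measure.QuasiMeasurePreserving (fracPart : Space d → Space d) volume (cellMeasure d) := by
  refine ⟨measurable_fracPart d, Measure.AbsolutelyContinuous.mk fun s hs h0 => ?_⟩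
  rw [Measure.map_apply (measurable_fracPart d) hs]
  rw [Measure.restrict_apply hs] at h0
  have hsub : fracPart ⁻¹' s ⊆
      ⋃ n : Fin d → ℤ, (fun x : Space d => x + latticePoint n) ⁻¹' (s ∩ cell d) := by
    intro x hx
    refine Set.mem_iUnion.2 ⟨fun i => -⌊x i⌋, ?_⟩
    have : x + latticePoint (fun i => -⌊x i⌋) = fracPart x := by
      ext i
      simp [latticePoint, fracPart, Int.fract, sub_eq_add_neg]
    simp only [Set.mem_preimage, this]
    exact ⟨hx, fracPart_mem_cell x⟩
  refine measure_mono_null hsub (measure_iUnion_null fun n => ?_)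
  rw [measure_preimage_add_right]
  exact h0

/-- The constant function `1` as an element of `L₂(Ω)`. -/
def oneCell (d : ℕ) : L2Cell d :=
  MemLp.toLp (fun _ => (1 : ℂ))
    (haveI : IsFiniteMeasure (cellMeasure d) :=
      ⟨by rw [Measure.restrict_apply_univ]; exact (volume_cell_ne_top d).lt_top⟩
     memLp_const 1)

/-- The orthogonal projection `P = (·, 1) 1` onto the constants in `L₂(Ω)`. -/
def meanProj (d : ℕ) : L2Cell d →L[ℂ] L2Cell d :=
  InnerProductSpace.rankOne ℂ (oneCell d) (oneCell d)

theorem periodicExt_add {d : ℕ} (u v : L2Cell d) :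
    periodicExt (⇑(u + v)) =ᵐ[volume] fun x => periodicExt u x + periodicExt v x :=
  (quasiMeasurePreserving_fracPart d).ae_eq (Lp.coeFn_add u v)

theorem periodicExt_smul {d : ℕ} (c : ℂ) (u : L2Cell d) :
    periodicExt (⇑(c • u)) =ᵐ[volume] fun x => c * periodicExt u x :=
  (quasiMeasurePreserving_fracPart d).ae_eq (Lp.coeFn_smul c u)

theorem periodicExt_zero {d : ℕ} :
    periodicExt (⇑(0 : L2Cell d)) =ᵐ[volume] fun _ => 0 :=
  (quasiMeasurePreserving_fracPart d).ae_eq (Lp.coeFn_zero ℂ 2 (cellMeasure d))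

/-- An almost everywhere property on `ℝᵈ` holds at both members of almost every pair. -/
theorem ae_pair {d : ℕ} {p : Space d → Prop} (h : ∀ᵐ x, p x) (O O' : Set (Space d)) :
    ∀ᵐ z : Space d × Space d ∂((volume.restrict O).prod (volume.restrict O')), p z.1 ∧ p z.2 :=
  ((Measure.quasiMeasurePreserving_fst (μ := volume.restrict O) (ν := volume.restrict O')).ae
      (ae_restrict_of_ae h)).and
    ((Measure.quasiMeasurePreserving_snd (μ := volume.restrict O) (ν := volume.restrict O')).ae
      (ae_restrict_of_ae h))

/-! ### Sobolev spaces of fractional order -/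

/-- Membership in the Sobolev (Slobodetskii) space `Hˢ(O)`, `0 < s < 1`: `f ∈ L₂(O)` and
`∬_{O × O} |f(x) - f(y)|² / |x - y|^{d+2s} dx dy < ∞`. -/
def MemSobolev {d : ℕ} (s : ℝ) (O : Set (Space d)) (f : Space d → ℂ) : Prop :=
  MemLp f 2 (volume.restrict O) ∧
  MemLp (fun p : Space d × Space d =>
      (f p.1 - f p.2) / ((‖p.1 - p.2‖ ^ (((d : ℝ) + 2 * s) / 2) : ℝ) : ℂ)) 2
    ((volume.restrict O).prod (volume.restrict O))

theorem MemSobolev.congr {d : ℕ} {s : ℝ} {O : Set (Space d)} {f g : Space d → ℂ}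
    (hf : MemSobolev s O f) (h : f =ᵐ[volume] g) : MemSobolev s O g := by
  refine ⟨hf.1.ae_eq (ae_restrict_of_ae h), hf.2.ae_eq ?_⟩
  filter_upwards [ae_pair h O O] with p hp
  rw [hp.1, hp.2]

theorem MemSobolev.add {d : ℕ} {s : ℝ} {O : Set (Space d)} {f g : Space d → ℂ}
    (hf : MemSobolev s O f) (hg : MemSobolev s O g) : MemSobolev s O fun x => f x + g x := by
  refine ⟨hf.1.add hg.1, (hf.2.add hg.2).ae_eq (Filter.Eventually.of_forall fun p => ?_)⟩
  simp only [Pi.add_apply]; ring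

theorem MemSobolev.const_mul {d : ℕ} {s : ℝ} {O : Set (Space d)} {f : Space d → ℂ}
    (hf : MemSobolev s O f) (c : ℂ) : MemSobolev s O fun x => c * f x := by
  refine ⟨hf.1.const_mul c, (hf.2.const_mul c).ae_eq (Filter.Eventually.of_forall fun p => ?_)⟩
  ring

theorem MemSobolev.zero {d : ℕ} (s : ℝ) (O : Set (Space d)) :
    MemSobolev s O fun _ : Space d => (0 : ℂ) := by
  refine ⟨MemLp.zero', ?_⟩
  simp only [sub_zero, zero_div]
  exact MemLp.zero'

/-- The periodic Sobolev space `H̃ˢ(Ω)`, `0 < s < 1`: the elements of `Hˢ(Ω)` whose `ℤᵈ`-periodic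
extension belongs to `Hˢ_loc(ℝᵈ)`, i.e. to `Hˢ(B)` for every ball `B`. (On the cell the function and
its periodic extension coincide.) -/
def periodicSobolev (d : ℕ) (s : ℝ) : Submodule ℂ (L2Cell d) where
  carrier := {u | MemSobolev s (cell d) (periodicExt u) ∧
    ∀ R : ℝ, MemSobolev s (Metric.ball 0 R) (periodicExt u)}
  add_mem' := fun {u v} hu hv =>
    ⟨(hu.1.add hv.1).congr (periodicExt_add u v).symm,
      fun R => ((hu.2 R).add (hv.2 R)).congr (periodicExt_add u v).symm⟩
  zero_mem' :=
    ⟨(MemSobolev.zero s _).congr periodicExt_zero.symm,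
      fun _ => (MemSobolev.zero s _).congr periodicExt_zero.symm⟩
  smul_mem' := fun c u hu =>
    ⟨(hu.1.const_mul c).congr (periodicExt_smul c u).symm,
      fun R => ((hu.2 R).const_mul c).congr (periodicExt_smul c u).symm⟩

/-! ### The coefficient, the quadratic forms and the operators `𝔸(ξ)` -/

/-- The conditions on the coefficient `μ ∈ L_∞(ℝᵈ × ℝᵈ)`: `μ₋ ≤ μ ≤ μ₊`, symmetry, and
`ℤᵈ`-periodicity in each variable (as for any element of `L_∞`, up to null sets). -/
structure IsAdmissible {d : ℕ} (μm μp : ℝ) (μ : Space d → Space d → ℝ) : Prop where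
  aestronglyMeasurable :
    AEStronglyMeasurable (fun p : Space d × Space d => μ p.1 p.2) volume
  bounds : ∀ᵐ p : Space d × Space d, μm ≤ μ p.1 p.2 ∧ μ p.1 p.2 ≤ μp
  symm : ∀ᵐ p : Space d × Space d, μ p.1 p.2 = μ p.2 p.1
  periodic : ∀ m n : Fin d → ℤ, ∀ᵐ p : Space d × Space d,
    μ (p.1 + latticePoint m) (p.2 + latticePoint n) = μ p.1 p.2

/-- The product of the Lebesgue measures on `Ω` (variable `x`) and on `ℝᵈ` (variable `y`). -/
abbrev pairMeasure (d : ℕ) : Measure (Space d × Space d) := (cellMeasure d).prod volume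

/-- The kernel `μ(x,y) / |x - y|^{d+α}`. -/
def kernel {d : ℕ} (α : ℝ) (μ : Space d → Space d → ℝ) (p : Space d × Space d) : ℝ :=
  μ p.1 p.2 / ‖p.1 - p.2‖ ^ ((d : ℝ) + α)

/-- The function `e^{i⟨ξ,x⟩} u(x)` on `ℝᵈ`, for the periodic extension of `u`. -/
def blochFun {d : ℕ} (ξ : Space d) (u : L2Cell d) (x : Space d) : ℂ :=
  Complex.exp (Complex.I * ((inner ℝ ξ x : ℝ) : ℂ)) * periodicExt u x

/-- The integrand of the sesquilinear form `a(ξ)[u,w]`. -/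
def formIntegrand {d : ℕ} (α : ℝ) (μ : Space d → Space d → ℝ) (ξ : Space d) (u w : L2Cell d)
    (p : Space d × Space d) : ℂ :=
  (kernel α μ p : ℂ) *
    ((blochFun ξ u p.1 - blochFun ξ u p.2) * conj (blochFun ξ w p.1 - blochFun ξ w p.2))

/-- The sesquilinear form `a(ξ)[u,w]`, linear in `u` and antilinear in `w`, of the quadratic form
`a(ξ)[u,u] = ½ ∫_{ℝᵈ} dy ∫_Ω dx μ(x,y) |e^{i⟨ξ,x⟩}u(x) - e^{i⟨ξ,y⟩}u(y)|² / |x - y|^{d+α}`. -/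
def form {d : ℕ} (α : ℝ) (μ : Space d → Space d → ℝ) (ξ : Space d) (u w : L2Cell d) : ℂ :=
  (1 / 2 : ℂ) * ∫ p, formIntegrand α μ ξ u w p ∂(pairMeasure d)

theorem blochFun_add {d : ℕ} (ξ : Space d) (u v : L2Cell d) :
    blochFun ξ (u + v) =ᵐ[volume] fun x => blochFun ξ u x + blochFun ξ v x := by
  filter_upwards [periodicExt_add u v] with x hx
  simp only [blochFun, hx]; ring

theorem blochFun_smul {d : ℕ} (ξ : Space d) (c : ℂ) (u : L2Cell d) :
    blochFun ξ (c • u) =ᵐ[volume] fun x => c * blochFun ξ u x := by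
  filter_upwards [periodicExt_smul c u] with x hx
  simp only [blochFun, hx]; ring

theorem blochFun_zero {d : ℕ} (ξ : Space d) :
    blochFun ξ (0 : L2Cell d) =ᵐ[volume] fun _ => 0 := by
  filter_upwards [periodicExt_zero (d := d)] with x hx
  simp only [blochFun, hx, mul_zero]

theorem ae_pairMeasure {d : ℕ} {p : Space d → Prop} (h : ∀ᵐ x, p x) :
    ∀ᵐ z : Space d × Space d ∂(pairMeasure d), p z.1 ∧ p z.2 := by
  have := ae_pair h (cell d) Set.univ
  rwa [Measure.restrict_univ] at this

theorem formIntegrand_add {d : ℕ} (α : ℝ) (μ : Space d → Space d → ℝ) (ξ : Space d)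
    (u v w : L2Cell d) :
    formIntegrand α μ ξ (u + v) w =ᵐ[pairMeasure d]
      fun p => formIntegrand α μ ξ u w p + formIntegrand α μ ξ v w p := by
  filter_upwards [ae_pairMeasure (blochFun_add ξ u v)] with p hp
  simp only [formIntegrand, hp.1, hp.2]; ring

theorem formIntegrand_smul {d : ℕ} (α : ℝ) (μ : Space d → Space d → ℝ) (ξ : Space d) (c : ℂ)
    (u w : L2Cell d) :
    formIntegrand α μ ξ (c • u) w =ᵐ[pairMeasure d]
      fun p => c * formIntegrand α μ ξ u w p := by
  filter_upwards [ae_pairMeasure (blochFun_smul ξ c u)] with p hp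
  simp only [formIntegrand, hp.1, hp.2]; ring

theorem formIntegrand_zero {d : ℕ} (α : ℝ) (μ : Space d → Space d → ℝ) (ξ : Space d)
    (w : L2Cell d) :
    formIntegrand α μ ξ 0 w =ᵐ[pairMeasure d] fun _ => 0 := by
  filter_upwards [ae_pairMeasure (blochFun_zero ξ)] with p hp
  simp only [formIntegrand, hp.1, hp.2]; ring

/-- The graph of the operator generated by the form `a(ξ)` with domain `H̃^{α/2}(Ω)`: the pairs
`(u, f)` with `u` in the form domain and `a(ξ)[u, η] = (f, η)` for all `η` in the form domain
(the integral that defines `a(ξ)[u, η]` being absolutely convergent). -/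
def operatorGraph {d : ℕ} (α : ℝ) (μ : Space d → Space d → ℝ) (ξ : Space d) :
    Submodule ℂ (L2Cell d × L2Cell d) where
  carrier := {q | q.1 ∈ periodicSobolev d (α / 2) ∧ ∀ η ∈ periodicSobolev d (α / 2),
    Integrable (formIntegrand α μ ξ q.1 η) (pairMeasure d) ∧
      form α μ ξ q.1 η = inner ℂ η q.2}
  add_mem' := by
    rintro ⟨u, f⟩ ⟨v, g⟩ ⟨hu, hu'⟩ ⟨hv, hv'⟩
    refine ⟨Submodule.add_mem _ hu hv, fun η hη => ⟨?_, ?_⟩⟩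
    · exact ((hu' η hη).1.add (hv' η hη).1).congr (formIntegrand_add α μ ξ u v η).symm
    · have h1 := (hu' η hη).2
      have h2 := (hv' η hη).2
      simp only [form, Prod.mk_add_mk] at h1 h2 ⊢
      rw [integral_congr_ae (formIntegrand_add α μ ξ u v η),
        integral_add (hu' η hη).1 (hv' η hη).1, mul_add, h1, h2, inner_add_right]
  zero_mem' := by
    refine ⟨Submodule.zero_mem _, fun η _ => ⟨?_, ?_⟩⟩
    · exact (integrable_zero _ _ _).congr (formIntegrand_zero α μ ξ η).symm
    · simp only [form, Prod.fst_zero, Prod.snd_zero, inner_zero_right]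
      rw [integral_congr_ae (formIntegrand_zero α μ ξ η)]
      simp
  smul_mem' := by
    rintro c ⟨u, f⟩ ⟨hu, hu'⟩
    refine ⟨Submodule.smul_mem _ c hu, fun η hη => ⟨?_, ?_⟩⟩
    · exact ((hu' η hη).1.const_mul c).congr (formIntegrand_smul α μ ξ c u η).symm
    · have h1 := (hu' η hη).2
      simp only [form, Prod.smul_mk] at h1 ⊢
      rw [integral_congr_ae (formIntegrand_smul α μ ξ c u η), integral_const_mul,
        mul_left_comm, h1, inner_smul_right]

/-- The operator `𝔸(ξ) = 𝔸(ξ; α, μ)` in `L₂(Ω)` generated by the form `a(ξ)`. -/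
def levyOperator {d : ℕ} (α : ℝ) (μ : Space d → Space d → ℝ) (ξ : Space d) :
    L2Cell d →ₗ.[ℂ] L2Cell d :=
  (operatorGraph α μ ξ).toLinearPMap

/-! ### Constants -/

/-- `c₀(d,α) = ∫_{ℝᵈ} (1 - cos z₁) / |z|^{d+α} dz`. -/
def c0 (d : ℕ) [NeZero d] (α : ℝ) : ℝ :=
  ∫ z : Space d, (1 - Real.cos (z 0)) / ‖z‖ ^ ((d : ℝ) + α)

/-- `d₀ = μ₋ c₀(d,α) π^α`. -/
def spectralGap (d : ℕ) [NeZero d] (α μm : ℝ) : ℝ := μm * c0 d α * Real.pi ^ α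

/-- `δ₀ = π (μ₋ / (3 μ₊))^{1/α}`. -/
def delta0 (α μm μp : ℝ) : ℝ := Real.pi * (μm / (3 * μp)) ^ (1 / α)

/-- The mean value `μ⁰ = ∫_Ω ∫_Ω μ(x,y) dx dy`. -/
def muMean {d : ℕ} (μ : Space d → Space d → ℝ) : ℝ :=
  ∫ p, μ p.1 p.2 ∂((cellMeasure d).prod (cellMeasure d))

/-- `μ_*(z) = ∫_Ω μ(x, z + x) dx - μ⁰`. -/
def muStar {d : ℕ} (μ : Space d → Space d → ℝ) (z : Space d) : ℝ :=
  (∫ x, μ x (z + x) ∂(cellMeasure d)) - muMean μ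

/-! ### Cell problems and the matrix `g⁰` -/

/-- The integrand of the `k`-th cell problem with test function `η`. -/
def cellIntegrand {d : ℕ} (α : ℝ) (μ : Space d → Space d → ℝ) (k : Fin d) (v η : L2Cell d)
    (p : Space d × Space d) : ℂ :=
  (kernel α μ p : ℂ) *
    ((periodicExt v p.1 - periodicExt v p.2 + ((p.1 k - p.2 k : ℝ) : ℂ)) *
      conj (periodicExt η p.1 - periodicExt η p.2))

/-- `v` is a solution of the `k`-th cell problem: `v ∈ H̃^{α/2}(Ω)` has mean value zero and
`∫_{ℝᵈ} dy ∫_Ω dx μ(x,y) |x-y|^{-d-α} (v(x) - v(y) + x_k - y_k) conj(η(x) - η(y)) = 0` for all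
`η ∈ H̃^{α/2}(Ω)`, the integral being absolutely convergent. -/
def IsCellSolution {d : ℕ} (α : ℝ) (μ : Space d → Space d → ℝ) (k : Fin d) (v : L2Cell d) : Prop :=
  v ∈ periodicSobolev d (α / 2) ∧
  ∫ x, v x ∂(cellMeasure d) = 0 ∧
  ∀ η ∈ periodicSobolev d (α / 2),
    Integrable (cellIntegrand α μ k v η) (pairMeasure d) ∧
      ∫ p, cellIntegrand α μ k v η p ∂(pairMeasure d) = 0

/-- The integrand of the part of `g⁰_{jk}` that involves the cell solutions. -/
def correctorIntegrand {d : ℕ} (α : ℝ) (μ : Space d → Space d → ℝ) (v : Fin d → L2Cell d)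
    (j k : Fin d) (p : Space d × Space d) : ℂ :=
  (kernel α μ p : ℂ) *
    (((p.1 j - p.2 j : ℝ) : ℂ) * (periodicExt (v k) p.1 - periodicExt (v k) p.2) +
      ((p.1 k - p.2 k : ℝ) : ℂ) * (periodicExt (v j) p.1 - periodicExt (v j) p.2))

/-- The shifted cell `Ω + n`. -/
def shiftedCell {d : ℕ} (n : Fin d → ℤ) : Set (Space d) := {z | z - latticePoint n ∈ cell d}

/-- The integrand `μ_*(z) z_j z_k / (2 |z|^{d+α})`. -/
def latticeIntegrand {d : ℕ} (α : ℝ) (μ : Space d → Space d → ℝ) (j k : Fin d) (z : Space d) : ℝ :=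
  muStar μ z * z j * z k / (2 * ‖z‖ ^ ((d : ℝ) + α))

/-- The entry `g⁰_{jk}` formed with the functions `v₁, …, v_d`. -/
def g0Entry {d : ℕ} (α : ℝ) (μ : Space d → Space d → ℝ) (v : Fin d → L2Cell d) (j k : Fin d) : ℂ :=
  (1 / 4 : ℂ) * ∫ p, correctorIntegrand α μ v j k p ∂(pairMeasure d) +
    ((∑' n : Fin d → ℤ, ∫ z in shiftedCell n, latticeIntegrand α μ j k z : ℝ) : ℂ)

/-- The integrals in the definition of `g⁰_{jk}` converge absolutely, and so does the sum over the
cells. -/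
def G0EntryConverges {d : ℕ} (α : ℝ) (μ : Space d → Space d → ℝ) (v : Fin d → L2Cell d)
    (j k : Fin d) : Prop :=
  Integrable (correctorIntegrand α μ v j k) (pairMeasure d) ∧
  (∀ n : Fin d → ℤ, IntegrableOn (latticeIntegrand α μ j k) (shiftedCell n)) ∧
  Summable fun n : Fin d → ℤ => ∫ z in shiftedCell n, latticeIntegrand α μ j k z

end LevyType

end

open LevyType

noncomputable section

namespace LevyType

section

/-! ### Coordinates with respect to a Hilbert basis -/

section Diagonal

variable {H : Type*} [NormedAddCommGroup H] [InnerProductSpace ℂ H]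
  {ι : Type*} (b : HilbertBasis ι ℂ H)

/-! The unbounded problem is first made bounded. Let S (`smoothing`) be the Fourier multiplier with
entries max(1,|n|)^{-α/2}. By Plancherel the energy of u at quasimomentum ξ is Σ 2c₀|ξ+2πn|^α|û(n)|²
(`energy_eq_tsum`), so the range of S is exactly the form domain (`mem_periodicSobolev_iff_range`).
Since μ lies between μ₋ and μ₊, there is a bounded self-adjoint B(ξ) (`IsAdmissible.formOp`) with
(B(ξ)f, g) = a(ξ)[Sf, Sg]. Then 𝔸(ξ)u = h means u = Sg and B(ξ)g = Sh
(`IsAdmissible.levyOperator_iff`), and an eigenvector Sψ is a solution of B(ξ)ψ = λS²ψ.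

For |ξ| ≤ π the form is at least d₀‖f‖² on f ⊥ 1 (`IsAdmissible.le_re_inner_formOp`). Hence B + S²
is coercive, S(B + S²)⁻¹S is a compact resolvent, and a spectral measure exists
(`IsAdmissible.exists_resolvent`). The lowest eigenvalue satisfies λ ≤ a(ξ)[1,1] ≤ μ₊c₀|ξ|^α, which
is at most d₀/3 when |ξ| ≤ δ₀. The gap leaves room for only one eigenvector φ = Sψ below d₀/3, so
for every spectral measure of 𝔸(ξ) the projection F is Q = (·,φ)φ and 𝔸(ξ)F = λQ
(`IsSpectralMeasureOf.proj_Icc_eq`, `IsAdmissible.levyOperator_proj`).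

It remains to expand λ and φ. Write e for the constant 1, m for the vector representing the linear
function ⟨ξ, x - y⟩ in the form (`IsAdmissible.gradVec`), and f for the solution of B(0)f = -m, a
combination of the cell solutions pulled back by S. Then m and f are O(|ξ|), B(ξ)e = im + O(|ξ|^α),
B(ξ)f = -m + O(|ξ|^{1+α/2}), and the gap forces ψ - (ψ,e)e = O(|ξ|). For q = e + if the terms im
cancel, so B(ξ)q = O(|ξ|^α); computing the pairing of B(ξ)q with ψ in two ways gives λ = (B(ξ)e, e)
- (B(0)f, f) + O(|ξ|^{1+α}) (`abs_eigenvalue_sub_le`). The term -(B(0)f, f) is the corrector part of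
g⁰. The condition α > 1 enters because |x - y| must be integrable against the kernel at infinity.

The form on constants is μ⁰c₀|ξ|^α + ∫ μ_*(z)(1 - cos⟨ξ,z⟩)|z|^{-d-α} dz. The quadratic Taylor term
of the cosine is not integrable against |z|^{-d-α} at infinity, but μ_* is periodic with mean zero:
on a cell Ω + n away from the origin the value of the kernel at n may be subtracted, which gains a
factor 1/|z|. This makes the lattice sum in g⁰ converge and, by scaling, the remainder O(|ξ|^{1+α})
(`IsAdmissible.lattice_sum`). Finally λQ - ΛP = (λ - Λ)P + λ(Q - P), where Λ is the asserted
expansion, λ = O(|ξ|^α) and Q - P = O(|ξ|). -/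

theorem hasSum_sq_coeff (u : H) : HasSum (fun i => ‖inner ℂ (b i) u‖ ^ 2) (‖u‖ ^ 2) := by
  have h := b.hasSum_inner_mul_inner u u
  rw [inner_self_eq_norm_sq_to_K] at h
  have h' : HasSum (fun i => ((‖inner ℂ (b i) u‖ ^ 2 : ℝ) : ℂ)) ((‖u‖ ^ 2 : ℝ) : ℂ) := by
    convert! h using 1
    · funext i
      rw [← inner_conj_symm u (b i), ← Complex.normSq_eq_conj_mul_self, Complex.normSq_eq_norm_sq]
    · norm_cast
  exact Complex.hasSum_ofReal.mp h'

theorem eq_of_coeff_eq {u v : H} (h : ∀ i, inner ℂ (b i) u = inner ℂ (b i) v) : u = v := by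
  apply b.repr.injective
  ext i
  rw [b.repr_apply_apply, b.repr_apply_apply, h i]

theorem exists_of_summable_sq {c : ι → ℂ} (hc : Summable fun i => ‖c i‖ ^ 2) :
    ∃ u : H, ∀ i, inner ℂ (b i) u = c i := by
  have hm : Memℓp c 2 := memℓp_gen (by simpa using hc)
  refine ⟨b.repr.symm ⟨c, hm⟩, fun i => ?_⟩
  rw [← b.repr_apply_apply, LinearIsometryEquiv.apply_symm_apply]

theorem summable_sq_mul {s : ι → ℝ} {C : ℝ} (hs : ∀ i, |s i| ≤ C) (u : H) :
    Summable fun i => ‖(s i : ℂ) * inner ℂ (b i) u‖ ^ 2 := by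
  refine Summable.of_nonneg_of_le (fun _ => by positivity) (fun i => ?_)
    ((hasSum_sq_coeff b u).summable.mul_left (C ^ 2))
  rw [norm_mul, mul_pow, Complex.norm_real, Real.norm_eq_abs]
  have := hs i
  gcongr

variable {s : ι → ℝ} {C : ℝ} (hs : ∀ i, |s i| ≤ C)

/-- The bounded operator that is diagonal in the Hilbert basis `b`, with bounded real entries. -/
def diagOp : H →L[ℂ] H :=
  LinearMap.mkContinuous
    { toFun := fun u => (exists_of_summable_sq b (summable_sq_mul b hs u)).choose
      map_add' := fun u v => eq_of_coeff_eq b fun i => by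
        rw [inner_add_right, (exists_of_summable_sq b (summable_sq_mul b hs (u + v))).choose_spec,
          (exists_of_summable_sq b (summable_sq_mul b hs u)).choose_spec,
          (exists_of_summable_sq b (summable_sq_mul b hs v)).choose_spec, inner_add_right, mul_add]
      map_smul' := fun c u => eq_of_coeff_eq b fun i => by
        rw [RingHom.id_apply, inner_smul_right,
          (exists_of_summable_sq b (summable_sq_mul b hs (c • u))).choose_spec,
          (exists_of_summable_sq b (summable_sq_mul b hs u)).choose_spec, inner_smul_right,
          mul_left_comm] } |C|
    (fun u => by
      have h1 := hasSum_sq_coeff b (exists_of_summable_sq b (summable_sq_mul b hs u)).choose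
      refine le_of_sq_le_sq ?_ (by positivity)
      refine hasSum_le (fun i => ?_) h1 (by
        rw [mul_pow]; exact (hasSum_sq_coeff b u).mul_left (|C| ^ 2))
      rw [(exists_of_summable_sq b (summable_sq_mul b hs u)).choose_spec, norm_mul, mul_pow,
        Complex.norm_real, Real.norm_eq_abs]
      have := (hs i).trans (le_abs_self C)
      gcongr)

theorem coeff_diagOp (u : H) (i : ι) :
    inner ℂ (b i) (diagOp b hs u) = (s i : ℂ) * inner ℂ (b i) u :=
  (exists_of_summable_sq b (summable_sq_mul b hs u)).choose_spec i

theorem norm_diagOp_le : ‖diagOp b hs‖ ≤ |C| :=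
  LinearMap.mkContinuous_norm_le _ (abs_nonneg C) _

theorem diagOp_basis (i : ι) : diagOp b hs (b i) = (s i : ℂ) • b i := by
  classical
  refine eq_of_coeff_eq b fun j => ?_
  rw [coeff_diagOp, inner_smul_right, orthonormal_iff_ite.1 b.orthonormal j i]
  split_ifs with h
  · rw [h]
  · simp

theorem inner_diagOp_left (u v : H) : inner ℂ (diagOp b hs u) v = inner ℂ u (diagOp b hs v) := by
  rw [← b.tsum_inner_mul_inner, ← b.tsum_inner_mul_inner]
  refine tsum_congr fun i => ?_
  rw [coeff_diagOp, ← inner_conj_symm (diagOp b hs u), coeff_diagOp, map_mul, inner_conj_symm,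
    Complex.conj_ofReal]
  ring

theorem isSelfAdjoint_diagOp [CompleteSpace H] : IsSelfAdjoint (diagOp b hs) :=
  ContinuousLinearMap.isSelfAdjoint_iff_isSymmetric.2 fun u v => inner_diagOp_left b hs u v

/-- A diagonal operator whose entries tend to zero is compact. -/
theorem isCompactOperator_diagOp [CompleteSpace H]
    (h0 : Filter.Tendsto s Filter.cofinite (nhds 0)) : IsCompactOperator (diagOp b hs) := by
  classical
  have hb : ∀ F : Finset ι, ∀ i, |if i ∈ F then s i else 0| ≤ |C| := fun F i => by
    split_ifs
    · exact (hs i).trans (le_abs_self C)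
    · simp
  -- Compact as the norm limit of the finite-rank truncations to finite index sets F; once F
  -- contains the finitely many entries of size at least ε/2, the truncation error is at most ε/2.
  refine isCompactOperator_of_tendsto (l := (Filter.atTop : Filter (Finset ι)))
    (F := fun F => diagOp b (hb F)) ?_ (Filter.Eventually.of_forall fun F => ?_)
  · rw [Metric.tendsto_atTop]
    intro ε hε
    have hfin : {i | ¬ |s i| < ε / 2}.Finite := by
      have := h0.abs
      rw [abs_zero] at this
      exact Filter.eventually_cofinite.1 (this.eventually (gt_mem_nhds (half_pos hε)))
    refine ⟨hfin.toFinset, fun F hF => ?_⟩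
    have hd : ∀ i, |(if i ∈ F then s i else 0) - s i| ≤ ε / 2 := fun i => by
      split_ifs with hi
      · rw [sub_self, abs_zero]; exact (half_pos hε).le
      · rw [zero_sub, abs_neg]
        by_contra hcon
        exact hi (hF (hfin.mem_toFinset.2 fun h => hcon h.le))
    have : diagOp b (hb F) - diagOp b hs = diagOp b hd := by
      ext u
      refine eq_of_coeff_eq b fun i => ?_
      rw [sub_apply, inner_sub_right, coeff_diagOp, coeff_diagOp, coeff_diagOp]
      push_cast
      ring
    rw [dist_eq_norm, this]
    refine (norm_diagOp_le b hd).trans_lt ?_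
    rw [abs_of_pos (half_pos hε)]
    exact half_lt_self hε
  · have hr : ∀ u, diagOp b (hb F) u ∈ Submodule.span ℂ (b '' (F : Set ι)) := by
      intro u
      have hsum := b.hasSum_repr (diagOp b (hb F) u)
      have : diagOp b (hb F) u = ∑ i ∈ F, b.repr (diagOp b (hb F) u) i • b i := by
        refine hsum.unique (hasSum_sum_of_ne_finset_zero fun i hi => ?_)
        rw [b.repr_apply_apply, coeff_diagOp, if_neg hi]
        simp
      rw [this]
      exact Submodule.sum_mem _ fun i hi =>
        Submodule.smul_mem _ _ (Submodule.subset_span ⟨i, hi, rfl⟩)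
    have hfd : FiniteDimensional ℂ (Submodule.span ℂ (b '' (F : Set ι))) :=
      FiniteDimensional.span_of_finite ℂ (F.finite_toSet.image b)
    have hc : IsCompactOperator ((diagOp b (hb F)).codRestrict _ hr) := by
      have hpr : ProperSpace (Submodule.span ℂ (b '' (F : Set ι))) := FiniteDimensional.proper ℂ _
      exact isCompactOperator_of_locallyCompactSpace_dom _
    exact hc.clm_comp (Submodule.subtypeL _)

end Diagonal

/-- An orthogonal family of closed subspaces with dense sum has an adapted Hilbert basis. -/
theorem exists_hilbertBasis_of_orthogonalFamily {H κ : Type*}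
    [NormedAddCommGroup H] [InnerProductSpace ℂ H] [CompleteSpace H] {V : κ → Submodule ℂ H}
    [∀ k, CompleteSpace (V k)] (hV : OrthogonalFamily ℂ (fun k => V k) fun k => (V k).subtypeₗᵢ)
    (hbot : (⨆ k, V k)ᗮ = ⊥) :
    ∃ (w : ∀ k, Set (V k)) (b : HilbertBasis (Σ k, w k) ℂ H), ∀ i, b i ∈ V i.1 := by
  have hex : ∀ k, ∃ (w : Set (V k)) (_ : HilbertBasis w ℂ (V k)), True := fun k => by
    obtain ⟨w, b, -⟩ := exists_hilbertBasis ℂ (V k)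
    exact ⟨w, b, trivial⟩
  choose w e _ using hex
  have hon := hV.orthonormal_sigma_orthonormal (fun k => (e k).orthonormal)
  obtain ⟨v, hv⟩ : ∃ v : (Σ k, w k) → H, v = fun a => (V a.1).subtypeₗᵢ (e a.1 a.2) := ⟨_, rfl⟩
  rw [← hv] at hon
  have hspan : (Submodule.span ℂ (Set.range v))ᗮ = ⊥ := by
    rw [Submodule.eq_bot_iff]
    intro x hx
    rw [Submodule.mem_orthogonal'] at hx
    rw [← Submodule.mem_bot ℂ, ← hbot, ← Submodule.iInf_orthogonal, Submodule.mem_iInf]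
    intro k
    rw [Submodule.mem_orthogonal']
    intro y hy
    -- Each y in V k is the sum of its expansion in the basis of V k, and x is orthogonal to every
    -- term.
    have hs := (((e k).hasSum_repr ⟨y, hy⟩).mapL (V k).subtypeL).mapL (innerSL ℂ x)
    refine hs.unique ?_
    have hz : ∀ i, (innerSL ℂ x) ((V k).subtypeL ((e k).repr ⟨y, hy⟩ i • e k i)) = 0 := by
      intro i
      have := hx _ (Submodule.subset_span ⟨⟨k, i⟩, rfl⟩)
      rw [hv] at this
      simp only [Submodule.coe_subtypeₗᵢ, Submodule.subtype_apply] at this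
      simp only [map_smul, innerSL_apply_apply, smul_eq_mul, Submodule.subtypeL_apply]
      rw [this, mul_zero]
    simp only [hz]
    exact hasSum_zero
  refine ⟨w, HilbertBasis.mkOfOrthogonalEqBot hon hspan, fun a => ?_⟩
  rw [HilbertBasis.coe_mkOfOrthogonalEqBot, hv]
  exact (e a.1 a.2).2

/-- A compact self-adjoint operator is diagonal in some Hilbert basis. -/
theorem exists_hilbertBasis_eigenvectors.{u} {H : Type u} [NormedAddCommGroup H] [InnerProductSpace ℂ H]
    [CompleteSpace H] {R : H →L[ℂ] H} (hc : IsCompactOperator R) (hR : IsSelfAdjoint R) :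
    ∃ (ι : Type u) (b : HilbertBasis ι ℂ H) (r : ι → ℝ), ∀ i, R (b i) = (r i : ℂ) • b i := by
  have hsym : (R : H →ₗ[ℂ] H).IsSymmetric := ContinuousLinearMap.isSelfAdjoint_iff_isSymmetric.1 hR
  have hcompl : ∀ μ : ℂ, CompleteSpace (Module.End.eigenspace (R : H →ₗ[ℂ] H) μ) := fun μ => by
    have : IsClosed (Module.End.eigenspace (R : H →ₗ[ℂ] H) μ : Set H) := by
      have : (Module.End.eigenspace (R : H →ₗ[ℂ] H) μ : Set H) = {x | R x = μ • x} := by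
        ext x; simp
      rw [this]
      exact isClosed_eq R.continuous (by fun_prop)
    exact this.completeSpace_coe
  obtain ⟨w, b, hf⟩ := exists_hilbertBasis_of_orthogonalFamily hsym.orthogonalFamily_eigenspaces
    (ContinuousLinearMap.orthogonalComplement_iSup_eigenspaces_eq_bot hc hsym)
  -- The first component of the index is the complex eigenvalue. Symmetry makes it real, so taking
  -- the real part loses nothing.
  refine ⟨_, b, fun i => i.1.re, fun i => ?_⟩
  have heig : R (b i) = i.1 • b i := Module.End.mem_eigenspace_iff.1 (hf i)
  have hreal : ((i.1.re : ℝ) : ℂ) = i.1 := by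
    rw [← Complex.conj_eq_iff_re]
    refine hsym.conj_eigenvalue_eq_self (Module.End.hasEigenvalue_of_hasEigenvector
      (x := b i) ⟨hf i, fun h0 => ?_⟩)
    have := b.orthonormal.1 i
    rw [h0, norm_zero] at this
    exact zero_ne_one this
  rw [hreal, heig]

end

section

/-! ### Spectral measures that are diagonal in a Hilbert basis -/

section DiagonalSpectralMeasure

variable {H : Type*} [NormedAddCommGroup H] [InnerProductSpace ℂ H] [CompleteSpace H]
  {ι : Type*} (b : HilbertBasis ι ℂ H) (t : ι → ℝ)

theorem abs_indicator_one_le (B : Set ℝ) (i : ι) : |B.indicator (fun _ => (1 : ℝ)) (t i)| ≤ 1 := by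
  by_cases h : t i ∈ B <;> simp [h]

/-- The projection-valued measure that assigns to `B` the projection onto the closed span of the
basis vectors `b i` with `t i ∈ B`. -/
def diagMeasure : ProjectionValuedMeasure H where
  proj B := diagOp b (abs_indicator_one_le t B)
  isStarProjection B _ := by
    refine ⟨ContinuousLinearMap.ext fun u => eq_of_coeff_eq b fun i => ?_, isSelfAdjoint_diagOp b _⟩
    rw [mul_apply_eq_comp, coeff_diagOp, coeff_diagOp]
    by_cases h : t i ∈ B <;> simp [h]
  empty := ContinuousLinearMap.ext fun u => eq_of_coeff_eq b fun i => by
    rw [coeff_diagOp]; simp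
  univ := ContinuousLinearMap.ext fun u => eq_of_coeff_eq b fun i => by
    rw [coeff_diagOp]; simp
  inter B C _ _ := ContinuousLinearMap.ext fun u => eq_of_coeff_eq b fun i => by
    rw [mul_apply_eq_comp, coeff_diagOp, coeff_diagOp, coeff_diagOp]
    by_cases h : t i ∈ B <;> by_cases h' : t i ∈ C <;> simp [h, h']
  hasSum_iUnion B _ hd u := by
    classical
    have hcoef : ∀ j, ∀ i, inner ℂ (b i) (diagOp b (abs_indicator_one_le t (B j)) u) =
        if t i ∈ B j then inner ℂ (b i) u else 0 := fun j i => by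
      rw [coeff_diagOp]
      by_cases h : t i ∈ B j <;> simp [h]
    have horth : ∀ j k, j ≠ k → ∀ x y : H,
        inner ℂ (diagOp b (abs_indicator_one_le t (B j)) x)
          (diagOp b (abs_indicator_one_le t (B k)) y) = 0 := by
      intro j k hjk x y
      rw [← b.tsum_inner_mul_inner]
      convert! tsum_zero with i
      rw [← inner_conj_symm, coeff_diagOp, coeff_diagOp]
      by_cases h : t i ∈ B j
      · have h' : t i ∉ B k := fun h' => Set.disjoint_left.1 (hd hjk) h h'
        simp [h']
      · simp [h]
    -- Strong countable additivity: disjoint sets give orthogonal ranges, so it suffices to bound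
    -- the partial sums of squared norms, which is done by comparing coordinates with those of u.
    have hsum : Summable fun j => diagOp b (abs_indicator_one_le t (B j)) u := by
      have hV : OrthogonalFamily ℂ
          (fun j => LinearMap.range (diagOp b (abs_indicator_one_le t (B j))).toLinearMap)
          fun j => (LinearMap.range
            (diagOp b (abs_indicator_one_le t (B j))).toLinearMap).subtypeₗᵢ := by
        rintro j k hjk ⟨_, x, rfl⟩ ⟨_, y, rfl⟩
        exact horth j k hjk x y
      have hm : ∀ j, diagOp b (abs_indicator_one_le t (B j)) u ∈
          LinearMap.range (diagOp b (abs_indicator_one_le t (B j))).toLinearMap := fun j =>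
        LinearMap.mem_range_self _ u
      refine (hV.summable_iff_norm_sq_summable (fun j => ⟨_, hm j⟩)).2 ?_
      refine summable_of_sum_le (c := ‖u‖ ^ 2) (fun _ => by positivity) fun F => ?_
      have h1 := hV.norm_sum (fun j => ⟨_, hm j⟩) F
      simp only [Submodule.coe_subtypeₗᵢ, Submodule.subtype_apply, Submodule.coe_norm] at h1
      simp only [Submodule.coe_norm]
      rw [← h1]
      refine hasSum_le (fun i => ?_) (hasSum_sq_coeff b _) (hasSum_sq_coeff b u)
      rw [inner_sum]
      simp_rw [hcoef]
      -- By disjointness at most one j contributes to a given coordinate.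
      by_cases hi : ∃ j ∈ F, t i ∈ B j
      · obtain ⟨j, hj, hij⟩ := hi
        rw [Finset.sum_eq_single j, if_pos hij]
        · intro k _ hkj
          exact if_neg fun hk => Set.disjoint_left.1 (hd hkj) hk hij
        · exact fun h => absurd hj h
      · rw [Finset.sum_eq_zero]
        · rw [norm_zero, zero_pow two_ne_zero]
          exact sq_nonneg _
        · exact fun j hj => if_neg fun h => hi ⟨j, hj, h⟩
    have heq : ∑' j, diagOp b (abs_indicator_one_le t (B j)) u =
        diagOp b (abs_indicator_one_le t (⋃ j, B j)) u := by
      refine eq_of_coeff_eq b fun i => ?_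
      have h1 := hsum.hasSum.mapL (innerSL ℂ (b i))
      simp only [innerSL_apply_apply, hcoef] at h1
      rw [← h1.tsum_eq, coeff_diagOp]
      by_cases hi : ∃ j, t i ∈ B j
      · obtain ⟨j, hij⟩ := hi
        rw [tsum_eq_single j, if_pos hij]
        · have : t i ∈ ⋃ j, B j := Set.mem_iUnion.2 ⟨j, hij⟩
          simp [this]
        · intro k hkj
          exact if_neg fun hk => Set.disjoint_left.1 (hd hkj) hk hij
      · have : t i ∉ ⋃ j, B j := fun h => hi (Set.mem_iUnion.1 h)
        simp only [Set.indicator_of_notMem this]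
        push Not at hi
        simp [hi]
    rw [← heq]
    exact hsum.hasSum

theorem scalarMeasure_apply (E : ProjectionValuedMeasure H) (u : H) {B : Set ℝ}
    (hB : MeasurableSet B) : E.scalarMeasure u B = ENNReal.ofReal (‖E.proj B u‖ ^ 2) :=
  Measure.ofMeasurable_apply B hB

/-- By Parseval the mass of B is the sum of the squared coefficients with t i ∈ B. The measure is
thus purely atomic and its moments become series over the basis. -/
theorem scalarMeasure_diagMeasure (u : H) :
    (diagMeasure b t).scalarMeasure u =
      Measure.sum fun i => ENNReal.ofReal (‖inner ℂ (b i) u‖ ^ 2) • Measure.dirac (t i) := by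
  refine Measure.ext fun B hB => ?_
  rw [scalarMeasure_apply _ _ hB, Measure.sum_apply _ hB]
  have h := hasSum_sq_coeff b ((diagMeasure b t).proj B u)
  rw [← h.tsum_eq, ENNReal.ofReal_tsum_of_nonneg (fun _ => by positivity) h.summable]
  refine tsum_congr fun i => ?_
  rw [Measure.smul_apply, Measure.dirac_apply' _ hB, smul_eq_mul]
  simp only [diagMeasure]
  rw [coeff_diagOp]
  by_cases h : t i ∈ B <;> simp [h]

theorem lintegral_scalarMeasure_diagMeasure (u : H) {f : ℝ → ℝ≥0∞} (hf : Measurable f) :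
    ∫⁻ s, f s ∂((diagMeasure b t).scalarMeasure u) =
      ∑' i, ENNReal.ofReal (‖inner ℂ (b i) u‖ ^ 2) * f (t i) := by
  rw [scalarMeasure_diagMeasure, lintegral_sum_measure]
  refine tsum_congr fun i => ?_
  rw [lintegral_smul_measure, lintegral_dirac' _ hf, smul_eq_mul]

instance isFiniteMeasure_scalarMeasure (E : ProjectionValuedMeasure H) (u : H) :
    IsFiniteMeasure (E.scalarMeasure u) :=
  ⟨by rw [scalarMeasure_apply _ _ MeasurableSet.univ]; exact ENNReal.ofReal_lt_top⟩

theorem memLp_two_id_scalarMeasure {E : ProjectionValuedMeasure H} {u : H}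
    (h : ∫⁻ s, ENNReal.ofReal (s ^ 2) ∂(E.scalarMeasure u) < ∞) :
    MemLp (fun s : ℝ => s) 2 (E.scalarMeasure u) := by
  refine ⟨by fun_prop, ?_⟩
  rw [eLpNorm_lt_top_iff_lintegral_rpow_enorm_lt_top two_ne_zero ENNReal.ofNat_ne_top]
  convert! h using 2
  funext s
  rw [← ofReal_norm, ENNReal.toReal_ofNat, ENNReal.ofReal_rpow_of_nonneg (norm_nonneg _) zero_le_two,
    Real.rpow_two, Real.norm_eq_abs, sq_abs]

/-- The scalar measure is finite, so a finite second moment gives a finite first moment; on the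
domain of the operator the integral of t is therefore a genuine one. -/
theorem integrable_id_scalarMeasure {E : ProjectionValuedMeasure H} {u : H}
    (h : ∫⁻ s, ENNReal.ofReal (s ^ 2) ∂(E.scalarMeasure u) < ∞) :
    Integrable (fun s : ℝ => s) (E.scalarMeasure u) :=
  (memLp_two_id_scalarMeasure h).integrable one_le_two

theorem integral_scalarMeasure_diagMeasure (u : H)
    (h : Integrable (fun s : ℝ => s) ((diagMeasure b t).scalarMeasure u)) :
    HasSum (fun i => ‖inner ℂ (b i) u‖ ^ 2 * t i)
      (∫ s, s ∂((diagMeasure b t).scalarMeasure u)) := by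
  rw [scalarMeasure_diagMeasure] at h ⊢
  refine (hasSum_integral_measure h).congr_fun fun i => ?_
  rw [integral_smul_measure, integral_dirac, ENNReal.toReal_ofReal (by positivity), smul_eq_mul]

end DiagonalSpectralMeasure

/-! ### Spectral resolution of an operator with compact resolvent -/

section CompactResolvent

universe u

variable {H : Type u} [NormedAddCommGroup H] [InnerProductSpace ℂ H] [CompleteSpace H]

/-- An operator `A` such that `A u = f` is equivalent to `u = R (f + u)`, where `R` has an
orthonormal basis of eigenvectors with positive eigenvalues, has a spectral measure. -/
theorem isSpectralMeasureOf_diagMeasure {ι : Type*} (b : HilbertBasis ι ℂ H) {r : ι → ℝ}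
    {R : H →L[ℂ] H} (hr : ∀ i, 0 < r i) (hb : ∀ i, R (b i) = (r i : ℂ) • b i)
    (hR : IsSelfAdjoint R) {A : H →ₗ.[ℂ] H}
    (hA : ∀ u f, (∃ h : u ∈ A.domain, A ⟨u, h⟩ = f) ↔ u = R (f + u)) :
    (diagMeasure b fun i => 1 / r i - 1).IsSpectralMeasureOf A := by
  have hsym := ContinuousLinearMap.isSelfAdjoint_iff_isSymmetric.1 hR
  have hcoef : ∀ i h, inner ℂ (b i) (R h) = (r i : ℂ) * inner ℂ (b i) h := fun i h => by
    have : inner ℂ (R (b i)) h = inner ℂ (b i) (R h) := hsym (b i) h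
    rw [← this, hb, inner_smul_left, Complex.conj_ofReal]
  -- Eigenvalues of R are bounded by its norm, so the coefficients 1 - r i act boundedly.
  have hbound : ∀ i, |1 - r i| ≤ 1 + ‖R‖ := fun i => by
    have h1 : ‖R (b i)‖ ≤ ‖R‖ * ‖b i‖ := R.le_opNorm _
    rw [hb, norm_smul, b.orthonormal.1, mul_one, mul_one, Complex.norm_real, Real.norm_eq_abs] at h1
    calc |1 - r i| ≤ |1| + |r i| := abs_sub _ _
      _ ≤ _ := by rw [abs_one]; gcongr
  -- With h = Au + u the right side is the coefficient of h - u = Au, which identifies 1/r - 1 as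
  -- the eigenvalue of A.
  have hmain : ∀ u h, u = R h → ∀ i, ((1 / r i - 1 : ℝ) : ℂ) * inner ℂ (b i) u =
      ((1 - r i : ℝ) : ℂ) * inner ℂ (b i) h := fun u h hu i => by
    rw [hu, hcoef, ← mul_assoc, ← Complex.ofReal_mul]
    congr 2
    have := (hr i).ne'
    field_simp
  have hlint : ∀ u, ∫⁻ s, ENNReal.ofReal (s ^ 2)
      ∂((diagMeasure b fun i => 1 / r i - 1).scalarMeasure u) =
      ∑' i, ENNReal.ofReal (‖((1 / r i - 1 : ℝ) : ℂ) * inner ℂ (b i) u‖ ^ 2) := fun u => by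
    rw [lintegral_scalarMeasure_diagMeasure b _ u (by fun_prop)]
    refine tsum_congr fun i => ?_
    rw [← ENNReal.ofReal_mul (by positivity), norm_mul, mul_pow, Complex.norm_real,
      Real.norm_eq_abs, sq_abs, mul_comm]
  have hfwd : ∀ u, u ∈ A.domain → ∫⁻ s, ENNReal.ofReal (s ^ 2)
      ∂((diagMeasure b fun i => 1 / r i - 1).scalarMeasure u) < ∞ := fun u hu => by
    have := (hA u (A ⟨u, hu⟩)).1 ⟨hu, rfl⟩
    rw [hlint, lt_top_iff_ne_top]
    simp_rw [hmain u _ this]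
    exact (summable_sq_mul b hbound _).tsum_ofReal_ne_top
  refine ⟨fun u => ⟨hfwd u, fun h => ?_⟩, fun u => ?_⟩
  · rw [hlint] at h
    -- A finite second moment says that the candidate coefficients of Au are square summable. The
    -- vector f having them satisfies u = R(f + u), so u lies in the domain.
    have hs : Summable fun i => ‖((1 / r i - 1 : ℝ) : ℂ) * inner ℂ (b i) u‖ ^ 2 := by
      have := ENNReal.summable_toReal h.ne
      simpa only [ENNReal.toReal_ofReal (sq_nonneg _)] using this
    obtain ⟨f, hf⟩ := exists_of_summable_sq b hs
    refine ((hA u f).2 (eq_of_coeff_eq b fun i => ?_)).1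
    rw [hcoef, inner_add_right, hf]
    have := (hr i).ne'
    have h2 : (r i : ℂ) ≠ 0 := by exact_mod_cast this
    push_cast
    field_simp
    ring
  · have hu := (hA u (A u)).1 ⟨u.2, rfl⟩
    have hint := integrable_id_scalarMeasure (hfwd u u.2)
    have h1 := Complex.hasSum_ofReal.mpr (integral_scalarMeasure_diagMeasure b _ (u : H) hint)
    have h2 := b.hasSum_inner_mul_inner (u : H) (A u)
    refine h2.unique (h1.congr_fun fun i => ?_)
    have h3 := hmain u _ hu i
    have h4 : inner ℂ (b i) (A u) = ((1 / r i - 1 : ℝ) : ℂ) * inner ℂ (b i) (u : H) := by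
      rw [h3]
      have h5 := congrArg (fun x => inner ℂ (b i) x) hu
      simp only [hcoef, inner_add_right] at h5
      push_cast
      rw [inner_add_right]
      linear_combination - h5
    rw [h4, ← inner_conj_symm (u : H) (b i)]
    push_cast
    rw [← Complex.conj_mul']
    ring

/-- Positivity of the quadratic form makes every eigenvalue of R positive, as needed for 1/r - 1 to
make sense. -/
theorem exists_isSpectralMeasureOf {R : H →L[ℂ] H} (hc : IsCompactOperator R)
    (hR : IsSelfAdjoint R) (hpos : ∀ u, u ≠ 0 → 0 < (inner ℂ u (R u)).re) {A : H →ₗ.[ℂ] H}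
    (hA : ∀ u f, (∃ h : u ∈ A.domain, A ⟨u, h⟩ = f) ↔ u = R (f + u)) :
    ∃ E : ProjectionValuedMeasure H, E.IsSpectralMeasureOf A := by
  obtain ⟨ι, b, r, hb⟩ := exists_hilbertBasis_eigenvectors hc hR
  refine ⟨_, isSpectralMeasureOf_diagMeasure b (fun i => ?_) hb hR hA⟩
  have h := hpos (b i) (b.orthonormal.ne_zero i)
  rw [hb, inner_smul_right, inner_self_eq_norm_sq_to_K, b.orthonormal.1] at h
  simpa using h

/-- A compact self-adjoint operator has an eigenvalue at least as large as any value of its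
quadratic form on the unit sphere. -/
theorem exists_eigenvalue_ge {R : H →L[ℂ] H} (hc : IsCompactOperator R) (hR : IsSelfAdjoint R)
    {u : H} (hu : ‖u‖ = 1) :
    ∃ (r : ℝ) (φ : H), ‖φ‖ = 1 ∧ R φ = (r : ℂ) • φ ∧ (inner ℂ u (R u)).re ≤ r := by
  obtain ⟨ι, b, r, hb⟩ := exists_hilbertBasis_eigenvectors hc hR
  have hsym := ContinuousLinearMap.isSelfAdjoint_iff_isSymmetric.1 hR
  by_contra! hcon
  have hlt : ∀ i, r i < (inner ℂ u (R u)).re := fun i => hcon (r i) (b i) (b.orthonormal.1 i) (hb i)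
  have h1 := Complex.hasSum_re (b.hasSum_inner_mul_inner u (R u))
  have hterm : ∀ i, (inner ℂ u (b i) * inner ℂ (b i) (R u)).re = r i * ‖inner ℂ (b i) u‖ ^ 2 := by
    intro i
    have : inner ℂ (R (b i)) u = inner ℂ (b i) (R u) := hsym (b i) u
    rw [← this, hb, inner_smul_left, Complex.conj_ofReal, ← inner_conj_symm u (b i),
      mul_left_comm, Complex.conj_mul', ← Complex.ofReal_pow, ← Complex.ofReal_mul,
      Complex.ofReal_re]
  simp only [hterm] at h1
  have h2 := (hasSum_sq_coeff b u).mul_left (inner ℂ u (R u)).re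
  rw [hu, one_pow, mul_one] at h2
  obtain ⟨i, hi⟩ : ∃ i, inner ℂ (b i) u ≠ 0 := by
    by_contra! h0
    have : u = 0 := eq_of_coeff_eq b fun i => by rw [h0, inner_zero_right]
    rw [this, norm_zero] at hu
    exact zero_ne_one hu
  -- On a unit vector the quadratic form is an average of the eigenvalues, so it cannot exceed all
  -- of them strictly; a nonzero coefficient of u supplies the strict term.
  have h3 := hasSum_lt (fun i => mul_le_mul_of_nonneg_right (hlt i).le (sq_nonneg _))
    (mul_lt_mul_of_pos_right (hlt i) (by positivity)) h1 h2
  exact lt_irrefl _ h3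

end CompactResolvent

end

section

/-! ### Spectral projections, eigenvectors and the form of the operator -/

namespace ProjectionValuedMeasure

variable {H : Type*} [NormedAddCommGroup H] [InnerProductSpace ℂ H] [CompleteSpace H]
  (E : ProjectionValuedMeasure H)

theorem proj_proj {B C : Set ℝ} (hB : MeasurableSet B) (hC : MeasurableSet C) (u : H) :
    E.proj B (E.proj C u) = E.proj (B ∩ C) u := by
  rw [E.inter B C hB hC, mul_apply_eq_comp]

theorem inner_proj_left {B : Set ℝ} (hB : MeasurableSet B) (u v : H) :
    inner ℂ (E.proj B u) v = inner ℂ u (E.proj B v) :=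
  ContinuousLinearMap.isSelfAdjoint_iff_isSymmetric.1
    (E.isStarProjection B hB).isSelfAdjoint u v

theorem proj_add_proj_compl {B : Set ℝ} (hB : MeasurableSet B) (u : H) :
    E.proj B u + E.proj Bᶜ u = u := by
  -- Finite additivity follows from countable additivity by padding with empty sets.
  have hs := E.hasSum_iUnion (fun n : ℕ => if n = 0 then B else if n = 1 then Bᶜ else ∅)
    (fun n => by split_ifs <;> simp [hB]) (fun i j hij => by
      simp only [Function.onFun]
      split_ifs <;> simp_all [disjoint_compl_right, disjoint_compl_left]) u
  have hU : (⋃ n : ℕ, if n = 0 then B else if n = 1 then Bᶜ else ∅) = Set.univ := by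
    refine Set.eq_univ_of_forall fun x => ?_
    by_cases hx : x ∈ B
    · exact Set.mem_iUnion.2 ⟨0, by simpa using hx⟩
    · exact Set.mem_iUnion.2 ⟨1, by simpa using hx⟩
  rw [hU, E.univ] at hs
  have h2 := hasSum_sum_of_ne_finset_zero (L := SummationFilter.unconditional ℕ) (s := Finset.range 2)
    (f := fun n : ℕ => E.proj (if n = 0 then B else if n = 1 then Bᶜ else ∅) u) (fun n hn => by
      have h0 : n ≠ 0 := by rintro rfl; simp at hn
      have h1 : n ≠ 1 := by rintro rfl; simp at hn
      simp [h0, h1, E.empty])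
  have := h2.unique hs
  simpa [Finset.sum_range_succ] using this

theorem scalarMeasure_proj {B : Set ℝ} (hB : MeasurableSet B) (u : H) :
    E.scalarMeasure (E.proj B u) = (E.scalarMeasure u).restrict B := by
  refine Measure.ext fun C hC => ?_
  rw [Measure.restrict_apply hC, scalarMeasure_apply _ _ hC, scalarMeasure_apply _ _ (hC.inter hB),
    E.proj_proj hC hB]

/-- The cross terms vanish because E(B)E(C)E(Bᶜ) = 0 for every C, so Pythagoras applies after
projecting onto C. -/
theorem scalarMeasure_add {B : Set ℝ} (hB : MeasurableSet B) (u w : H) :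
    E.scalarMeasure (E.proj B u + E.proj Bᶜ w) =
      E.scalarMeasure (E.proj B u) + E.scalarMeasure (E.proj Bᶜ w) := by
  refine Measure.ext fun C hC => ?_
  rw [Measure.add_apply, scalarMeasure_apply _ _ hC, scalarMeasure_apply _ _ hC,
    scalarMeasure_apply _ _ hC, ← ENNReal.ofReal_add (by positivity) (by positivity), map_add]
  congr 1
  have h0 : inner ℂ (E.proj C (E.proj B u)) (E.proj C (E.proj Bᶜ w)) = 0 := by
    rw [E.inner_proj_left hC, E.proj_proj hC hC, Set.inter_self, E.inner_proj_left hB,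
      E.proj_proj hC hB.compl, E.proj_proj hB (hC.inter hB.compl)]
    have : B ∩ (C ∩ Bᶜ) = ∅ := by ext; simp; tauto
    rw [this, E.empty]
    simp
  have := norm_add_sq_eq_norm_sq_add_norm_sq_of_inner_eq_zero _ _ h0
  rw [sq, sq, sq, this]

variable {E} {A : H →ₗ.[ℂ] H}

theorem IsSpectralMeasureOf.proj_mem_domain (hE : E.IsSpectralMeasureOf A)
    {B : Set ℝ} (hB : MeasurableSet B) {u : H}
    (hu : u ∈ A.domain) : E.proj B u ∈ A.domain := by
  rw [hE.1] at hu ⊢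
  rw [E.scalarMeasure_proj hB]
  exact (lintegral_mono' Measure.restrict_le_self le_rfl).trans_lt hu

theorem IsSpectralMeasureOf.proj_Icc_mem_domain (hE : E.IsSpectralMeasureOf A)
    (a c : ℝ) (u : H) :
    E.proj (Set.Icc a c) u ∈ A.domain := by
  rw [hE.1, E.scalarMeasure_proj measurableSet_Icc]
  calc ∫⁻ s in Set.Icc a c, ENNReal.ofReal (s ^ 2) ∂(E.scalarMeasure u)
      ≤ ∫⁻ s in Set.Icc a c, ENNReal.ofReal ((|a| + |c|) ^ 2) ∂(E.scalarMeasure u) := by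
        refine setLIntegral_mono measurable_const fun s hs => ENNReal.ofReal_le_ofReal ?_
        refine sq_le_sq' ?_ ?_
        · linarith [hs.1, neg_abs_le a, abs_nonneg c]
        · linarith [hs.2, le_abs_self c, abs_nonneg a]
    _ < ∞ := by
        rw [lintegral_const]
        exact ENNReal.mul_lt_top ENNReal.ofReal_lt_top (measure_lt_top _ _)

/-- The definition of a spectral measure only gives the diagonal values (Ax, x). Since the scalar
measure of E(B)u + cE(Bᶜ)w is additive, the cross terms cancel for each phase c, and two phases
separate them. -/
theorem IsSpectralMeasureOf.inner_proj_compl (hE : E.IsSpectralMeasureOf A)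
    {B : Set ℝ} (hB : MeasurableSet B) {u w : H}
    (hu : E.proj B u ∈ A.domain) (hw : E.proj Bᶜ w ∈ A.domain) :
    inner ℂ (E.proj B u) (A ⟨_, hw⟩) = 0 := by
  have hI : ∀ x : A.domain, Integrable (fun s : ℝ => s) (E.scalarMeasure (x : H)) := fun x =>
    integrable_id_scalarMeasure ((hE.1 _).1 x.2)
  have hq : ∀ c : ℂ, ‖c‖ = 1 →
      inner ℂ (E.proj B u) (A (c • ⟨_, hw⟩)) + inner ℂ (c • E.proj Bᶜ w) (A ⟨_, hu⟩) = 0 := by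
    intro c hc
    set x : A.domain := ⟨_, hu⟩ with hx
    set y : A.domain := ⟨_, hw⟩ with hy
    have h1 := hE.2 x
    have h2 := hE.2 (c • y)
    have h3 := hE.2 (x + c • y)
    have hm : E.scalarMeasure ((x + c • y : A.domain) : H) =
        E.scalarMeasure (x : H) + E.scalarMeasure ((c • y : A.domain) : H) := by
      have := E.scalarMeasure_add hB u (c • w)
      rw [map_smul] at this
      exact this
    rw [hm, integral_add_measure (hI x) (hI (c • y)), Complex.ofReal_add, ← h1, ← h2] at h3
    rw [LinearPMap.map_add] at h3
    rw [Submodule.coe_add, inner_add_left, inner_add_right, inner_add_right] at h3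
    have e1 : ((c • y : A.domain) : H) = c • E.proj Bᶜ w := rfl
    have e2 : (x : H) = E.proj B u := rfl
    rw [e1, e2] at h3
    linear_combination h3
  -- The phases 1 and i: the first gives p + q = 0, the second p - q = 0 for the two cross terms.
  have h1 := hq 1 norm_one
  have h2 := hq Complex.I Complex.norm_I
  rw [LinearPMap.map_smul, inner_smul_left, inner_smul_right] at h1 h2
  rw [map_one] at h1
  rw [Complex.conj_I] at h2
  have h3 : Complex.I * (2 * inner ℂ (E.proj B u) (A ⟨_, hw⟩)) = 0 := by
    linear_combination h2 + Complex.I * h1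
  rcases mul_eq_zero.1 h3 with h | h
  · exact absurd h Complex.I_ne_zero
  · exact (mul_eq_zero.1 h).resolve_left two_ne_zero

/-- An eigenvector has no spectral mass in a set that lies strictly on one side of the
eigenvalue. -/
theorem IsSpectralMeasureOf.proj_eq_zero_of_eigenvector (hE : E.IsSpectralMeasureOf A)
    {φ : H} (hφ : φ ∈ A.domain) {lam : ℝ}
    (heig : A ⟨φ, hφ⟩ = (lam : ℂ) • φ) {B : Set ℝ} (hB : MeasurableSet B)
    (hside : (∀ s ∈ B, lam < s) ∨ ∀ s ∈ B, s < lam) : E.proj B φ = 0 := by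
  have hu := hE.proj_mem_domain hB hφ
  have hw := hE.proj_mem_domain hB.compl hφ
  have h1 := hE.inner_proj_compl hB hu hw
  have hsum : (⟨φ, hφ⟩ : A.domain) = ⟨_, hu⟩ + ⟨_, hw⟩ :=
    Subtype.ext (E.proj_add_proj_compl hB φ).symm
  have h2 : inner ℂ (E.proj B φ) (A ⟨_, hu⟩) = ((lam * ‖E.proj B φ‖ ^ 2 : ℝ) : ℂ) := by
    have : inner ℂ (E.proj B φ) (A ⟨φ, hφ⟩) = inner ℂ (E.proj B φ) (A ⟨_, hu⟩) := by
      rw [hsum, LinearPMap.map_add, inner_add_right, h1, add_zero]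
    rw [← this, heig, inner_smul_right, E.inner_proj_left hB, E.inner_proj_self hB]
    push_cast; ring
  have h3 := hE.2 ⟨_, hu⟩
  have hint := integrable_id_scalarMeasure ((hE.1 _).1 hu)
  have h4 := Complex.ofReal_injective (h2.symm.trans h3)
  simp only at h4
  rw [E.scalarMeasure_proj hB] at h4 hint
  have hreal : ((E.scalarMeasure φ).restrict B).real Set.univ = ‖E.proj B φ‖ ^ 2 := by
    rw [Measure.real, Measure.restrict_apply_univ, scalarMeasure_apply _ _ hB,
      ENNReal.toReal_ofReal (by positivity)]
  -- The form on E(B)φ is λ‖E(B)φ‖² by the eigenvalue equation and ∫ s over B by the spectral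
  -- formula. Hence s - λ, of strict constant sign on B, integrates to zero and B is a null set.
  have h5 : ∫ s in B, (s - lam) ∂(E.scalarMeasure φ) = 0 := by
    rw [integral_sub hint (integrable_const _), integral_const, hreal, ← h4, smul_eq_mul]
    ring
  have hint2 : IntegrableOn (fun s => s - lam) B (E.scalarMeasure φ) :=
    hint.sub (integrable_const _)
  have h6 : E.scalarMeasure φ B = 0 := by
    rcases hside with h | h
    · have := (setIntegral_pos_iff_support_of_nonneg_ae
        ((ae_restrict_iff' hB).2 (Filter.Eventually.of_forall fun s hs =>
          (sub_pos.2 (h s hs)).le)) hint2).not.1 h5.not_gt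
      rw [not_lt, nonpos_iff_eq_zero] at this
      refine measure_mono_null (fun s hs => ?_) this
      exact ⟨(sub_pos.2 (h s hs)).ne', hs⟩
    · have h5' : ∫ s in B, (lam - s) ∂(E.scalarMeasure φ) = 0 := by
        rw [← neg_eq_zero, ← integral_neg, ← h5]
        simp only [neg_sub]
      have hint3 : IntegrableOn (fun s => lam - s) B (E.scalarMeasure φ) := by
        refine hint2.neg.congr (Filter.Eventually.of_forall fun s => ?_)
        simp
      have := (setIntegral_pos_iff_support_of_nonneg_ae
        ((ae_restrict_iff' hB).2 (Filter.Eventually.of_forall fun s hs =>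
          (sub_pos.2 (h s hs)).le)) hint3).not.1 h5'.not_gt
      rw [not_lt, nonpos_iff_eq_zero] at this
      refine measure_mono_null (fun s hs => ?_) this
      exact ⟨(sub_pos.2 (h s hs)).ne', hs⟩
  rw [scalarMeasure_apply _ _ hB, ENNReal.ofReal_eq_zero] at h6
  have : ‖E.proj B φ‖ ^ 2 = 0 := le_antisymm h6 (by positivity)
  simpa using this

/-- An eigenvector has no mass above c and none below a, so both complementary projections fix it.
-/
theorem IsSpectralMeasureOf.proj_Icc_eigenvector (hE : E.IsSpectralMeasureOf A)
    {φ : H} (hφ : φ ∈ A.domain) {lam a c : ℝ}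
    (heig : A ⟨φ, hφ⟩ = (lam : ℂ) • φ) (ha : a ≤ lam) (hc : lam ≤ c) :
    E.proj (Set.Icc a c) φ = φ := by
  have h1 := hE.proj_eq_zero_of_eigenvector hφ heig (measurableSet_Ioi (a := c))
    (Or.inl fun s hs => hc.trans_lt hs)
  have h2 := hE.proj_eq_zero_of_eigenvector hφ heig (measurableSet_Iio (a := a))
    (Or.inr fun s hs => lt_of_lt_of_le hs ha)
  have h3 := E.proj_add_proj_compl (measurableSet_Ioi (a := c)) φ
  have h4 := E.proj_add_proj_compl (measurableSet_Iio (a := a)) φ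
  rw [h1, zero_add] at h3
  rw [h2, zero_add] at h4
  have : Set.Icc a c = (Set.Iio a)ᶜ ∩ (Set.Ioi c)ᶜ := by ext; simp
  rw [this, ← E.proj_proj measurableSet_Iio.compl measurableSet_Ioi.compl, h3, h4]

theorem IsSpectralMeasureOf.re_inner_proj_Icc_le (hE : E.IsSpectralMeasureOf A)
    (a c : ℝ) (u : H) :
    (inner ℂ (E.proj (Set.Icc a c) u) (A ⟨_, hE.proj_Icc_mem_domain a c u⟩)).re ≤
      c * ‖E.proj (Set.Icc a c) u‖ ^ 2 := by
  have hint := integrable_id_scalarMeasure ((hE.1 _).1 (hE.proj_Icc_mem_domain a c u))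
  rw [hE.2 ⟨_, hE.proj_Icc_mem_domain a c u⟩, Complex.ofReal_re]
  simp only
  have hB : MeasurableSet (Set.Icc a c) := measurableSet_Icc
  have hreal : ((E.scalarMeasure u).restrict (Set.Icc a c)).real Set.univ =
      ‖E.proj (Set.Icc a c) u‖ ^ 2 := by
    rw [Measure.real, Measure.restrict_apply_univ, scalarMeasure_apply _ _ hB,
      ENNReal.toReal_ofReal (by positivity)]
  rw [E.scalarMeasure_proj hB] at hint ⊢
  calc ∫ s in Set.Icc a c, s ∂(E.scalarMeasure u) ≤ ∫ s in Set.Icc a c, c ∂(E.scalarMeasure u) :=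
        setIntegral_mono_on hint (integrable_const _) hB fun s hs => hs.2
    _ = c * ‖E.proj (Set.Icc a c) u‖ ^ 2 := by
        rw [integral_const, hreal, smul_eq_mul, mul_comm]

/-- If the quadratic form of `A` exceeds `c` on the orthogonal complement of a vector `e` and `φ` is
a normalized eigenvector with eigenvalue in `[0, c]`, then the spectral projection for `[0, c]` is
the projection onto `φ`. -/
theorem IsSpectralMeasureOf.proj_Icc_eq (hE : E.IsSpectralMeasureOf A)
    {φ e : H} (hφ : φ ∈ A.domain) (hφ1 : ‖φ‖ = 1)
    {lam c : ℝ} (heig : A ⟨φ, hφ⟩ = (lam : ℂ) • φ) (h0 : 0 ≤ lam) (hc : lam ≤ c)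
    (hgap : ∀ u : A.domain, inner ℂ e (u : H) = 0 →
      (inner ℂ (u : H) (A u)).re ≤ c * ‖(u : H)‖ ^ 2 → (u : H) = 0) (u : H) :
    E.proj (Set.Icc 0 c) u = inner ℂ φ u • φ := by
  have hF := hE.proj_Icc_eigenvector hφ heig h0 hc
  have hB : MeasurableSet (Set.Icc (0 : ℝ) c) := measurableSet_Icc
  have hker : ∀ w, inner ℂ e (E.proj (Set.Icc 0 c) w) = 0 → E.proj (Set.Icc 0 c) w = 0 :=
    fun w hw => hgap ⟨_, hE.proj_Icc_mem_domain 0 c w⟩ hw (hE.re_inner_proj_Icc_le 0 c w)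
  have hne : inner ℂ e φ ≠ 0 := fun h => by
    have := hker φ (by rwa [hF])
    rw [hF] at this
    rw [this, norm_zero] at hφ1
    exact zero_ne_one hφ1
  -- The range of the projection meets the complement of e trivially. The combination of its
  -- elements E u and φ that is orthogonal to e must vanish, which puts E u on the line of φ; the
  -- coefficient then comes from the symmetry of E.
  have h1 := hker (inner ℂ e φ • u - inner ℂ e (E.proj (Set.Icc 0 c) u) • φ) (by
    rw [map_sub, map_smul, map_smul, hF, inner_sub_right, inner_smul_right, inner_smul_right]
    ring)
  rw [map_sub, map_smul, map_smul, hF, sub_eq_zero] at h1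
  have h2 : E.proj (Set.Icc 0 c) u =
      ((inner ℂ e φ)⁻¹ * inner ℂ e (E.proj (Set.Icc 0 c) u)) • φ := by
    rw [mul_smul, ← h1, smul_smul, inv_mul_cancel₀ hne, one_smul]
  have h3 : inner ℂ φ (E.proj (Set.Icc 0 c) u) = inner ℂ φ u := by
    rw [← E.inner_proj_left hB, hF]
  rw [h2, inner_smul_right, inner_self_eq_norm_sq_to_K, hφ1] at h3
  rw [h2, ← h3]
  simp

end ProjectionValuedMeasure

end

section

variable {d : ℕ}

/-! ### The torus and the periodicity cell -/

theorem fracPart_of_mem_cell {x : Space d} (hx : x ∈ cell d) : fracPart x = x := by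
  ext i
  exact Int.fract_eq_self.2 (hx i)

theorem fracPart_add_latticePoint (x : Space d) (n : Fin d → ℤ) :
    fracPart (x + latticePoint n) = fracPart x := by
  ext i
  simp [fracPart, latticePoint]

/-- The Haar probability measure on the torus. -/
def torusMeasure (d : ℕ) : Measure (UnitAddTorus (Fin d)) :=
  Measure.pi fun _ => AddCircle.haarAddCircle

instance isProbabilityMeasure_torusMeasure : IsProbabilityMeasure (torusMeasure d) := by
  unfold torusMeasure; infer_instance

instance isAddLeftInvariant_torusMeasure : (torusMeasure d).IsAddLeftInvariant := by
  unfold torusMeasure; infer_instance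

/-- The projection onto the torus. -/
def toTorus (x : Space d) : UnitAddTorus (Fin d) := fun i => (x i : UnitAddCircle)

/-- The representative in the cell of a point of the torus. -/
def ofTorus (y : UnitAddTorus (Fin d)) : Space d :=
  WithLp.toLp 2 fun i => (AddCircle.measurableEquivIco (1 : ℝ) 0 (y i) : ℝ)

theorem measurable_ofTorus : Measurable (ofTorus : UnitAddTorus (Fin d) → Space d) := by
  have h : Measurable fun y : UnitAddTorus (Fin d) => fun i : Fin d =>
      (AddCircle.measurableEquivIco (1 : ℝ) 0 (y i) : ℝ) :=
    measurable_pi_lambda _ fun i => measurable_subtype_coe.comp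
      ((AddCircle.measurableEquivIco (1 : ℝ) 0).measurable.comp (measurable_pi_apply i))
  exact (MeasurableEquiv.toLp 2 (Fin d → ℝ)).measurable.comp h

theorem ofTorus_toTorus (x : Space d) : ofTorus (toTorus x) = fracPart x := by
  ext i
  have := AddCircle.coe_equivIco_mk_apply (1 : ℝ) (x i)
  rw [div_one, mul_one] at this
  exact this

theorem toTorus_add (x z : Space d) : toTorus (x + z) = toTorus x + toTorus z := by
  funext i
  simp [toTorus]

theorem measurePreserving_toTorus : MeasurePreserving toTorus (cellMeasure d) (torusMeasure d) := by
  have h1 := (PiLp.volume_preserving_ofLp (Fin d)).restrict_preimage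
    (MeasurableSet.univ_pi fun _ : Fin d => measurableSet_Ico (a := (0 : ℝ)) (b := 1))
  have hpre : (@WithLp.ofLp 2 (Fin d → ℝ)) ⁻¹' (Set.univ.pi fun _ => Set.Ico (0 : ℝ) 1) =
      cell d := by
    ext x; simp [cell]
  rw [hpre, volume_pi, Measure.restrict_pi_pi] at h1
  have h2 : MeasurePreserving (fun (x : Fin d → ℝ) i => (x i : UnitAddCircle))
      (Measure.pi fun _ : Fin d => volume.restrict (Set.Ico (0 : ℝ) 1)) (torusMeasure d) := by
    refine measurePreserving_pi _ _ fun i => ?_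
    rw [restrict_Ico_eq_restrict_Ioc]
    have := AddCircle.measurePreserving_mk (1 : ℝ) 0
    rw [zero_add, AddCircle.volume_eq_smul_haarAddCircle, ENNReal.ofReal_one, one_smul] at this
    exact this
  exact h2.comp h1

instance isProbabilityMeasure_cellMeasure : IsProbabilityMeasure (cellMeasure d) :=
  ⟨by rw [← Set.preimage_univ (f := toTorus), measurePreserving_toTorus.measure_preimage
    MeasurableSet.univ.nullMeasurableSet, measure_univ]⟩

theorem ae_fracPart_eq : ∀ᵐ x ∂(cellMeasure d), fracPart x = x :=
  (ae_restrict_iff' (measurableSet_cell d)).2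
    (Filter.Eventually.of_forall fun _ hx => fracPart_of_mem_cell hx)

theorem measurePreserving_ofTorus : MeasurePreserving ofTorus (torusMeasure d) (cellMeasure d) := by
  refine ⟨measurable_ofTorus, ?_⟩
  rw [← measurePreserving_toTorus.map_eq,
    Measure.map_map measurable_ofTorus measurePreserving_toTorus.measurable]
  have : (ofTorus ∘ toTorus : Space d → Space d) =ᵐ[cellMeasure d] id := by
    filter_upwards [ae_fracPart_eq] with x hx
    rw [Function.comp_apply, ofTorus_toTorus, hx, id]
  rw [Measure.map_congr this, Measure.map_id]

/-- Translations of the torus, read in the cell, preserve the Lebesgue measure. -/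
theorem measurePreserving_fracPart_add (z : Space d) :
    MeasurePreserving (fun x => fracPart (x + z)) (cellMeasure d) (cellMeasure d) := by
  have h1 : MeasurePreserving (fun y => toTorus z + y) (torusMeasure d) (torusMeasure d) :=
    measurePreserving_add_left _ _
  have := (measurePreserving_ofTorus.comp h1).comp (measurePreserving_toTorus (d := d))
  convert! this using 1
  funext x
  simp only [Function.comp_apply]
  rw [← toTorus_add, ofTorus_toTorus, add_comm]

/-! ### The Fourier basis of `L₂(Ω)` -/

/-- The frequency `2πn`. -/
def freq (n : Fin d → ℤ) : Space d := (2 * Real.pi) • latticePoint n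

/-- The character `x ↦ e^{i⟨k,x⟩}`. -/
def expChar (k x : Space d) : ℂ := Complex.exp (Complex.I * ((inner ℝ k x : ℝ) : ℂ))

theorem norm_expChar (k x : Space d) : ‖expChar k x‖ = 1 := by
  rw [expChar, mul_comm, Complex.norm_exp_ofReal_mul_I]

theorem expChar_add_right (k x y : Space d) : expChar k (x + y) = expChar k x * expChar k y := by
  rw [expChar, expChar, expChar, ← Complex.exp_add, inner_add_right]
  push_cast; ring_nf

theorem expChar_add_left (k l x : Space d) : expChar (k + l) x = expChar k x * expChar l x := by
  rw [expChar, expChar, expChar, ← Complex.exp_add, inner_add_left]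
  push_cast; ring_nf

theorem expChar_zero_left (x : Space d) : expChar 0 x = 1 := by simp [expChar]

theorem measurable_expChar (k : Space d) : Measurable (expChar k) := by
  unfold expChar; fun_prop

theorem normSq_one_sub_expChar (k x : Space d) :
    ‖1 - expChar k x‖ ^ 2 = 2 * (1 - Real.cos (inner ℝ k x)) := by
  rw [← Complex.normSq_eq_norm_sq, expChar, mul_comm, Complex.exp_mul_I, Complex.normSq_apply,
    ← Complex.ofReal_cos, ← Complex.ofReal_sin]
  simp only [Complex.sub_re, Complex.one_re, Complex.add_re, Complex.ofReal_re, Complex.mul_re,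
    Complex.I_re, Complex.sub_im, Complex.one_im, Complex.add_im, Complex.ofReal_im, Complex.mul_im,
    Complex.I_im, mul_zero, mul_one, zero_sub, sub_zero, add_zero, zero_add]
  nlinarith [Real.sin_sq_add_cos_sq (inner ℝ k x)]

theorem mFourier_toTorus (n : Fin d → ℤ) (x : Space d) :
    UnitAddTorus.mFourier n (toTorus x) = expChar (freq n) x := by
  simp only [UnitAddTorus.mFourier, toTorus, ContinuousMap.coe_mk, fourier_coe_apply, expChar,
    ← Complex.exp_sum]
  congr 1
  rw [freq, inner_smul_left, PiLp.inner_apply, Finset.mul_sum]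
  push_cast
  rw [Finset.mul_sum]
  refine Finset.sum_congr rfl fun i _ => ?_
  simp [latticePoint]
  ring

/-- The Fourier basis of the torus. -/
def torusBasis (d : ℕ) : HilbertBasis (Fin d → ℤ) ℂ (Lp ℂ 2 (torusMeasure d)) :=
  UnitAddTorus.mFourierBasis

theorem coeFn_torusBasis (n : Fin d → ℤ) :
    torusBasis d n =ᵐ[torusMeasure d] UnitAddTorus.mFourier n := by
  have h : torusBasis d n = UnitAddTorus.mFourierLp 2 n :=
    congrFun UnitAddTorus.coe_mFourierBasis n
  rw [h]
  exact UnitAddTorus.coeFn_mFourierLp 2 n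

/-- The identification of `L₂` of the torus with `L₂(Ω)`. -/
def torusIsometry (d : ℕ) : Lp ℂ 2 (torusMeasure d) ≃ₗᵢ[ℂ] L2Cell d :=
  LinearIsometryEquiv.ofSurjective
    (Lp.compMeasurePreservingₗᵢ ℂ toTorus measurePreserving_toTorus) fun u => by
      refine ⟨Lp.compMeasurePreserving ofTorus measurePreserving_ofTorus u, Lp.ext ?_⟩
      have h1 := Lp.coeFn_compMeasurePreserving u (measurePreserving_ofTorus (d := d))
      have h2 := Lp.coeFn_compMeasurePreserving
        (Lp.compMeasurePreserving ofTorus measurePreserving_ofTorus u)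
        (measurePreserving_toTorus (d := d))
      have h3 := measurePreserving_toTorus.quasiMeasurePreserving.ae_eq_comp h1
      filter_upwards [h2, h3, ae_fracPart_eq] with x hx2 hx3 hx
      change Lp.compMeasurePreserving toTorus measurePreserving_toTorus
        (Lp.compMeasurePreserving ofTorus measurePreserving_ofTorus u) x = u x
      rw [hx2, hx3]
      simp only [Function.comp_apply]
      rw [ofTorus_toTorus, hx]

/-- The Fourier basis `e^{2πi⟨n,x⟩}` of `L₂(Ω)`. -/
def fourierBasis (d : ℕ) : HilbertBasis (Fin d → ℤ) ℂ (L2Cell d) :=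
  HilbertBasis.ofRepr ((torusIsometry d).symm.trans (torusBasis d).repr)

theorem coeFn_fourierBasis (n : Fin d → ℤ) :
    fourierBasis d n =ᵐ[cellMeasure d] expChar (freq n) := by
  classical
  have h : fourierBasis d n = Lp.compMeasurePreserving toTorus measurePreserving_toTorus
      (torusBasis d n) := by
    rw [← HilbertBasis.repr_symm_single, ← HilbertBasis.repr_symm_single]
    rfl
  rw [h]
  have h1 := Lp.coeFn_compMeasurePreserving (torusBasis d n) (measurePreserving_toTorus (d := d))
  have h2 := measurePreserving_toTorus.quasiMeasurePreserving.ae_eq_comp (coeFn_torusBasis n)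
  filter_upwards [h1, h2] with x hx1 hx2
  rw [hx1, hx2, Function.comp_apply, mFourier_toTorus]

theorem freq_zero : freq (0 : Fin d → ℤ) = 0 := by
  ext i; simp [freq, latticePoint]

theorem fourierBasis_zero : fourierBasis d 0 = oneCell d := by
  refine Lp.ext ?_
  filter_upwards [coeFn_fourierBasis (d := d) 0, MemLp.coeFn_toLp (memLp_const (1 : ℂ) :
    MemLp (fun _ : Space d => (1 : ℂ)) 2 (cellMeasure d))] with x h1 h2
  rw [h1, freq_zero, expChar_zero_left]
  exact h2.symm

theorem norm_oneCell : ‖oneCell d‖ = 1 := by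
  rw [← fourierBasis_zero]; exact (fourierBasis d).orthonormal.1 0

theorem expChar_freq_fracPart (n : Fin d → ℤ) (x : Space d) :
    expChar (freq n) (fracPart x) = expChar (freq n) x := by
  rw [← mFourier_toTorus, ← mFourier_toTorus]
  congr 1
  funext i
  change ((Int.fract (x i) : ℝ) : UnitAddCircle) = (x i : UnitAddCircle)
  rw [← Int.self_sub_floor, AddCircle.coe_sub, sub_eq_self, AddCircle.coe_eq_zero_iff]
  exact ⟨⌊x i⌋, by simp⟩

/-- The translation by `z` of periodic functions. -/
def translate (z : Space d) : L2Cell d →ₗᵢ[ℂ] L2Cell d :=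
  Lp.compMeasurePreservingₗᵢ ℂ _ (measurePreserving_fracPart_add z)

theorem coeFn_translate (z : Space d) (u : L2Cell d) :
    translate z u =ᵐ[cellMeasure d] fun x => periodicExt u (x + z) :=
  Lp.coeFn_compMeasurePreserving u (measurePreserving_fracPart_add z)

theorem translate_fourierBasis (z : Space d) (n : Fin d → ℤ) :
    translate z (fourierBasis d n) = expChar (freq n) z • fourierBasis d n := by
  refine Lp.ext ?_
  have h := (measurePreserving_fracPart_add z).quasiMeasurePreserving.ae_eq_comp
    (coeFn_fourierBasis (d := d) n)
  filter_upwards [coeFn_translate z (fourierBasis d n), h, coeFn_fourierBasis (d := d) n,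
    Lp.coeFn_smul (expChar (freq n) z) (fourierBasis d n)] with x h1 h2 h3 h4
  rw [h1, h4, Pi.smul_apply, h3, smul_eq_mul, ← mul_comm, ← expChar_add_right,
    ← expChar_freq_fracPart]
  exact h2

theorem coeff_translate (z : Space d) (n : Fin d → ℤ) (u : L2Cell d) :
    inner ℂ (fourierBasis d n) (translate z u) =
      expChar (freq n) z * inner ℂ (fourierBasis d n) u := by
  have h := (translate z).inner_map_map (fourierBasis d n) u
  rw [translate_fourierBasis, inner_smul_left] at h
  have h2 : expChar (freq n) z * conj (expChar (freq n) z) = 1 := by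
    rw [Complex.mul_conj', norm_expChar]; simp
  rw [← h, ← mul_assoc, h2, one_mul]

theorem lintegral_sq_enorm {X : Type*} {_ : MeasurableSpace X} {ν : Measure X} (u : Lp ℂ 2 ν) :
    ∫⁻ x, ‖u x‖ₑ ^ 2 ∂ν = ENNReal.ofReal (‖u‖ ^ 2) := by
  rw [← ENNReal.toReal_ofReal (norm_nonneg u), ofReal_norm, ← ENNReal.toReal_pow,
    ENNReal.ofReal_toReal (by simp), Lp.enorm_def, eLpNorm_eq_lintegral_rpow_enorm_toReal
    two_ne_zero ENNReal.ofNat_ne_top, ENNReal.toReal_ofNat, ← ENNReal.rpow_two, ← ENNReal.rpow_mul]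
  simp

/-- The difference `u(x) - e^{i⟨ξ,y-x⟩} u(y)` for the periodic extension of `u`. -/
def twistDiff (ξ : Space d) (u : Space d → ℂ) (p : Space d × Space d) : ℂ :=
  periodicExt u p.1 - expChar ξ (p.2 - p.1) * periodicExt u p.2

/-- For fixed z the difference is u - e^{i⟨ξ,z⟩} times the translate of u. Translation is diagonal
in the Fourier basis, so Parseval applies with the multiplier 1 - e^{i⟨ξ+2πn,z⟩}. -/
theorem lintegral_twistDiff (ξ z : Space d) (u : L2Cell d) :
    ∫⁻ x, ‖twistDiff ξ u (x, x + z)‖ₑ ^ 2 ∂(cellMeasure d) =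
      ∑' n, ENNReal.ofReal (‖inner ℂ (fourierBasis d n) u‖ ^ 2) *
        ENNReal.ofReal (2 * (1 - Real.cos (inner ℝ (ξ + freq n) z))) := by
  have h1 : ∫⁻ x, ‖twistDiff ξ u (x, x + z)‖ₑ ^ 2 ∂(cellMeasure d) =
      ∫⁻ x, ‖(u - expChar ξ z • translate z u) x‖ₑ ^ 2 ∂(cellMeasure d) := by
    refine lintegral_congr_ae ?_
    filter_upwards [Lp.coeFn_sub u (expChar ξ z • translate z u), ae_fracPart_eq,
      Lp.coeFn_smul (expChar ξ z) (translate z u), coeFn_translate z u] with x h1 h2 h3 h4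
    rw [h1, Pi.sub_apply, h3, Pi.smul_apply, h4, smul_eq_mul, twistDiff, add_sub_cancel_left,
      periodicExt, h2]
  rw [h1, lintegral_sq_enorm, ← (hasSum_sq_coeff (fourierBasis d) _).tsum_eq,
    ENNReal.ofReal_tsum_of_nonneg (fun _ => by positivity)
      (hasSum_sq_coeff (fourierBasis d) _).summable]
  refine tsum_congr fun n => ?_
  rw [← ENNReal.ofReal_mul (by positivity), inner_sub_right, inner_smul_right, coeff_translate,
    ← mul_assoc, ← expChar_add_left, ← normSq_one_sub_expChar, ← mul_pow, ← norm_mul]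
  congr 3
  ring

end

section

variable {d : ℕ}

/-! ### Integrals of homogeneous kernels -/

/-- The radial majorant `min((R|z|)^p, (R|z|)^q) / |z|^{d+β}`. -/
def radialMin (d : ℕ) (β : ℝ) (p q : ℕ) (R : ℝ) (z : Space d) : ℝ :=
  min ((R * ‖z‖) ^ p) ((R * ‖z‖) ^ q) / ‖z‖ ^ ((d : ℝ) + β)

theorem radialMin_nonneg (β : ℝ) (p q : ℕ) {R : ℝ} (hR : 0 ≤ R) (z : Space d) :
    0 ≤ radialMin d β p q R z := by
  unfold radialMin; positivity

/-- In polar coordinates the integrand is y^{p-β-1} on (0,1] and y^{q-β-1} beyond; q < β < p is what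
both halves need. -/
theorem integrable_radialMin_one [NeZero d] {β : ℝ} {p q : ℕ} (hq : (q : ℝ) < β)
    (hp : β < p) : Integrable (radialMin d β p q 1) := by
  have hd : 1 ≤ d := NeZero.one_le
  have hd' : ((d - 1 : ℕ) : ℝ) = d - 1 := by push_cast [hd]; ring
  unfold radialMin
  simp only [one_mul]
  rw [integrable_fun_norm_addHaar volume
    (f := fun y : ℝ => min (y ^ p) (y ^ q) / y ^ ((d : ℝ) + β)), finrank_euclideanSpace,
    Fintype.card_fin]
  have hqp : q ≤ p := by exact_mod_cast (hq.trans hp).le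
  rw [← Set.Ioc_union_Ioi_eq_Ioi zero_le_one]
  refine IntegrableOn.union ?_ ?_
  · have h1 : IntegrableOn (fun y : ℝ => y ^ ((p : ℝ) - β - 1)) (Set.Ioc 0 1) :=
      (intervalIntegrable_iff_integrableOn_Ioc_of_le zero_le_one).1
        (intervalIntegral.intervalIntegrable_rpow' (by linarith))
    refine h1.congr_fun (fun y hy => ?_) measurableSet_Ioc
    have hy0 : 0 < y := hy.1
    simp only [smul_eq_mul]
    rw [min_eq_left (pow_le_pow_of_le_one hy0.le hy.2 hqp), ← Real.rpow_natCast,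
      ← Real.rpow_natCast, ← Real.rpow_sub hy0, ← Real.rpow_add hy0, hd']
    congr 1; ring
  · have h1 : IntegrableOn (fun y : ℝ => y ^ ((q : ℝ) - β - 1)) (Set.Ioi 1) :=
      integrableOn_Ioi_rpow_of_lt (by linarith) one_pos
    refine h1.congr_fun (fun y hy => ?_) measurableSet_Ioi
    have hy0 : 0 < y := one_pos.trans hy
    simp only [smul_eq_mul]
    rw [min_eq_right (pow_le_pow_right₀ (le_of_lt hy) hqp), ← Real.rpow_natCast,
      ← Real.rpow_natCast, ← Real.rpow_sub hy0, ← Real.rpow_add hy0, hd']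
    congr 1; ring

theorem radialMin_zero {β : ℝ} {p q : ℕ} (hp : 0 < p) (z : Space d) :
    radialMin d β p q 0 z = 0 := by
  have : min ((0 : ℝ) ^ p) (0 ^ q) = 0 := by
    rw [zero_pow hp.ne']
    exact min_eq_left (by positivity)
  simp only [radialMin, zero_mul, this, zero_div]

theorem radialMin_eq_smul {β : ℝ} {p q : ℕ} {R : ℝ} (hR : 0 < R) (z : Space d) :
    radialMin d β p q R z = R ^ ((d : ℝ) + β) * radialMin d β p q 1 (R • z) := by
  have h1 : ‖R • z‖ = R * ‖z‖ := by rw [norm_smul, Real.norm_of_nonneg hR.le]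
  unfold radialMin
  rw [h1, one_mul, Real.mul_rpow hR.le (norm_nonneg z)]
  have := Real.rpow_pos_of_pos hR ((d : ℝ) + β)
  rw [mul_div_assoc', mul_div_mul_left _ _ this.ne']

theorem integrable_radialMin [NeZero d] {β : ℝ} {p q : ℕ} (hq : (q : ℝ) < β)
    (hp : β < p) {R : ℝ} (hR : 0 ≤ R) : Integrable (radialMin d β p q R) := by
  have hp0 : 0 < p := by
    have : (0 : ℝ) < p := (Nat.cast_nonneg q).trans_lt (hq.trans hp)
    exact_mod_cast this
  rcases hR.eq_or_lt with rfl | hR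
  · have : radialMin d β p q 0 = fun _ => 0 := funext fun z => radialMin_zero hp0 z
    rw [this]
    exact integrable_zero _ _ _
  · have : radialMin d β p q R = fun z => R ^ ((d : ℝ) + β) * radialMin d β p q 1 (R • z) :=
      funext fun z => radialMin_eq_smul hR z
    rw [this]
    exact ((integrable_radialMin_one hq hp).comp_smul hR.ne').const_mul _

/-- The substitution z ↦ Rz. This homogeneity yields the powers |ξ|^α and |ξ|^{1+α} in the weighted
estimates below. -/
theorem integral_radialMin {β : ℝ} {p q : ℕ} (hq : (q : ℝ) < β)
    (hp : β < p) {R : ℝ} (hR : 0 ≤ R) :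
    ∫ z, radialMin d β p q R z = R ^ β * ∫ z, radialMin d β p q 1 z := by
  have hp0 : 0 < p := by
    have : (0 : ℝ) < p := (Nat.cast_nonneg q).trans_lt (hq.trans hp)
    exact_mod_cast this
  rcases hR.eq_or_lt with rfl | hR
  · simp only [radialMin_zero hp0]
    rw [Real.zero_rpow ((Nat.cast_nonneg q).trans_lt hq).ne']
    simp
  · simp only [radialMin_eq_smul hR]
    rw [integral_const_mul, Measure.integral_comp_smul, finrank_euclideanSpace, Fintype.card_fin,
      abs_of_pos (by positivity), smul_eq_mul, ← mul_assoc, Real.rpow_add hR, Real.rpow_natCast,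
      mul_right_comm (R ^ d), mul_inv_cancel₀ (by positivity), one_mul]

theorem one_sub_cos_le (t : ℝ) : 1 - Real.cos t ≤ 2 * min (|t| ^ 2) (|t| ^ 0) := by
  rw [pow_zero, sq_abs]
  have h1 := Real.one_sub_sq_div_two_le_cos (x := t)
  have h2 := Real.neg_one_le_cos t
  rcases le_total (t ^ 2) 1 with h | h
  · rw [min_eq_left h]; nlinarith [sq_nonneg t]
  · rw [min_eq_right h]; linarith

theorem min_pow_mono {p q : ℕ} {s t : ℝ} (hs : 0 ≤ s) (h : s ≤ t) :
    min (s ^ p) (s ^ q) ≤ min (t ^ p) (t ^ q) :=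
  min_le_min (pow_le_pow_left₀ hs h p) (pow_le_pow_left₀ hs h q)

/-- A kernel dominated in terms of `|⟨k,z⟩|` is dominated by a radial one. -/
theorem le_radialMin_of_le {β : ℝ} {p q : ℕ} {k z : Space d} {a C : ℝ} (hC : 0 ≤ C)
    (h : a ≤ C * min (|inner ℝ k z| ^ p) (|inner ℝ k z| ^ q)) :
    a / ‖z‖ ^ ((d : ℝ) + β) ≤ C * radialMin d β p q ‖k‖ z := by
  rw [radialMin, mul_div_assoc']
  refine div_le_div_of_nonneg_right (h.trans ?_) (by positivity)
  exact mul_le_mul_of_nonneg_left (min_pow_mono (abs_nonneg _) (abs_real_inner_le_norm k z)) hC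

theorem one_sub_cos_div_le (α : ℝ) (k z : Space d) :
    (1 - Real.cos (inner ℝ k z)) / ‖z‖ ^ ((d : ℝ) + α) ≤ 2 * radialMin d α 2 0 ‖k‖ z :=
  le_radialMin_of_le zero_le_two (one_sub_cos_le _)

theorem integrable_one_sub_cos_div [NeZero d] {α : ℝ} (h0 : 0 < α) (h2 : α < 2) (k : Space d) :
    Integrable fun z : Space d => (1 - Real.cos (inner ℝ k z)) / ‖z‖ ^ ((d : ℝ) + α) := by
  refine ((integrable_radialMin (p := 2) (q := 0) (by simpa using h0) (by simpa using h2)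
    (norm_nonneg k)).const_mul 2).mono'
    (by fun_prop : Measurable fun z : Space d => (1 - Real.cos (inner ℝ k z)) /
      ‖z‖ ^ ((d : ℝ) + α)).aestronglyMeasurable (Filter.Eventually.of_forall fun z => ?_)
  rw [Real.norm_of_nonneg (div_nonneg (by linarith [Real.cos_le_one (inner ℝ k z)]) (by positivity))]
  exact one_sub_cos_div_le α k z

theorem inner_single_one [NeZero d] (z : Space d) :
    inner ℝ (EuclideanSpace.single (0 : Fin d) (1 : ℝ)) z = z 0 := by
  simp [EuclideanSpace.inner_single_left]

/-- A reflection takes |k| times the first basis vector to k, and a dilation by |k| removes the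
length; what remains is the integral defining c₀. -/
theorem integral_one_sub_cos_div [NeZero d] {α : ℝ} (h0 : 0 < α) (k : Space d) :
    ∫ z : Space d, (1 - Real.cos (inner ℝ k z)) / ‖z‖ ^ ((d : ℝ) + α) = c0 d α * ‖k‖ ^ α := by
  rcases eq_or_ne k 0 with rfl | hk
  · simp [Real.zero_rpow h0.ne']
  have hR : 0 < ‖k‖ := norm_pos_iff.2 hk
  set e : Space d := EuclideanSpace.single (0 : Fin d) (1 : ℝ) with he
  have hnorm : ‖‖k‖ • e‖ = ‖k‖ := by
    rw [norm_smul, he, PiLp.norm_single]; simp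
  have hL := Submodule.reflection_sub hnorm
  set L := (Submodule.span ℝ {‖k‖ • e - k})ᗮ.reflection with hLdef
  have h1 : ∫ z : Space d, (1 - Real.cos (inner ℝ k z)) / ‖z‖ ^ ((d : ℝ) + α) =
      ∫ z : Space d, (1 - Real.cos (inner ℝ k (L z))) / ‖L z‖ ^ ((d : ℝ) + α) :=
    (L.measurePreserving.integral_comp L.toMeasurableEquiv.measurableEmbedding
      (fun z : Space d => (1 - Real.cos (inner ℝ k z)) / ‖z‖ ^ ((d : ℝ) + α))).symm
  have h2 : ∀ z : Space d, (1 - Real.cos (inner ℝ k (L z))) / ‖L z‖ ^ ((d : ℝ) + α) =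
      ‖k‖ ^ ((d : ℝ) + α) * ((1 - Real.cos ((‖k‖ • z) 0)) / ‖‖k‖ • z‖ ^ ((d : ℝ) + α)) := by
    intro z
    have hin : inner ℝ k (L z) = (‖k‖ • z) 0 := by
      have : inner ℝ k (L z) = inner ℝ (L (‖k‖ • e)) (L z) := by rw [hL]
      rw [this, L.inner_map_map, inner_smul_left, he, inner_single_one]
      simp
    rw [hin, L.norm_map, norm_smul, norm_norm, Real.mul_rpow hR.le (norm_nonneg z)]
    have := Real.rpow_pos_of_pos hR ((d : ℝ) + α)
    rw [mul_div_assoc', mul_div_mul_left _ _ this.ne']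
  rw [h1]
  simp only [h2]
  rw [integral_const_mul, Measure.integral_comp_smul volume
    (fun z : Space d => (1 - Real.cos (z 0)) / ‖z‖ ^ ((d : ℝ) + α)), finrank_euclideanSpace,
    Fintype.card_fin, abs_of_pos (by positivity), smul_eq_mul, ← mul_assoc, Real.rpow_add hR,
    Real.rpow_natCast, mul_right_comm (‖k‖ ^ d), mul_inv_cancel₀ (by positivity), one_mul, mul_comm,
    c0]

theorem c0_pos [NeZero d] {α : ℝ} (h0 : 0 < α) (h2 : α < 2) : 0 < c0 d α := by
  have hint := integrable_one_sub_cos_div h0 h2 (EuclideanSpace.single (0 : Fin d) (1 : ℝ))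
  simp only [inner_single_one] at hint
  unfold c0
  rw [integral_pos_iff_support_of_nonneg (fun z => div_nonneg
    (by linarith [Real.cos_le_one (z 0)]) (by positivity)) hint]
  -- On this nonempty open slab 0 < z₀ < 1 the integrand is strictly positive.
  have hopen : IsOpen {z : Space d | 0 < z 0 ∧ z 0 < 1} :=
    (isOpen_lt continuous_const (by fun_prop : Continuous fun z : Space d => z 0)).inter
      (isOpen_lt (by fun_prop : Continuous fun z : Space d => z 0) continuous_const)
  refine (hopen.measure_pos volume ⟨EuclideanSpace.single 0 (1 / 2), ?_⟩).trans_le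
    (measure_mono fun z hz => ?_)
  · simp; norm_num
  · have hz0 : z ≠ 0 := by rintro rfl; simp at hz
    have h3 : Real.cos (z 0) < 1 := by
      rw [← Real.cos_zero]
      exact Real.cos_lt_cos_of_nonneg_of_le_pi le_rfl (by linarith [hz.2, Real.pi_gt_three]) hz.1
    have h4 : 0 < ‖z‖ ^ ((d : ℝ) + α) := Real.rpow_pos_of_pos (norm_pos_iff.2 hz0) _
    exact (div_pos (by linarith) h4).ne'

end

section

variable {d : ℕ}

/-! ### Tiling by the shifted cells -/

theorem mem_shiftedCell_iff {n : Fin d → ℤ} {x : Space d} :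
    x ∈ shiftedCell n ↔ ∀ i, ⌊x i⌋ = n i := by
  simp only [shiftedCell, cell, Set.mem_ofPred_eq, Int.floor_eq_iff]
  refine forall_congr' fun i => ?_
  simp only [latticePoint, PiLp.sub_apply, Set.mem_Ico]
  constructor <;> rintro ⟨h1, h2⟩ <;> constructor <;> linarith

theorem preimage_add_shiftedCell (n : Fin d → ℤ) :
    (fun x : Space d => x + latticePoint n) ⁻¹' shiftedCell n = cell d := by
  ext x; simp [shiftedCell]

theorem measurableSet_shiftedCell (n : Fin d → ℤ) : MeasurableSet (shiftedCell n) :=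
  (by fun_prop : Measurable fun x : Space d => x - latticePoint n) (measurableSet_cell d)

theorem iUnion_shiftedCell : ⋃ n : Fin d → ℤ, shiftedCell n = (Set.univ : Set (Space d)) :=
  Set.eq_univ_of_forall fun x =>
    Set.mem_iUnion.2 ⟨fun i => ⌊x i⌋, mem_shiftedCell_iff.2 fun _ => rfl⟩

theorem pairwise_disjoint_shiftedCell :
    Pairwise (Function.onFun Disjoint (shiftedCell : (Fin d → ℤ) → Set (Space d))) := by
  intro m n hmn
  refine Set.disjoint_left.2 fun x hm hn => hmn (funext fun i => ?_)
  rw [← mem_shiftedCell_iff.1 hm i, mem_shiftedCell_iff.1 hn i]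

theorem measurePreserving_add_shiftedCell (n : Fin d → ℤ) :
    MeasurePreserving (fun x : Space d => x + latticePoint n) (cellMeasure d)
      (volume.restrict (shiftedCell n)) := by
  have := (measurePreserving_add_right volume (latticePoint n : Space d)).restrict_preimage
    (measurableSet_shiftedCell n)
  rwa [preimage_add_shiftedCell] at this

theorem setLIntegral_shiftedCell (n : Fin d → ℤ) (f : Space d → ℝ≥0∞) :
    ∫⁻ x in shiftedCell n, f x = ∫⁻ x, f (x + latticePoint n) ∂(cellMeasure d) :=
  ((measurePreserving_add_shiftedCell n).lintegral_comp_emb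
    (measurableEmbedding_addRight _) f).symm

theorem norm_le_sqrt_of_mem_cell {x : Space d} (hx : x ∈ cell d) : ‖x‖ ≤ Real.sqrt d := by
  rw [EuclideanSpace.norm_eq]
  refine Real.sqrt_le_sqrt ?_
  calc ∑ i, ‖x i‖ ^ 2 ≤ ∑ _i : Fin d, (1 : ℝ) := by
        refine Finset.sum_le_sum fun i _ => ?_
        have h := hx i
        rw [Real.norm_eq_abs, sq_abs]
        nlinarith [h.1, h.2]
    _ = d := by simp

/-- The integral of a periodic function over a ball is finite if that over the cell is. -/
theorem setLIntegral_ball_lt_top {g : Space d → ℝ≥0∞} (hg : ∀ x n, g (x + latticePoint n) = g x)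
    (h : ∫⁻ x, g x ∂(cellMeasure d) < ∞) (R : ℝ) : ∫⁻ x in Metric.ball 0 R, g x < ∞ := by
  set F : Finset (Fin d → ℤ) := Fintype.piFinset fun _ => Finset.Icc ⌊-R⌋ ⌊R⌋ with hF
  have hsub : Metric.ball (0 : Space d) R ⊆ ⋃ n ∈ F, shiftedCell n := by
    intro x hx
    rw [mem_ball_zero_iff] at hx
    refine Set.mem_iUnion₂.2 ⟨fun i => ⌊x i⌋, ?_, mem_shiftedCell_iff.2 fun _ => rfl⟩
    rw [hF, Fintype.mem_piFinset]
    intro i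
    have h1 : |x i| ≤ R := (PiLp.norm_apply_le x i).trans hx.le
    rw [Finset.mem_Icc]
    exact ⟨Int.floor_le_floor (abs_le.1 h1).1, Int.floor_le_floor (abs_le.1 h1).2⟩
  calc ∫⁻ x in Metric.ball 0 R, g x ≤ ∫⁻ x in ⋃ n ∈ F, shiftedCell n, g x :=
        lintegral_mono_set hsub
    _ = ∑ n ∈ F, ∫⁻ x in shiftedCell n, g x :=
        lintegral_biUnion_finset (fun _ _ _ _ h => pairwise_disjoint_shiftedCell h)
          (fun n _ => measurableSet_shiftedCell n) _
    _ = ∑ n ∈ F, ∫⁻ x, g x ∂(cellMeasure d) := by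
        refine Finset.sum_congr rfl fun n _ => ?_
        rw [setLIntegral_shiftedCell]
        simp only [hg]
    _ < ∞ := ENNReal.sum_lt_top.2 fun _ _ => h

/-! ### Integrals over pairs -/

/-- The shear (x, z) ↦ (x, x + z) preserves the measure. It makes z = y - x an independent variable,
on which the Riesz kernel alone depends. -/
theorem lintegral_pair {F : Space d × Space d → ℝ≥0∞} (hF : AEMeasurable F (pairMeasure d)) :
    ∫⁻ p, F p ∂(pairMeasure d) = ∫⁻ z, ∫⁻ x, F (x, x + z) ∂(cellMeasure d) := by
  have hmp : MeasurePreserving (fun z : Space d × Space d => (z.1, z.1 + z.2)) (pairMeasure d)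
      (pairMeasure d) := measurePreserving_prod_add (cellMeasure d) volume
  rw [← hmp.lintegral_comp_emb (MeasurableEquiv.shearAddRight (Space d)).measurableEmbedding F,
    lintegral_prod_symm]
  exact hF.comp_quasiMeasurePreserving hmp.quasiMeasurePreserving

theorem aestronglyMeasurable_periodicExt (u : L2Cell d) :
    AEStronglyMeasurable (periodicExt u) volume :=
  (Lp.aestronglyMeasurable u).comp_quasiMeasurePreserving (quasiMeasurePreserving_fracPart d)

theorem aestronglyMeasurable_periodicExt_fst (u : L2Cell d) :
    AEStronglyMeasurable (fun p : Space d × Space d => periodicExt u p.1) (pairMeasure d) :=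
  (aestronglyMeasurable_periodicExt u).restrict.comp_fst

theorem aestronglyMeasurable_periodicExt_snd (u : L2Cell d) :
    AEStronglyMeasurable (fun p : Space d × Space d => periodicExt u p.2) (pairMeasure d) :=
  (aestronglyMeasurable_periodicExt u).comp_snd

theorem aestronglyMeasurable_twistDiff (ξ : Space d) (u : L2Cell d) :
    AEStronglyMeasurable (twistDiff ξ u) (pairMeasure d) := by
  refine (aestronglyMeasurable_periodicExt_fst u).sub
    (AEStronglyMeasurable.mul ?_ (aestronglyMeasurable_periodicExt_snd u))
  exact ((measurable_expChar ξ).comp (by fun_prop :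
    Measurable fun p : Space d × Space d => p.2 - p.1)).aestronglyMeasurable

theorem lintegral_periodicExt_sq_add (u : L2Cell d) (z : Space d) :
    ∫⁻ x, ‖periodicExt u (x + z)‖ₑ ^ 2 ∂(cellMeasure d) = ENNReal.ofReal (‖u‖ ^ 2) := by
  rw [← (translate z).norm_map u, ← lintegral_sq_enorm]
  refine lintegral_congr_ae ?_
  filter_upwards [coeFn_translate z u] with x hx
  rw [hx]

theorem aemeasurable_mul_fst {f : Space d → ℝ≥0∞} (hf : Measurable f) (u : L2Cell d) :
    AEMeasurable (fun p => f (p.2 - p.1) * ‖periodicExt u p.1‖ₑ ^ 2) (pairMeasure d) :=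
  (hf.comp (by fun_prop : Measurable fun p : Space d × Space d => p.2 - p.1)).aemeasurable.mul
    ((aestronglyMeasurable_periodicExt_fst u).enorm.pow_const 2)

theorem aemeasurable_mul_snd {f : Space d → ℝ≥0∞} (hf : Measurable f) (u : L2Cell d) :
    AEMeasurable (fun p => f (p.2 - p.1) * ‖periodicExt u p.2‖ₑ ^ 2) (pairMeasure d) :=
  (hf.comp (by fun_prop : Measurable fun p : Space d × Space d => p.2 - p.1)).aemeasurable.mul
    ((aestronglyMeasurable_periodicExt_snd u).enorm.pow_const 2)

theorem lintegral_pair_mul_snd {f : Space d → ℝ≥0∞} (hf : Measurable f) (u : L2Cell d) :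
    ∫⁻ p, f (p.2 - p.1) * ‖periodicExt u p.2‖ₑ ^ 2 ∂(pairMeasure d) =
      (∫⁻ z, f z) * ENNReal.ofReal (‖u‖ ^ 2) := by
  rw [lintegral_pair (aemeasurable_mul_snd hf u), ← lintegral_mul_const _ hf]
  refine lintegral_congr fun z => ?_
  simp only [add_sub_cancel_left]
  rw [lintegral_const_mul'' _ ?_, lintegral_periodicExt_sq_add]
  have := (Lp.aestronglyMeasurable (translate z u)).congr (coeFn_translate z u)
  exact this.enorm.pow_const 2

theorem lintegral_pair_mul_fst {f : Space d → ℝ≥0∞} (hf : Measurable f) (u : L2Cell d) :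
    ∫⁻ p, f (p.2 - p.1) * ‖periodicExt u p.1‖ₑ ^ 2 ∂(pairMeasure d) =
      (∫⁻ z, f z) * ENNReal.ofReal (‖u‖ ^ 2) := by
  rw [lintegral_pair (aemeasurable_mul_fst hf u), ← lintegral_mul_const _ hf]
  refine lintegral_congr fun z => ?_
  simp only [add_sub_cancel_left]
  rw [lintegral_const_mul'' _ ?_]
  · have := lintegral_periodicExt_sq_add u 0
    simp only [add_zero] at this
    rw [this]
  · exact (aestronglyMeasurable_periodicExt u).restrict.enorm.pow_const 2

/-- The Riesz kernel `|x-y|^{-d-α}`, with values in `[0,∞]`. -/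
def rieszKernel (α : ℝ) (p : Space d × Space d) : ℝ≥0∞ :=
  ENNReal.ofReal (1 / ‖p.1 - p.2‖ ^ ((d : ℝ) + α))

theorem measurable_rieszKernel (α : ℝ) : Measurable (rieszKernel (d := d) α) := by
  unfold rieszKernel; fun_prop

theorem rieszKernel_shear (α : ℝ) (x z : Space d) :
    rieszKernel α (x, x + z) = ENNReal.ofReal (1 / ‖z‖ ^ ((d : ℝ) + α)) := by
  simp [rieszKernel]

theorem aemeasurable_energy (α : ℝ) (ξ : Space d) (u : L2Cell d) :
    AEMeasurable (fun p => rieszKernel α p * ‖twistDiff ξ u p‖ₑ ^ 2) (pairMeasure d) :=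
  (measurable_rieszKernel α).aemeasurable.mul
    ((aestronglyMeasurable_twistDiff ξ u).enorm.pow_const 2)

/-- The energy `∫_{ℝᵈ} dy ∫_Ω dx |u(x) - e^{i⟨ξ,y-x⟩}u(y)|² / |x-y|^{d+α}`. -/
def energy (α : ℝ) (ξ : Space d) (u : L2Cell d) : ℝ≥0∞ :=
  ∫⁻ p, rieszKernel α p * ‖twistDiff ξ u p‖ₑ ^ 2 ∂(pairMeasure d)

/-- The energy in terms of the Fourier coefficients. -/
theorem energy_eq_tsum [NeZero d] {α : ℝ} (h0 : 0 < α) (h2 : α < 2) (ξ : Space d) (u : L2Cell d) :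
    energy α ξ u = ∑' n, ENNReal.ofReal (‖inner ℂ (fourierBasis d n) u‖ ^ 2) *
      ENNReal.ofReal (2 * c0 d α * ‖ξ + freq n‖ ^ α) := by
  have hm : ∀ n : Fin d → ℤ, Measurable fun z : Space d =>
      ENNReal.ofReal (2 * ((1 - Real.cos (inner ℝ (ξ + freq n) z)) / ‖z‖ ^ ((d : ℝ) + α))) :=
    fun n => by fun_prop
  rw [energy, lintegral_pair (aemeasurable_energy α ξ u)]
  have h1 : ∀ z : Space d, ∫⁻ x, rieszKernel α (x, x + z) * ‖twistDiff ξ u (x, x + z)‖ₑ ^ 2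
      ∂(cellMeasure d) = ∑' n, ENNReal.ofReal (‖inner ℂ (fourierBasis d n) u‖ ^ 2) *
        ENNReal.ofReal (2 * ((1 - Real.cos (inner ℝ (ξ + freq n) z)) /
          ‖z‖ ^ ((d : ℝ) + α))) := by
    intro z
    simp only [rieszKernel_shear]
    rw [lintegral_const_mul' _ _ ENNReal.ofReal_ne_top, lintegral_twistDiff, ← ENNReal.tsum_mul_left]
    refine tsum_congr fun n => ?_
    rw [mul_left_comm, ← ENNReal.ofReal_mul (by positivity)]
    congr 2
    ring
  simp only [h1]
  rw [lintegral_tsum fun n => ((hm n).const_mul _).aemeasurable]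
  refine tsum_congr fun n => ?_
  rw [lintegral_const_mul _ (hm n), ← ofReal_integral_eq_lintegral_ofReal
    ((integrable_one_sub_cos_div h0 h2 _).const_mul 2)
    (Filter.Eventually.of_forall fun z => mul_nonneg zero_le_two
      (div_nonneg (by linarith [Real.cos_le_one (inner ℝ (ξ + freq n) z)]) (by positivity))),
    integral_const_mul, integral_one_sub_cos_div h0]
  congr 2
  ring

theorem twistDiff_zero (u : Space d → ℂ) (p : Space d × Space d) :
    twistDiff 0 u p = periodicExt u p.1 - periodicExt u p.2 := by
  rw [twistDiff, expChar_zero_left, one_mul]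

theorem lintegral_far_lt_top [NeZero d] {α : ℝ} (h0 : 0 < α) (h2 : α < 2) :
    ∫⁻ z : Space d, (Metric.ball (0 : Space d) 1)ᶜ.indicator
      (fun z => ENNReal.ofReal (1 / ‖z‖ ^ ((d : ℝ) + α))) z < ∞ := by
  have hint := integrable_radialMin (d := d) (β := α) (p := 2) (q := 0) (by simpa using h0)
    (by simpa using h2) zero_le_one
  refine lt_of_le_of_lt (lintegral_mono fun z => ?_) hint.lintegral_lt_top
  by_cases hz : z ∈ (Metric.ball (0 : Space d) 1)ᶜ
  · rw [Set.indicator_of_mem hz]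
    have hz1 : 1 ≤ ‖z‖ := by simpa using hz
    refine ENNReal.ofReal_le_ofReal ?_
    rw [radialMin, one_mul, pow_zero, min_eq_right (one_le_pow₀ hz1)]
  · rw [Set.indicator_of_notMem hz]
    exact zero_le

theorem enorm_sub_sq_le (a b : ℂ) : ‖a - b‖ₑ ^ 2 ≤ 2 * (‖a‖ₑ ^ 2 + ‖b‖ₑ ^ 2) := by
  have h1 : ‖a - b‖ ^ 2 ≤ 2 * (‖a‖ ^ 2 + ‖b‖ ^ 2) := by
    have := norm_sub_le a b
    nlinarith [norm_nonneg (a - b), norm_nonneg a, norm_nonneg b, sq_nonneg (‖a‖ - ‖b‖)]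
  have h2 := ENNReal.ofReal_le_ofReal h1
  rw [ENNReal.ofReal_mul zero_le_two, ENNReal.ofReal_add (by positivity) (by positivity),
    ENNReal.ofReal_pow (norm_nonneg _), ENNReal.ofReal_pow (norm_nonneg _),
    ENNReal.ofReal_pow (norm_nonneg _), ofReal_norm, ofReal_norm, ofReal_norm] at h2
  simpa using h2

theorem enorm_quotient_sq (α : ℝ) (u : Space d → ℂ) (p : Space d × Space d) :
    ‖(u p.1 - u p.2) / ((‖p.1 - p.2‖ ^ (((d : ℝ) + 2 * (α / 2)) / 2) : ℝ) : ℂ)‖ₑ ^ (2 : ℝ) =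
      rieszKernel α p * ‖u p.1 - u p.2‖ₑ ^ 2 := by
  rw [ENNReal.rpow_two, ← ofReal_norm, ← ofReal_norm, ← ENNReal.ofReal_pow (norm_nonneg _),
    ← ENNReal.ofReal_pow (norm_nonneg _), rieszKernel, ← ENNReal.ofReal_mul (by positivity)]
  congr 1
  rw [norm_div, div_pow, Complex.norm_real, Real.norm_of_nonneg (by positivity),
    ← Real.rpow_natCast (‖p.1 - p.2‖ ^ _), ← Real.rpow_mul (norm_nonneg _), one_div_mul_eq_div]
  congr 2
  push_cast
  ring

theorem memSobolev_iff {α : ℝ} {O : Set (Space d)} {u : Space d → ℂ}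
    (hu : AEStronglyMeasurable u (volume.restrict O)) :
    MemSobolev (α / 2) O u ↔ ∫⁻ x in O, ‖u x‖ₑ ^ 2 < ∞ ∧
      ∫⁻ p, rieszKernel α p * ‖u p.1 - u p.2‖ₑ ^ 2
        ∂((volume.restrict O).prod (volume.restrict O)) < ∞ := by
  have hm : AEStronglyMeasurable (fun p : Space d × Space d => (u p.1 - u p.2) /
      ((‖p.1 - p.2‖ ^ (((d : ℝ) + 2 * (α / 2)) / 2) : ℝ) : ℂ))
      ((volume.restrict O).prod (volume.restrict O)) :=
    (hu.comp_fst.sub hu.comp_snd).div₀ (by fun_prop : Measurable fun p : Space d × Space d =>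
      ((‖p.1 - p.2‖ ^ (((d : ℝ) + 2 * (α / 2)) / 2) : ℝ) : ℂ)).aestronglyMeasurable
  rw [MemSobolev, MemLp, MemLp, and_iff_right hu, and_iff_right hm,
    eLpNorm_lt_top_iff_lintegral_rpow_enorm_lt_top two_ne_zero ENNReal.ofNat_ne_top,
    eLpNorm_lt_top_iff_lintegral_rpow_enorm_lt_top two_ne_zero ENNReal.ofNat_ne_top,
    ENNReal.toReal_ofNat]
  simp only [enorm_quotient_sq]
  simp

/-- The periodic Sobolev space consists of the functions of finite energy. -/
theorem mem_periodicSobolev_iff [NeZero d] {α : ℝ} (h0 : 0 < α) (h2 : α < 2) (u : L2Cell d) :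
    u ∈ periodicSobolev d (α / 2) ↔ energy α 0 u < ∞ := by
  have hmeas := aestronglyMeasurable_periodicExt u
  have hcell : cell d ⊆ Metric.ball 0 (Real.sqrt d + 2) := fun x hx => by
    rw [mem_ball_zero_iff]
    linarith [norm_le_sqrt_of_mem_cell hx]
  have hFm : AEMeasurable (fun p => rieszKernel α p * ‖twistDiff 0 u p‖ₑ ^ 2) (pairMeasure d) :=
    aemeasurable_energy α 0 u
  constructor
  · rintro ⟨-, h⟩
    have hB := ((memSobolev_iff hmeas.restrict).1 (h (Real.sqrt d + 2))).2
    -- Pairs with |x - y| < 1 and x in the cell lie in the ball of radius √d + 2, where the local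
    -- Sobolev norm controls them. For the remaining pairs the kernel is integrable and the L₂ norm
    -- suffices.
    set D : Set (Space d × Space d) := {p | ‖p.2 - p.1‖ < 1} with hD
    have hDm : MeasurableSet D := measurableSet_lt (by fun_prop) (by fun_prop)
    rw [energy, ← lintegral_add_compl _ hDm]
    refine ENNReal.add_lt_top.2 ⟨?_, ?_⟩
    · refine lt_of_le_of_lt ?_ hB
      simp only [twistDiff_zero]
      refine lintegral_mono' ?_ le_rfl
      have : pairMeasure d = (volume.prod volume).restrict (cell d ×ˢ Set.univ) := by
        rw [← Measure.prod_restrict, Measure.restrict_univ]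
      rw [this, Measure.restrict_restrict hDm, Measure.prod_restrict]
      refine Measure.restrict_mono (fun p hp => ?_) le_rfl
      have hx := norm_le_sqrt_of_mem_cell hp.2.1
      have hy : ‖p.2‖ ≤ ‖p.1‖ + ‖p.2 - p.1‖ := norm_le_norm_add_norm_sub' p.2 p.1
      have hp1 : ‖p.2 - p.1‖ < 1 := hp.1
      constructor <;> rw [mem_ball_zero_iff] <;> linarith
    · set f : Space d → ℝ≥0∞ := (Metric.ball (0 : Space d) 1)ᶜ.indicator
        (fun z => ENNReal.ofReal (1 / ‖z‖ ^ ((d : ℝ) + α))) with hf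
      have hfm : Measurable f := Measurable.indicator (by fun_prop) measurableSet_ball.compl
      have hle : ∫⁻ p in Dᶜ, rieszKernel α p * ‖twistDiff 0 u p‖ₑ ^ 2 ∂(pairMeasure d) ≤
          ∫⁻ p, 2 * (f (p.2 - p.1) * ‖periodicExt u p.1‖ₑ ^ 2 +
            f (p.2 - p.1) * ‖periodicExt u p.2‖ₑ ^ 2) ∂(pairMeasure d) := by
        rw [← lintegral_indicator hDm.compl]
        refine lintegral_mono fun p => ?_
        by_cases hp : p ∈ Dᶜ
        · rw [Set.indicator_of_mem hp]
          have hp' : p.2 - p.1 ∈ (Metric.ball (0 : Space d) 1)ᶜ := by simpa [hD] using hp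
          rw [hf, Set.indicator_of_mem hp', twistDiff_zero, rieszKernel, norm_sub_rev p.2,
            ← mul_add, mul_left_comm]
          gcongr
          exact enorm_sub_sq_le _ _
        · rw [Set.indicator_of_notMem hp]
          exact zero_le
      refine lt_of_le_of_lt hle ?_
      rw [lintegral_const_mul' _ _ ENNReal.ofNat_ne_top, lintegral_add_left'
        (aemeasurable_mul_fst hfm u), lintegral_pair_mul_fst hfm, lintegral_pair_mul_snd hfm]
      have := lintegral_far_lt_top (d := d) h0 h2
      have h3 := ENNReal.mul_lt_top this (ENNReal.ofReal_lt_top (r := ‖u‖ ^ 2))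
      exact ENNReal.mul_lt_top (by simp) (ENNReal.add_lt_top.2 ⟨h3, h3⟩)
  · intro h
    have hball : ∀ R : ℝ, MemSobolev (α / 2) (Metric.ball 0 R) (periodicExt u) := by
      intro R
      refine (memSobolev_iff hmeas.restrict).2 ⟨?_, ?_⟩
      · refine setLIntegral_ball_lt_top (fun x n => ?_) ?_ R
        · simp only [periodicExt, fracPart_add_latticePoint]
        · have := lintegral_periodicExt_sq_add u 0
          simp only [add_zero] at this
          rw [this]
          exact ENNReal.ofReal_lt_top
      -- The inner integral over all y is a periodic function of x, so its integral over a ball is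
      -- controlled by finitely many copies of the one over the cell.
      · have hper : ∀ (x : Space d) (n : Fin d → ℤ),
            ∫⁻ y, rieszKernel α (x + latticePoint n, y) *
              ‖periodicExt u (x + latticePoint n) - periodicExt u y‖ₑ ^ 2 =
            ∫⁻ y, rieszKernel α (x, y) * ‖periodicExt u x - periodicExt u y‖ₑ ^ 2 := by
          intro x n
          rw [← lintegral_add_right_eq_self _ (latticePoint n)]
          simp only [rieszKernel, add_sub_add_right_eq_sub, periodicExt, fracPart_add_latticePoint]
        have hae : AEMeasurable (fun p : Space d × Space d => rieszKernel α p *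
            ‖periodicExt u p.1 - periodicExt u p.2‖ₑ ^ 2)
            ((volume.restrict (Metric.ball 0 R)).prod volume) :=
          (measurable_rieszKernel α).aemeasurable.mul
            ((hmeas.restrict.comp_fst.sub hmeas.comp_snd).enorm.pow_const 2)
        refine lt_of_le_of_lt (lintegral_mono' (Measure.prod_mono le_rfl
          Measure.restrict_le_self) le_rfl) ?_
        rw [lintegral_prod _ hae]
        refine setLIntegral_ball_lt_top hper ?_ R
        rw [energy, lintegral_prod _ hFm] at h
        simpa only [twistDiff_zero] using h
    refine ⟨?_, hball⟩
    have hb := (memSobolev_iff hmeas.restrict).1 (hball (Real.sqrt d + 2))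
    refine (memSobolev_iff hmeas.restrict).2 ⟨lt_of_le_of_lt (lintegral_mono_set hcell) hb.1,
      lt_of_le_of_lt (lintegral_mono' (Measure.prod_mono ?_ ?_) le_rfl) hb.2⟩ <;>
    exact Measure.restrict_mono hcell le_rfl

end

section

variable {d : ℕ}

/-! ### The smoothing operator with range `H̃^{α/2}(Ω)` -/

/-- The Fourier multiplier `max(1,|n|)^{-α/2}`. -/
def sobolevWeight (α : ℝ) (n : Fin d → ℤ) : ℝ :=
  (max 1 ‖(latticePoint n : Space d)‖) ^ (-(α / 2))

theorem sobolevWeight_pos (α : ℝ) (n : Fin d → ℤ) : 0 < sobolevWeight α n :=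
  Real.rpow_pos_of_pos (lt_max_of_lt_left one_pos) _

theorem abs_sobolevWeight_le {α : ℝ} (h0 : 0 < α) (n : Fin d → ℤ) : |sobolevWeight α n| ≤ 1 := by
  rw [abs_of_pos (sobolevWeight_pos α n)]
  exact Real.rpow_le_one_of_one_le_of_nonpos (le_max_left _ _) (by linarith)

theorem sobolevWeight_sq (α : ℝ) (n : Fin d → ℤ) :
    sobolevWeight α n ^ 2 * (max 1 ‖(latticePoint n : Space d)‖) ^ α = 1 := by
  have h : 0 < max 1 ‖(latticePoint n : Space d)‖ := lt_max_of_lt_left one_pos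
  rw [sobolevWeight, ← Real.rpow_natCast, ← Real.rpow_mul h.le, ← Real.rpow_add h]
  convert Real.rpow_zero _ using 2
  push_cast; ring

theorem latticePoint_zero : (latticePoint 0 : Space d) = 0 := by
  ext i; simp [latticePoint]

theorem sobolevWeight_zero (α : ℝ) : sobolevWeight α (0 : Fin d → ℤ) = 1 := by
  rw [sobolevWeight, latticePoint_zero]
  simp

theorem one_le_norm_latticePoint {n : Fin d → ℤ} (hn : n ≠ 0) :
    1 ≤ ‖(latticePoint n : Space d)‖ := by
  obtain ⟨i, hi⟩ := Function.ne_iff.1 hn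
  have h1 : (1 : ℝ) ≤ |(n i : ℝ)| := by exact_mod_cast Int.one_le_abs hi
  exact h1.trans (PiLp.norm_apply_le (latticePoint n : Space d) i)

theorem norm_freq (n : Fin d → ℤ) : ‖(freq n : Space d)‖ = 2 * Real.pi * ‖latticePoint n‖ := by
  rw [freq, norm_smul, Real.norm_of_nonneg (by positivity)]

theorem tendsto_norm_latticePoint :
    Filter.Tendsto (fun n : Fin d → ℤ => ‖(latticePoint n : Space d)‖) Filter.cofinite
      Filter.atTop := by
  refine Filter.tendsto_atTop.2 fun R => ?_
  rw [Filter.eventually_cofinite]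
  refine (Fintype.piFinset fun _ : Fin d => Finset.Icc ⌊-R⌋ ⌊R⌋).finite_toSet.subset fun n hn => ?_
  rw [Finset.mem_coe, Fintype.mem_piFinset]
  intro i
  have h1 : |(n i : ℝ)| ≤ R :=
    (PiLp.norm_apply_le (latticePoint n : Space d) i).trans (not_le.1 hn).le
  rw [Finset.mem_Icc, ← Int.floor_intCast (R := ℝ) (n i)]
  exact ⟨Int.floor_le_floor (abs_le.1 h1).1, Int.floor_le_floor (abs_le.1 h1).2⟩

theorem tendsto_sobolevWeight {α : ℝ} (h0 : 0 < α) :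
    Filter.Tendsto (sobolevWeight (d := d) α) Filter.cofinite (nhds 0) := by
  refine (tendsto_rpow_neg_atTop (half_pos h0)).comp ?_
  exact Filter.tendsto_atTop_mono (fun n => le_max_right _ _) tendsto_norm_latticePoint

/-- The compact operator `S` that is diagonal in the Fourier basis with entries
`max(1,|n|)^{-α/2}`. -/
def smoothing (d : ℕ) {α : ℝ} (h0 : 0 < α) : L2Cell d →L[ℂ] L2Cell d :=
  diagOp (fourierBasis d) (abs_sobolevWeight_le h0)

variable {α : ℝ} (h0 : 0 < α)

theorem coeff_smoothing (f : L2Cell d) (n : Fin d → ℤ) :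
    inner ℂ (fourierBasis d n) (smoothing d h0 f) =
      (sobolevWeight α n : ℂ) * inner ℂ (fourierBasis d n) f :=
  coeff_diagOp _ _ _ _

theorem isCompactOperator_smoothing : IsCompactOperator (smoothing d h0) :=
  isCompactOperator_diagOp _ _ (tendsto_sobolevWeight h0)

theorem norm_smoothing_le (f : L2Cell d) : ‖smoothing d h0 f‖ ≤ ‖f‖ := by
  have := (smoothing d h0).le_of_opNorm_le (norm_diagOp_le (fourierBasis d)
    (abs_sobolevWeight_le h0)) f
  rwa [abs_one, one_mul] at this

theorem inner_smoothing_left (f g : L2Cell d) :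
    inner ℂ (smoothing d h0 f) g = inner ℂ f (smoothing d h0 g) :=
  inner_diagOp_left _ _ _ _

theorem smoothing_oneCell : smoothing d h0 (oneCell d) = oneCell d := by
  rw [← fourierBasis_zero, smoothing, diagOp_basis, sobolevWeight_zero]
  simp

theorem inner_oneCell_smoothing (f : L2Cell d) :
    inner ℂ (oneCell d) (smoothing d h0 f) = inner ℂ (oneCell d) f := by
  rw [← inner_smoothing_left, smoothing_oneCell]

theorem smoothing_injective : Function.Injective (smoothing d h0) := by
  intro f g hfg
  refine eq_of_coeff_eq (fourierBasis d) fun n => ?_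
  have := congrArg (fun u => inner ℂ (fourierBasis d n) u) hfg
  simp only [coeff_smoothing] at this
  exact mul_left_cancel₀ (by exact_mod_cast (sobolevWeight_pos α n).ne') this

theorem energy_smoothing [NeZero d] (h2 : α < 2) (ξ : Space d) (f : L2Cell d) :
    energy α ξ (smoothing d h0 f) =
      ∑' n, ENNReal.ofReal (‖inner ℂ (fourierBasis d n) f‖ ^ 2 *
        (2 * c0 d α * (sobolevWeight α n ^ 2 * ‖ξ + freq n‖ ^ α))) := by
  rw [energy_eq_tsum h0 h2]
  refine tsum_congr fun n => ?_
  rw [← ENNReal.ofReal_mul (by positivity), coeff_smoothing, norm_mul, Complex.norm_real,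
    Real.norm_eq_abs, mul_pow, sq_abs]
  congr 1
  ring

/-- The operator `S` maps into the space of functions of finite energy, with a bound. -/
theorem energy_smoothing_le [NeZero d] (h2 : α < 2) (ξ : Space d) (f : L2Cell d) :
    energy α ξ (smoothing d h0 f) ≤
      ENNReal.ofReal (2 * c0 d α * (‖ξ‖ + 2 * Real.pi) ^ α * ‖f‖ ^ 2) := by
  have hc := (c0_pos (d := d) h0 h2).le
  have hs := (hasSum_sq_coeff (fourierBasis d) f).mul_left
    (2 * c0 d α * (‖ξ‖ + 2 * Real.pi) ^ α)
  rw [energy_smoothing h0 h2, ← hs.tsum_eq,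
    ENNReal.ofReal_tsum_of_nonneg (fun _ => by positivity) hs.summable]
  refine ENNReal.tsum_le_tsum fun n => ENNReal.ofReal_le_ofReal ?_
  have hm : 1 ≤ max 1 ‖(latticePoint n : Space d)‖ := le_max_left _ _
  -- The factor max(1,|n|) pulled out here, raised to the power α, is cancelled by the squared
  -- weight.
  have h1 : ‖ξ + freq n‖ ≤ (‖ξ‖ + 2 * Real.pi) * max 1 ‖(latticePoint n : Space d)‖ := by
    have h3 : ‖ξ‖ ≤ ‖ξ‖ * max 1 ‖(latticePoint n : Space d)‖ :=
      le_mul_of_one_le_right (norm_nonneg _) hm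
    have h4 : 2 * Real.pi * ‖(latticePoint n : Space d)‖ ≤
        2 * Real.pi * max 1 ‖(latticePoint n : Space d)‖ := by
      gcongr; exact le_max_right _ _
    calc ‖ξ + freq n‖ ≤ ‖ξ‖ + ‖(freq n : Space d)‖ := norm_add_le _ _
      _ ≤ _ := by rw [norm_freq, add_mul]; linarith
  have h3 : sobolevWeight α n ^ 2 * ‖ξ + freq n‖ ^ α ≤ (‖ξ‖ + 2 * Real.pi) ^ α := by
    calc sobolevWeight α n ^ 2 * ‖ξ + freq n‖ ^ α
        ≤ sobolevWeight α n ^ 2 *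
          ((‖ξ‖ + 2 * Real.pi) * max 1 ‖(latticePoint n : Space d)‖) ^ α := by
          gcongr
      _ = (‖ξ‖ + 2 * Real.pi) ^ α := by
          rw [Real.mul_rpow (by positivity) (by positivity), mul_left_comm, sobolevWeight_sq,
            mul_one]
  calc ‖inner ℂ (fourierBasis d n) f‖ ^ 2 *
      (2 * c0 d α * (sobolevWeight α n ^ 2 * ‖ξ + freq n‖ ^ α))
      ≤ ‖inner ℂ (fourierBasis d n) f‖ ^ 2 * (2 * c0 d α * (‖ξ‖ + 2 * Real.pi) ^ α) := by gcongr
    _ = _ := by ring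

/-- The energy controls the nonconstant part. -/
theorem le_energy_smoothing [NeZero d] (h2 : α < 2) {ξ : Space d} (hξ : ‖ξ‖ ≤ Real.pi)
    (f : L2Cell d) :
    ENNReal.ofReal (2 * c0 d α * Real.pi ^ α * (‖f‖ ^ 2 - ‖inner ℂ (oneCell d) f‖ ^ 2)) ≤
      energy α ξ (smoothing d h0 f) := by
  classical
  have hc := (c0_pos (d := d) h0 h2).le
  have hs := hasSum_sq_coeff (fourierBasis d) f
  have h1 := ((hs.sub (hasSum_ite_eq (0 : Fin d → ℤ)
    (‖inner ℂ (fourierBasis d 0) f‖ ^ 2)))).mul_left (2 * c0 d α * Real.pi ^ α)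
  have hterm : ∀ n : Fin d → ℤ, 0 ≤ ‖inner ℂ (fourierBasis d n) f‖ ^ 2 -
      (if n = 0 then ‖inner ℂ (fourierBasis d 0) f‖ ^ 2 else 0) := fun n => by
    split_ifs with hn
    · rw [hn, sub_self]
    · rw [sub_zero]; positivity
  rw [← fourierBasis_zero, energy_smoothing h0 h2, ← h1.tsum_eq,
    ENNReal.ofReal_tsum_of_nonneg (fun n => mul_nonneg (by positivity) (hterm n)) h1.summable]
  refine ENNReal.tsum_le_tsum fun n => ENNReal.ofReal_le_ofReal ?_
  split_ifs with hn
  · rw [hn, sub_self, mul_zero]; positivity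
  · have hn1 := one_le_norm_latticePoint hn
    -- For n ≠ 0 and |ξ| ≤ π one has |ξ + 2πn| ≥ 2π|n| - π ≥ π|n|.
    have h3 : Real.pi * max 1 ‖(latticePoint n : Space d)‖ ≤ ‖ξ + freq n‖ := by
      rw [max_eq_right hn1]
      have h4 : ‖(freq n : Space d)‖ ≤ ‖ξ + freq n‖ + ‖ξ‖ := by
        have := norm_sub_le (ξ + freq n) ξ
        rwa [add_sub_cancel_left] at this
      rw [norm_freq] at h4
      nlinarith [Real.pi_pos]
    have h5 : Real.pi ^ α ≤ sobolevWeight α n ^ 2 * ‖ξ + freq n‖ ^ α := by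
      calc Real.pi ^ α = sobolevWeight α n ^ 2 *
            (Real.pi * max 1 ‖(latticePoint n : Space d)‖) ^ α := by
            rw [Real.mul_rpow (by positivity) (by positivity), mul_left_comm, sobolevWeight_sq,
              mul_one]
        _ ≤ _ := by gcongr
    rw [sub_zero]
    calc 2 * c0 d α * Real.pi ^ α * ‖inner ℂ (fourierBasis d n) f‖ ^ 2
        = ‖inner ℂ (fourierBasis d n) f‖ ^ 2 * (2 * c0 d α * Real.pi ^ α) := by ring
      _ ≤ _ := by gcongr

/-- The periodic Sobolev space is the range of `S`. -/
theorem mem_periodicSobolev_iff_range [NeZero d] (h2 : α < 2) (u : L2Cell d) :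
    u ∈ periodicSobolev d (α / 2) ↔ ∃ f, smoothing d h0 f = u := by
  rw [mem_periodicSobolev_iff h0 h2]
  constructor
  · intro h
    have hc := c0_pos (d := d) h0 h2
    rw [energy_eq_tsum h0 h2] at h
    have h1 : Summable fun n => ‖inner ℂ (fourierBasis d n) u‖ ^ 2 *
        (2 * c0 d α * ‖(0 : Space d) + freq n‖ ^ α) := by
      have := ENNReal.summable_toReal h.ne
      refine this.congr fun n => ?_
      rw [← ENNReal.ofReal_mul (by positivity), ENNReal.toReal_ofReal (by positivity)]
    -- The preimage must have the coefficients of u divided by the weight. They are square summable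
    -- because max(1,|n|)^α ≤ 1 + |2πn|^α, the two terms being the L₂ norm and the energy.
    have hsum : Summable fun n =>
        ‖((sobolevWeight α n)⁻¹ : ℂ) * inner ℂ (fourierBasis d n) u‖ ^ 2 := by
      refine Summable.of_nonneg_of_le (fun _ => by positivity) (fun n => ?_)
        ((hasSum_sq_coeff (fourierBasis d) u).summable.add (h1.mul_left (2 * c0 d α)⁻¹))
      have hw : (sobolevWeight α n)⁻¹ ^ 2 = (max 1 ‖(latticePoint n : Space d)‖) ^ α := by
        have := sobolevWeight_sq α n
        have h3 := (sobolevWeight_pos α n).ne'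
        field_simp
        linarith
      have h4 : (max 1 ‖(latticePoint n : Space d)‖) ^ α ≤ 1 + ‖(0 : Space d) + freq n‖ ^ α := by
        rw [zero_add, norm_freq]
        rcases le_total ‖(latticePoint n : Space d)‖ 1 with h | h
        · rw [max_eq_left h, Real.one_rpow]
          linarith [Real.rpow_nonneg (by positivity : 0 ≤ 2 * Real.pi *
            ‖(latticePoint n : Space d)‖) α]
        · rw [max_eq_right h]
          have : ‖(latticePoint n : Space d)‖ ^ α ≤
              (2 * Real.pi * ‖(latticePoint n : Space d)‖) ^ α := by
            refine Real.rpow_le_rpow (norm_nonneg _) ?_ h0.le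
            nlinarith [Real.pi_gt_three]
          linarith
      rw [norm_mul, mul_pow, norm_inv, Complex.norm_real, Real.norm_eq_abs,
        abs_of_pos (sobolevWeight_pos α n), hw]
      have h5 : (2 * c0 d α)⁻¹ * (‖inner ℂ (fourierBasis d n) u‖ ^ 2 *
          (2 * c0 d α * ‖(0 : Space d) + freq n‖ ^ α)) =
          ‖(0 : Space d) + freq n‖ ^ α * ‖inner ℂ (fourierBasis d n) u‖ ^ 2 := by
        field_simp
      rw [h5]
      have := mul_le_mul_of_nonneg_right h4 (sq_nonneg ‖inner ℂ (fourierBasis d n) u‖)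
      rw [add_mul, one_mul] at this
      exact this
    obtain ⟨f, hf⟩ := exists_of_summable_sq (fourierBasis d) hsum
    refine ⟨f, eq_of_coeff_eq (fourierBasis d) fun n => ?_⟩
    have h3 : (sobolevWeight α n : ℂ) ≠ 0 := by exact_mod_cast (sobolevWeight_pos α n).ne'
    rw [coeff_smoothing, hf, mul_inv_cancel_left₀ h3]
  · rintro ⟨f, rfl⟩
    exact (energy_smoothing_le h0 h2 0 f).trans_lt ENNReal.ofReal_lt_top

end

section

variable {d : ℕ}

/-! ### The weighted measure on pairs and the form as a bounded operator -/

/-- The measure `μ(x,y) |x-y|^{-d-α} dx dy` on `Ω × ℝᵈ`. -/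
def levyMeasure (α : ℝ) (μ : Space d → Space d → ℝ) : Measure (Space d × Space d) :=
  (pairMeasure d).withDensity fun p => ENNReal.ofReal (kernel α μ p)

theorem pairMeasure_le_volume : pairMeasure d ≤ volume := by
  rw [Measure.volume_eq_prod]
  exact Measure.prod_mono Measure.restrict_le_self le_rfl

theorem ae_pairMeasure_of_ae {P : Space d × Space d → Prop} (h : ∀ᵐ p, P p) :
    ∀ᵐ p ∂(pairMeasure d), P p :=
  ae_mono pairMeasure_le_volume h

section

variable {α μm μp : ℝ} {μ : Space d → Space d → ℝ}

theorem IsAdmissible.aestronglyMeasurable_pair (hμ : IsAdmissible μm μp μ) :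
    AEStronglyMeasurable (fun p : Space d × Space d => μ p.1 p.2) (pairMeasure d) :=
  hμ.aestronglyMeasurable.mono_measure pairMeasure_le_volume

theorem IsAdmissible.le (hμ : IsAdmissible μm μp μ) : μm ≤ μp := by
  obtain ⟨p, hp⟩ := hμ.bounds.exists
  exact hp.1.trans hp.2

theorem IsAdmissible.aestronglyMeasurable_kernel (hμ : IsAdmissible μm μp μ) :
    AEStronglyMeasurable (kernel α μ) (pairMeasure d) := by
  refine hμ.aestronglyMeasurable_pair.div₀ ?_
  exact (by fun_prop : Measurable fun p : Space d × Space d =>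
    ‖p.1 - p.2‖ ^ ((d : ℝ) + α)).aestronglyMeasurable

theorem IsAdmissible.aemeasurable_density (hμ : IsAdmissible μm μp μ) :
    AEMeasurable (fun p => ENNReal.ofReal (kernel α μ p)) (pairMeasure d) :=
  hμ.aestronglyMeasurable_kernel.aemeasurable.ennreal_ofReal

theorem levyMeasure_absolutelyContinuous : levyMeasure α μ ≪ pairMeasure d :=
  withDensity_absolutelyContinuous _ _

theorem IsAdmissible.lintegral_levyMeasure_le (hμ : IsAdmissible μm μp μ)
    (hμm : 0 < μm) {F : Space d × Space d → ℝ≥0∞} (hF : AEMeasurable F (pairMeasure d)) :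
    ∫⁻ p, F p ∂(levyMeasure α μ) ≤
      ENNReal.ofReal μp * ∫⁻ p, rieszKernel α p * F p ∂(pairMeasure d) := by
  rw [levyMeasure, lintegral_withDensity_eq_lintegral_mul₀ hμ.aemeasurable_density hF,
    ← lintegral_const_mul' _ _ ENNReal.ofReal_ne_top]
  refine lintegral_mono_ae ?_
  filter_upwards [ae_pairMeasure_of_ae hμ.bounds] with p hp
  rw [Pi.mul_apply, ← mul_assoc, rieszKernel, ← ENNReal.ofReal_mul (hμm.le.trans (hp.1.trans hp.2)),
    kernel, mul_one_div]
  gcongr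
  exact hp.2

theorem IsAdmissible.le_lintegral_levyMeasure (hμ : IsAdmissible μm μp μ)
    (hμm : 0 < μm) {F : Space d × Space d → ℝ≥0∞} (hF : AEMeasurable F (pairMeasure d)) :
    ENNReal.ofReal μm * ∫⁻ p, rieszKernel α p * F p ∂(pairMeasure d) ≤
      ∫⁻ p, F p ∂(levyMeasure α μ) := by
  rw [levyMeasure, lintegral_withDensity_eq_lintegral_mul₀ hμ.aemeasurable_density hF,
    ← lintegral_const_mul' _ _ ENNReal.ofReal_ne_top]
  refine lintegral_mono_ae ?_
  filter_upwards [ae_pairMeasure_of_ae hμ.bounds] with p hp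
  rw [Pi.mul_apply, ← mul_assoc, rieszKernel, ← ENNReal.ofReal_mul hμm.le, kernel, mul_one_div]
  gcongr
  exact hp.1

theorem IsAdmissible.ae_kernel_nonneg (hμ : IsAdmissible μm μp μ) (hμm : 0 < μm) :
    ∀ᵐ p ∂(pairMeasure d), 0 ≤ kernel α μ p := by
  filter_upwards [ae_pairMeasure_of_ae hμ.bounds] with p hp
  exact div_nonneg (hμm.le.trans hp.1) (by positivity)

theorem IsAdmissible.integrable_levyMeasure_iff (hμ : IsAdmissible μm μp μ) (hμm : 0 < μm)
    {g : Space d × Space d → ℂ} :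
    Integrable g (levyMeasure α μ) ↔
      Integrable (fun p => (kernel α μ p : ℂ) * g p) (pairMeasure d) := by
  rw [levyMeasure, integrable_withDensity_iff_integrable_smul₀' hμ.aemeasurable_density
    (Filter.Eventually.of_forall fun _ => ENNReal.ofReal_lt_top)]
  refine integrable_congr ?_
  filter_upwards [hμ.ae_kernel_nonneg hμm (α := α)] with p hp
  rw [ENNReal.toReal_ofReal hp, Complex.real_smul]

theorem IsAdmissible.integral_levyMeasure (hμ : IsAdmissible μm μp μ) (hμm : 0 < μm)
    (g : Space d × Space d → ℂ) :
    ∫ p, g p ∂(levyMeasure α μ) = ∫ p, (kernel α μ p : ℂ) * g p ∂(pairMeasure d) := by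
  rw [levyMeasure, integral_withDensity_eq_integral_toReal_smul₀ hμ.aemeasurable_density
    (Filter.Eventually.of_forall fun _ => ENNReal.ofReal_lt_top)]
  refine integral_congr_ae ?_
  filter_upwards [hμ.ae_kernel_nonneg hμm (α := α)] with p hp
  rw [ENNReal.toReal_ofReal hp, Complex.real_smul]

theorem memLp_two_of_lintegral_lt_top {X : Type*} {_ : MeasurableSpace X} {ν : Measure X}
    {F : X → ℂ} (hF : AEStronglyMeasurable F ν) (h : ∫⁻ x, ‖F x‖ₑ ^ 2 ∂ν < ∞) : MemLp F 2 ν := by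
  refine ⟨hF, ?_⟩
  rw [eLpNorm_lt_top_iff_lintegral_rpow_enorm_lt_top two_ne_zero ENNReal.ofNat_ne_top]
  simpa using h

theorem ofReal_norm_toLp_sq {X : Type*} {_ : MeasurableSpace X} {ν : Measure X}
    {F : X → ℂ} (hF : MemLp F 2 ν) :
    ENNReal.ofReal (‖hF.toLp F‖ ^ 2) = ∫⁻ x, ‖F x‖ₑ ^ 2 ∂ν := by
  rw [← lintegral_sq_enorm]
  refine lintegral_congr_ae ?_
  filter_upwards [hF.coeFn_toLp] with x hx
  rw [hx]

theorem norm_sq_le_of_ofReal_le {E : Type*} [SeminormedAddCommGroup E] {v : E} {C : ℝ}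
    (hC : 0 ≤ C) (h : ENNReal.ofReal (‖v‖ ^ 2) ≤ ENNReal.ofReal C) : ‖v‖ ^ 2 ≤ C :=
  (ENNReal.ofReal_le_ofReal_iff hC).1 h

theorem twistDiff_add (ξ : Space d) (u v : L2Cell d) :
    twistDiff ξ (u + v : L2Cell d) =ᵐ[pairMeasure d] fun p => twistDiff ξ u p + twistDiff ξ v p := by
  filter_upwards [ae_pairMeasure (periodicExt_add u v)] with p hp
  simp only [twistDiff, hp.1, hp.2]; ring

theorem twistDiff_smul (ξ : Space d) (c : ℂ) (u : L2Cell d) :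
    twistDiff ξ (c • u : L2Cell d) =ᵐ[pairMeasure d] fun p => c * twistDiff ξ u p := by
  filter_upwards [ae_pairMeasure (periodicExt_smul c u)] with p hp
  simp only [twistDiff, hp.1, hp.2]; ring

/-- Once the unimodular factor e^{i⟨ξ,x⟩}, invisible to the form, is taken out, ξ enters only
through e^{i⟨ξ,y-x⟩}, a function of the difference variable. -/
theorem blochFun_sub (ξ : Space d) (u : L2Cell d) (p : Space d × Space d) :
    blochFun ξ u p.1 - blochFun ξ u p.2 = expChar ξ p.1 * twistDiff ξ u p := by
  have : expChar ξ p.2 = expChar ξ p.1 * expChar ξ (p.2 - p.1) := by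
    rw [← expChar_add_right, add_sub_cancel]
  change expChar ξ p.1 * _ - expChar ξ p.2 * _ = _
  rw [this, twistDiff]; ring

theorem formIntegrand_eq (ξ : Space d) (u w : L2Cell d) (p : Space d × Space d) :
    formIntegrand α μ ξ u w p =
      (kernel α μ p : ℂ) * (twistDiff ξ u p * conj (twistDiff ξ w p)) := by
  have h : expChar ξ p.1 * conj (expChar ξ p.1) = 1 := by
    rw [Complex.mul_conj', norm_expChar]; simp
  rw [formIntegrand, blochFun_sub, blochFun_sub, map_mul]
  linear_combination (kernel α μ p : ℂ) * (twistDiff ξ u p * conj (twistDiff ξ w p)) * h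

variable [NeZero d]

theorem IsAdmissible.lintegral_twistDiff_le (hμ : IsAdmissible μm μp μ) (hμm : 0 < μm)
    (h0 : 0 < α) (h2 : α < 2) (ξ : Space d) (f : L2Cell d) :
    ∫⁻ p, ‖twistDiff ξ (smoothing d h0 f) p‖ₑ ^ 2 ∂(levyMeasure α μ) ≤
      ENNReal.ofReal (μp * (2 * c0 d α * (‖ξ‖ + 2 * Real.pi) ^ α) * ‖f‖ ^ 2) := by
  refine (hμ.lintegral_levyMeasure_le hμm
    ((aestronglyMeasurable_twistDiff ξ _).enorm.pow_const 2)).trans ?_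
  rw [mul_assoc μp, ENNReal.ofReal_mul (hμm.le.trans hμ.le)]
  exact mul_le_mul_right (energy_smoothing_le h0 h2 ξ f) _

theorem IsAdmissible.memLp_twistDiff (hμ : IsAdmissible μm μp μ) (hμm : 0 < μm)
    (h0 : 0 < α) (h2 : α < 2) (ξ : Space d) (f : L2Cell d) :
    MemLp (twistDiff ξ (smoothing d h0 f)) 2 (levyMeasure α μ) :=
  memLp_two_of_lintegral_lt_top
    ((aestronglyMeasurable_twistDiff ξ _).mono_ac levyMeasure_absolutelyContinuous)
    ((hμ.lintegral_twistDiff_le hμm h0 h2 ξ f).trans_lt ENNReal.ofReal_lt_top)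

/-- The bound for the operator `f ↦ (Sf)(x) - e^{i⟨ξ,y-x⟩}(Sf)(y)`. -/
def twistBound (d : ℕ) [NeZero d] (α μp R : ℝ) : ℝ :=
  Real.sqrt (μp * (2 * c0 d α * (R + 2 * Real.pi) ^ α))

/-- The operator `f ↦ (Sf)(x) - e^{i⟨ξ,y-x⟩}(Sf)(y)` into `L₂` of the weighted measure. -/
def IsAdmissible.twistOp (hμ : IsAdmissible μm μp μ) (hμm : 0 < μm)
    (h0 : 0 < α) (h2 : α < 2) (ξ : Space d) : L2Cell d →L[ℂ] Lp ℂ 2 (levyMeasure α μ) :=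
  LinearMap.mkContinuous
    { toFun := fun f => (hμ.memLp_twistDiff hμm h0 h2 ξ f).toLp _
      map_add' := fun f g => by
        rw [← MemLp.toLp_add]
        refine (MemLp.toLp_eq_toLp_iff _ _).2 ?_
        rw [map_add]
        exact levyMeasure_absolutelyContinuous.ae_le (twistDiff_add ξ _ _)
      map_smul' := fun c f => by
        rw [RingHom.id_apply, ← MemLp.toLp_const_smul]
        refine (MemLp.toLp_eq_toLp_iff _ _).2 ?_
        rw [map_smul]
        exact levyMeasure_absolutelyContinuous.ae_le (twistDiff_smul ξ _ _) }
    (twistBound d α μp ‖ξ‖)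
    (fun f => by
      have hc := (c0_pos (d := d) h0 h2).le
      have hp := hμm.le.trans hμ.le
      refine le_of_sq_le_sq ?_ (mul_nonneg (Real.sqrt_nonneg _) (norm_nonneg _))
      rw [mul_pow, twistBound, Real.sq_sqrt (by positivity)]
      refine norm_sq_le_of_ofReal_le (by positivity) ?_
      change ENNReal.ofReal (‖(hμ.memLp_twistDiff hμm h0 h2 ξ f).toLp _‖ ^ 2) ≤ _
      rw [ofReal_norm_toLp_sq]
      exact hμ.lintegral_twistDiff_le hμm h0 h2 ξ f)

variable (hμ : IsAdmissible μm μp μ) (hμm : 0 < μm) (h0 : 0 < α) (h2 : α < 2) (ξ : Space d)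

theorem IsAdmissible.norm_twistOp_le : ‖hμ.twistOp hμm h0 h2 ξ‖ ≤ twistBound d α μp ‖ξ‖ :=
  LinearMap.mkContinuous_norm_le _ (Real.sqrt_nonneg _) _

theorem IsAdmissible.coeFn_twistOp (f : L2Cell d) :
    hμ.twistOp hμm h0 h2 ξ f =ᵐ[levyMeasure α μ] twistDiff ξ (smoothing d h0 f) :=
  (hμ.memLp_twistDiff hμm h0 h2 ξ f).coeFn_toLp

theorem IsAdmissible.ofReal_norm_twistOp_sq (f : L2Cell d) :
    ENNReal.ofReal (‖hμ.twistOp hμm h0 h2 ξ f‖ ^ 2) =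
      ∫⁻ p, ‖twistDiff ξ (smoothing d h0 f) p‖ₑ ^ 2 ∂(levyMeasure α μ) :=
  ofReal_norm_toLp_sq (hμ.memLp_twistDiff hμm h0 h2 ξ f)

/-- The bounded operator `B` with `(B f, g) = a(ξ)[Sf, Sg]`. -/
def IsAdmissible.formOp : L2Cell d →L[ℂ] L2Cell d :=
  (1 / 2 : ℂ) • (ContinuousLinearMap.adjoint (hμ.twistOp hμm h0 h2 ξ) ∘L hμ.twistOp hμm h0 h2 ξ)

theorem IsAdmissible.inner_formOp (f g : L2Cell d) :
    inner ℂ g (hμ.formOp hμm h0 h2 ξ f) =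
      (1 / 2 : ℂ) * inner ℂ (hμ.twistOp hμm h0 h2 ξ g) (hμ.twistOp hμm h0 h2 ξ f) := by
  rw [formOp, smul_apply, inner_smul_right, ContinuousLinearMap.comp_apply,
    ContinuousLinearMap.adjoint_inner_right]

theorem IsAdmissible.inner_formOp_left (f g : L2Cell d) :
    inner ℂ (hμ.formOp hμm h0 h2 ξ f) g = inner ℂ f (hμ.formOp hμm h0 h2 ξ g) := by
  rw [← inner_conj_symm, inner_formOp, inner_formOp, map_mul, inner_conj_symm, map_div₀, map_one,
    Complex.conj_ofNat]

theorem IsAdmissible.inner_formOp_self (f : L2Cell d) :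
    inner ℂ f (hμ.formOp hμm h0 h2 ξ f) = ((1 / 2 * ‖hμ.twistOp hμm h0 h2 ξ f‖ ^ 2 : ℝ) : ℂ) := by
  rw [inner_formOp, inner_self_eq_norm_sq_to_K]
  push_cast
  rfl

theorem IsAdmissible.re_inner_formOp_self (f : L2Cell d) :
    (inner ℂ f (hμ.formOp hμm h0 h2 ξ f)).re = 1 / 2 * ‖hμ.twistOp hμm h0 h2 ξ f‖ ^ 2 := by
  rw [inner_formOp_self, Complex.ofReal_re]

theorem IsAdmissible.integrable_twistDiff_mul (hμ : IsAdmissible μm μp μ) (hμm : 0 < μm)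
    (h0 : 0 < α) (h2 : α < 2) (ξ η : Space d) (f g : L2Cell d) :
    Integrable (fun p => twistDiff ξ (smoothing d h0 f) p * conj (twistDiff η (smoothing d h0 g) p))
      (levyMeasure α μ) :=
  (hμ.memLp_twistDiff hμm h0 h2 ξ f).integrable_mul (hμ.memLp_twistDiff hμm h0 h2 η g).star

theorem IsAdmissible.inner_twistOp (f g : L2Cell d) :
    inner ℂ (hμ.twistOp hμm h0 h2 ξ g) (hμ.twistOp hμm h0 h2 ξ f) =
      ∫ p, twistDiff ξ (smoothing d h0 f) p * conj (twistDiff ξ (smoothing d h0 g) p)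
        ∂(levyMeasure α μ) := by
  rw [L2.inner_def]
  refine integral_congr_ae ?_
  filter_upwards [hμ.coeFn_twistOp hμm h0 h2 ξ f, hμ.coeFn_twistOp hμm h0 h2 ξ g] with p h1 h3
  rw [h1, h3, RCLike.inner_apply]

theorem IsAdmissible.integrable_formIntegrand (hμ : IsAdmissible μm μp μ) (hμm : 0 < μm)
    (h0 : 0 < α) (h2 : α < 2) (ξ : Space d)
    (f g : L2Cell d) :
    Integrable (formIntegrand α μ ξ (smoothing d h0 f) (smoothing d h0 g)) (pairMeasure d) := by
  have := (hμ.integrable_levyMeasure_iff hμm).1 (hμ.integrable_twistDiff_mul hμm h0 h2 ξ ξ f g)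
  refine this.congr (Filter.Eventually.of_forall fun p => ?_)
  rw [formIntegrand_eq]

theorem IsAdmissible.form_smoothing (f g : L2Cell d) :
    form α μ ξ (smoothing d h0 f) (smoothing d h0 g) = inner ℂ g (hμ.formOp hμm h0 h2 ξ f) := by
  rw [inner_formOp, inner_twistOp, hμ.integral_levyMeasure hμm, form]
  simp only [formIntegrand_eq]

/-- The graph of `𝔸(ξ)` in terms of the bounded operators `S` and `B`. -/
theorem IsAdmissible.mem_operatorGraph_iff (u f : L2Cell d) :
    (u, f) ∈ operatorGraph α μ ξ ↔
      ∃ g, smoothing d h0 g = u ∧ hμ.formOp hμm h0 h2 ξ g = smoothing d h0 f := by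
  constructor
  · rintro ⟨hu, h⟩
    obtain ⟨g, hg⟩ := (mem_periodicSobolev_iff_range h0 h2 u).1 hu
    refine ⟨g, hg, ext_inner_left ℂ fun k => ?_⟩
    have := (h (smoothing d h0 k) ((mem_periodicSobolev_iff_range h0 h2 _).2 ⟨k, rfl⟩)).2
    simp only at this
    rw [← hμ.form_smoothing hμm h0 h2, hg, this, inner_smoothing_left]
  · rintro ⟨g, rfl, hg⟩
    refine ⟨(mem_periodicSobolev_iff_range h0 h2 _).2 ⟨g, rfl⟩, fun η hη => ?_⟩
    obtain ⟨k, rfl⟩ := (mem_periodicSobolev_iff_range h0 h2 η).1 hη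
    refine ⟨hμ.integrable_formIntegrand hμm h0 h2 ξ g k, ?_⟩
    simp only
    rw [hμ.form_smoothing hμm h0 h2, hg, inner_smoothing_left]

theorem IsAdmissible.levyOperator_iff (u f : L2Cell d) :
    (∃ h : u ∈ (levyOperator α μ ξ).domain, levyOperator α μ ξ ⟨u, h⟩ = f) ↔
      ∃ g, smoothing d h0 g = u ∧ hμ.formOp hμm h0 h2 ξ g = smoothing d h0 f := by
  rw [← hμ.mem_operatorGraph_iff hμm h0 h2]
  -- `toLinearPMap` has the prescribed graph only if that graph is single-valued, which follows from
  -- applying the injectivity of S twice.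
  have hinj : ∀ x ∈ operatorGraph α μ ξ, x.1 = 0 → x.2 = 0 := by
    rintro ⟨v, w⟩ hvw rfl
    obtain ⟨g, hg, hg2⟩ := (hμ.mem_operatorGraph_iff hμm h0 h2 ξ _ _).1 hvw
    have hg0 : g = 0 := smoothing_injective h0 (by rw [hg, map_zero])
    rw [hg0, map_zero] at hg2
    exact smoothing_injective h0 (by rw [← hg2, map_zero])
  conv_rhs => rw [← Submodule.toLinearPMap_graph_eq (operatorGraph α μ ξ) hinj]
  rw [LinearPMap.mem_graph_iff]
  constructor
  · rintro ⟨h, rfl⟩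
    exact ⟨⟨u, h⟩, rfl, rfl⟩
  · rintro ⟨y, rfl, rfl⟩
    exact ⟨y.2, rfl⟩

/-- The form is bounded below on the complement of the constants. -/
theorem IsAdmissible.le_re_inner_formOp (hξ : ‖ξ‖ ≤ Real.pi) (f : L2Cell d) :
    spectralGap d α μm * (‖f‖ ^ 2 - ‖inner ℂ (oneCell d) f‖ ^ 2) ≤
      (inner ℂ f (hμ.formOp hμm h0 h2 ξ f)).re := by
  have h1 := hμ.le_lintegral_levyMeasure hμm (α := α)
    ((aestronglyMeasurable_twistDiff ξ (smoothing d h0 f)).enorm.pow_const 2)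
  have h3 := le_energy_smoothing h0 h2 hξ f
  have h4 : ENNReal.ofReal (μm * (2 * c0 d α * Real.pi ^ α *
      (‖f‖ ^ 2 - ‖inner ℂ (oneCell d) f‖ ^ 2))) ≤
      ENNReal.ofReal (‖hμ.twistOp hμm h0 h2 ξ f‖ ^ 2) := by
    rw [hμ.ofReal_norm_twistOp_sq, ENNReal.ofReal_mul hμm.le]
    exact (mul_le_mul_right h3 _).trans h1
  rw [ENNReal.ofReal_le_ofReal_iff (by positivity)] at h4
  rw [hμ.re_inner_formOp_self, spectralGap]
  linarith

end

end

/-! ### The resolvent, the lowest eigenvector and the spectral gap -/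

section

/-- Lax–Milgram. It is used to invert B(ξ) + S² for the resolvent and B(0) + P for the cell
problems. -/
theorem exists_inverse_of_coercive {H : Type*} [NormedAddCommGroup H] [InnerProductSpace ℂ H]
    [CompleteSpace H] (T : H →L[ℂ] H) {c : ℝ} (hc : 0 < c)
    (h : ∀ x, c * ‖x‖ ^ 2 ≤ (inner ℂ x (T x)).re) :
    ∃ N : H →L[ℂ] H, (∀ x, T (N x) = x) ∧ ∀ x, N (T x) = x := by
  have hu : IsUnit T := ContinuousLinearMap.isUnit_of_forall_le_norm_inner_map T
    (c := ⟨c, hc.le⟩) hc fun x => by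
      rw [← inner_conj_symm, RCLike.norm_conj, mul_comm]
      exact (h x).trans ((le_abs_self _).trans (Complex.abs_re_le_norm _))
  obtain ⟨N, h1, h2⟩ := isUnit_iff_exists.1 hu
  exact ⟨N, fun x => congrArg (fun L : H →L[ℂ] H => L x) h1,
    fun x => congrArg (fun L : H →L[ℂ] H => L x) h2⟩

section

variable {d : ℕ} {α μm μp : ℝ} {μ : Space d → Space d → ℝ} [NeZero d]
  (hμ : IsAdmissible μm μp μ) (hμm : 0 < μm) (h0 : 0 < α) (h2 : α < 2) {ξ : Space d}

theorem spectralGap_pos (hμm : 0 < μm) (h0 : 0 < α) (h2 : α < 2) : 0 < spectralGap d α μm := by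
  have := c0_pos (d := d) h0 h2
  have := Real.pi_pos
  unfold spectralGap; positivity

/-- The resolvent `(𝔸(ξ) + 1)⁻¹`. -/
theorem IsAdmissible.exists_resolvent (hξ : ‖ξ‖ ≤ Real.pi) :
    ∃ R : L2Cell d →L[ℂ] L2Cell d, IsCompactOperator R ∧ IsSelfAdjoint R ∧
      (∀ u, u ≠ 0 → 0 < (inner ℂ u (R u)).re) ∧
      (∀ u f, (∃ h : u ∈ (levyOperator α μ ξ).domain, levyOperator α μ ξ ⟨u, h⟩ = f) ↔
        u = R (f + u)) ∧
      (1 + (inner ℂ (oneCell d) (hμ.formOp hμm h0 h2 ξ (oneCell d))).re)⁻¹ ≤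
        (inner ℂ (oneCell d) (R (oneCell d))).re := by
  set S := smoothing d h0 with hS
  set B := hμ.formOp hμm h0 h2 ξ with hB
  have hgap := spectralGap_pos (d := d) hμm h0 h2
  -- If u = Sg and Bg = Sf, adding S²g = Su gives Tg = S(f + u), so the resolvent is S T⁻¹ S.
  set T : L2Cell d →L[ℂ] L2Cell d := B + S ∘L S with hT
  have hTapp : ∀ f, T f = B f + S (S f) := fun f => rfl
  have hTre : ∀ f, (inner ℂ f (T f)).re = (inner ℂ f (B f)).re + ‖S f‖ ^ 2 := fun f => by
    rw [hTapp, inner_add_right, Complex.add_re, ← inner_smoothing_left, inner_self_eq_norm_sq_to_K]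
    norm_cast
  have hTsym : ∀ f g, inner ℂ (T f) g = inner ℂ f (T g) := fun f g => by
    rw [hTapp, hTapp, inner_add_left, inner_add_right, hB, hμ.inner_formOp_left, hS,
      inner_smoothing_left, inner_smoothing_left]
  have hcpos : 0 < min 1 (spectralGap d α μm) := lt_min one_pos hgap
  -- B controls the part of f orthogonal to constants; S² controls the constant part because S fixes
  -- the constant 1.
  have hcoer : ∀ f, min 1 (spectralGap d α μm) * ‖f‖ ^ 2 ≤ (inner ℂ f (T f)).re := fun f => by
    rw [hTre]
    have h1 := hμ.le_re_inner_formOp hμm h0 h2 ξ hξ f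
    have h3 : ‖inner ℂ (oneCell d) f‖ ≤ ‖S f‖ := by
      rw [← inner_oneCell_smoothing h0 f]
      refine (norm_inner_le_norm _ _).trans ?_
      rw [norm_oneCell, one_mul]
    have h4 : ‖inner ℂ (oneCell d) f‖ ≤ ‖f‖ := by
      refine (norm_inner_le_norm _ _).trans ?_
      rw [norm_oneCell, one_mul]
    have h5 : ‖inner ℂ (oneCell d) f‖ ^ 2 ≤ ‖S f‖ ^ 2 := by gcongr
    have h6 : ‖inner ℂ (oneCell d) f‖ ^ 2 ≤ ‖f‖ ^ 2 := by gcongr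
    have h7 := min_le_left 1 (spectralGap d α μm)
    have h8 := min_le_right 1 (spectralGap d α μm)
    nlinarith [sq_nonneg ‖inner ℂ (oneCell d) f‖]
  obtain ⟨N, hTN, hNT⟩ := exists_inverse_of_coercive T hcpos hcoer
  have hNsym : ∀ f g, inner ℂ (N f) g = inner ℂ f (N g) := fun f g => by
    calc inner ℂ (N f) g = inner ℂ (N f) (T (N g)) := by rw [hTN]
      _ = inner ℂ f (N g) := by rw [← hTsym, hTN]
  have hRapp : ∀ f, (S ∘L N ∘L S) f = S (N (S f)) := fun f => rfl
  have hRinner : ∀ u, inner ℂ u (S (N (S u))) = inner ℂ (N (S u)) (T (N (S u))) := fun u => by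
    rw [hTN, ← inner_smoothing_left, hNsym]
  refine ⟨S ∘L N ∘L S, ?_, ?_, ?_, ?_, ?_⟩
  · exact (isCompactOperator_smoothing h0).comp_clm (N ∘L S)
  · refine ContinuousLinearMap.isSelfAdjoint_iff_isSymmetric.2 fun f g => ?_
    change inner ℂ (S (N (S f))) g = inner ℂ f (S (N (S g)))
    rw [inner_smoothing_left, hNsym, inner_smoothing_left]
  · intro u hu
    rw [hRapp, hRinner]
    refine lt_of_lt_of_le ?_ (hcoer _)
    have : N (S u) ≠ 0 := fun h => by
      have h3 := hTN (S u)
      rw [h, map_zero] at h3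
      exact hu (smoothing_injective h0 (by rw [map_zero, h3]))
    have := norm_pos_iff.2 this
    positivity
  · intro u f
    rw [hμ.levyOperator_iff hμm h0 h2]
    constructor
    · rintro ⟨g, rfl, hg⟩
      have : T g = S (f + S g) := by rw [hTapp, map_add, ← hg]
      rw [hRapp, ← this, hNT]
    · intro hu
      refine ⟨N (S (f + u)), hu.symm, ?_⟩
      have h3 := hTN (S (f + u))
      rw [hTapp] at h3
      have h4 : S (N (S (f + u))) = u := hu.symm
      rw [h4] at h3
      have h5 : S (f + u) = S f + S u := map_add _ _ _
      exact add_right_cancel (h3.trans h5)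
  · set e := oneCell d with he
    set w := N e with hw
    have hSe : S e = e := smoothing_oneCell h0
    have hTw : T w = e := hTN e
    have hre : (inner ℂ e (T e)).re = 1 + (inner ℂ e (B e)).re := by
      rw [hTre, hSe, he, norm_oneCell]; ring
    have hpos : 0 < 1 + (inner ℂ e (B e)).re := by
      rw [← hre]
      refine lt_of_lt_of_le ?_ (hcoer _)
      rw [he, norm_oneCell]; simpa using hgap
    have hR : (inner ℂ e ((S ∘L N ∘L S) e)).re = (inner ℂ w (T w)).re := by
      rw [hRapp, hRinner, hSe]
    have h1 : (inner ℂ e (T w)).re = 1 := by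
      rw [hTw, inner_self_eq_norm_sq_to_K, he, norm_oneCell]; simp
    have h3 : (inner ℂ w (T e)).re = 1 := by
      rw [← hTsym, ← inner_conj_symm, Complex.conj_re, h1]
    rw [hR]
    -- Cauchy–Schwarz for the form of T. With t = (Te, e) and w = T⁻¹e, positivity at tw - e reads
    -- t²(Tw, w) ≥ t, the required lower bound.
    have h4 : 0 ≤ (inner ℂ (((1 + (inner ℂ e (B e)).re : ℝ) : ℂ) • w - e)
        (T (((1 + (inner ℂ e (B e)).re : ℝ) : ℂ) • w - e))).re :=
      (mul_nonneg hcpos.le (sq_nonneg _)).trans (hcoer _)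
    rw [map_sub, map_smul, inner_sub_left, inner_sub_right, inner_sub_right, inner_smul_left,
      inner_smul_left, inner_smul_right, inner_smul_right, Complex.conj_ofReal] at h4
    simp only [Complex.sub_re, Complex.re_ofReal_mul] at h4
    rw [h1, h3, hre] at h4
    rw [inv_le_iff_one_le_mul₀ hpos]
    nlinarith

theorem IsAdmissible.exists_spectralMeasure (hμ : IsAdmissible μm μp μ) (hμm : 0 < μm)
    (h0 : 0 < α) (h2 : α < 2) (hξ : ‖ξ‖ ≤ Real.pi) :
    ∃ E : ProjectionValuedMeasure (L2Cell d), E.IsSpectralMeasureOf (levyOperator α μ ξ) := by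
  obtain ⟨R, hc, hs, hpos, hA, -⟩ := hμ.exists_resolvent hμm h0 h2 hξ
  exact exists_isSpectralMeasureOf hc hs hpos hA

/-- There is an eigenvector `Sψ` with eigenvalue at most `a(ξ)[1,1]`. -/
theorem IsAdmissible.exists_eigenvector (hξ : ‖ξ‖ ≤ Real.pi) :
    ∃ (lam : ℝ) (ψ : L2Cell d), ‖smoothing d h0 ψ‖ = 1 ∧
      hμ.formOp hμm h0 h2 ξ ψ = (lam : ℂ) • smoothing d h0 (smoothing d h0 ψ) ∧ 0 ≤ lam ∧
      lam ≤ (inner ℂ (oneCell d) (hμ.formOp hμm h0 h2 ξ (oneCell d))).re := by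
  obtain ⟨R, hc, hs, hpos, hA, hR⟩ := hμ.exists_resolvent hμm h0 h2 hξ
  obtain ⟨r, φ, hφ, hRφ, hr⟩ := exists_eigenvalue_ge hc hs (norm_oneCell (d := d))
  have ha : 0 ≤ (inner ℂ (oneCell d) (hμ.formOp hμm h0 h2 ξ (oneCell d))).re := by
    rw [hμ.re_inner_formOp_self]; positivity
  have hr0 : 0 < r := lt_of_lt_of_le (by positivity) (hR.trans hr)
  have hrC : (r : ℂ) ≠ 0 := by exact_mod_cast hr0.ne'
  -- An eigenvalue r of the resolvent corresponds to λ = 1/r - 1, so the lower bound on r becomes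
  -- the upper bound on λ.
  have heq : φ = R (((1 / r - 1 : ℝ) : ℂ) • φ + φ) := by
    rw [map_add, map_smul, hRφ, smul_smul, ← add_smul]
    have : ((1 / r - 1 : ℝ) : ℂ) * r + r = 1 := by
      push_cast; field_simp; ring
    rw [this, one_smul]
  obtain ⟨ψ, hψ, hBψ⟩ := (hμ.levyOperator_iff hμm h0 h2 ξ _ _).1 ((hA _ _).2 heq)
  rw [map_smul, ← hψ] at hBψ
  refine ⟨1 / r - 1, ψ, by rw [hψ, hφ], hBψ, ?_, ?_⟩
  · have h3 : inner ℂ ψ (hμ.formOp hμm h0 h2 ξ ψ) = ((1 / r - 1 : ℝ) : ℂ) := by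
      rw [hBψ, inner_smul_right, ← inner_smoothing_left, inner_self_eq_norm_sq_to_K, hψ, hφ]
      simp
    have h4 := hμ.re_inner_formOp_self hμm h0 h2 ξ ψ
    rw [h3, Complex.ofReal_re] at h4
    rw [h4]; positivity
  · have := hR.trans hr
    rw [inv_le_comm₀ (by positivity) hr0] at this
    rw [one_div]
    linarith

/-- The quadratic form of `𝔸(ξ)` is large on the complement of the constants. -/
theorem IsAdmissible.eq_zero_of_re_inner_le (hμ : IsAdmissible μm μp μ) (hμm : 0 < μm)
    (h0 : 0 < α) (h2 : α < 2) (hξ : ‖ξ‖ ≤ Real.pi)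
    (u : (levyOperator α μ ξ).domain) (hu : inner ℂ (oneCell d) (u : L2Cell d) = 0)
    (hle : (inner ℂ (u : L2Cell d) (levyOperator α μ ξ u)).re ≤
      spectralGap d α μm / 3 * ‖(u : L2Cell d)‖ ^ 2) : (u : L2Cell d) = 0 := by
  obtain ⟨g, hg, hB⟩ := (hμ.levyOperator_iff hμm h0 h2 ξ (u : L2Cell d) (levyOperator α μ ξ u)).1
    ⟨u.2, rfl⟩
  have hgap := spectralGap_pos (d := d) hμm h0 h2
  have h1 := hμ.le_re_inner_formOp hμm h0 h2 ξ hξ g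
  -- The gap gives d₀‖g‖² ≤ (d₀/3)‖u‖², while ‖u‖ = ‖Sg‖ ≤ ‖g‖; only g = 0 is possible.
  rw [hB, ← inner_smoothing_left, hg, ← inner_oneCell_smoothing h0, hg, hu, norm_zero] at h1
  have h3 : ‖(u : L2Cell d)‖ ≤ ‖g‖ := by rw [← hg]; exact norm_smoothing_le h0 g
  have h4 : ‖(u : L2Cell d)‖ ^ 2 ≤ ‖g‖ ^ 2 := by gcongr
  have h5 : ‖g‖ ^ 2 ≤ 0 := by nlinarith
  have h6 : g = 0 := by
    have : ‖g‖ ^ 2 = 0 := le_antisymm h5 (sq_nonneg _)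
    simpa using this
  rw [← hg, h6, map_zero]

end

end

section

/-! ### Weighted first-order bounds for differences of smoothed functions -/

theorem lintegral_mul_le_sqrt {X : Type*} {_ : MeasurableSpace X} {ν : Measure X}
    {f g : X → ℝ≥0∞} (hf : AEMeasurable f ν) (hg : AEMeasurable g ν) {a b : ℝ}
    (hfa : ∫⁻ x, f x ^ 2 ∂ν ≤ ENNReal.ofReal a) (hgb : ∫⁻ x, g x ^ 2 ∂ν ≤ ENNReal.ofReal b) :
    ∫⁻ x, f x * g x ∂ν ≤ ENNReal.ofReal (Real.sqrt a * Real.sqrt b) := by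
  have h := ENNReal.lintegral_mul_le_Lp_mul_Lq ν Real.HolderConjugate.two_two hf hg
  simp only [Pi.mul_apply, ENNReal.rpow_two] at h
  refine h.trans ?_
  have key : ∀ {t : ℝ} {s : ℝ≥0∞}, s ≤ ENNReal.ofReal t →
      s ^ (1 / 2 : ℝ) ≤ ENNReal.ofReal (Real.sqrt t) := by
    intro t s hs
    rcases le_total 0 t with ht | ht
    · rw [Real.sqrt_eq_rpow, ← ENNReal.ofReal_rpow_of_nonneg ht (by norm_num)]
      exact ENNReal.rpow_le_rpow hs (by norm_num)
    · rw [ENNReal.ofReal_of_nonpos ht] at hs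
      have : s = 0 := le_antisymm hs zero_le
      rw [this, ENNReal.zero_rpow_of_pos (by norm_num)]
      exact zero_le
  rw [ENNReal.ofReal_mul (Real.sqrt_nonneg _)]
  exact mul_le_mul' (key hfa) (key hgb)

theorem lintegral_mul_le_sqrt_of_eq {X : Type*} {_ : MeasurableSpace X} {ν : Measure X}
    {f g h : X → ℝ≥0∞} (hf : AEMeasurable f ν) (hg : AEMeasurable g ν) {a b : ℝ}
    (hfa : ∫⁻ x, f x ^ 2 ∂ν ≤ ENNReal.ofReal a) (hgb : ∫⁻ x, g x ^ 2 ∂ν ≤ ENNReal.ofReal b)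
    (hh : ∀ x, h x = f x * g x) :
    ∫⁻ x, h x ∂ν ≤ ENNReal.ofReal (Real.sqrt a * Real.sqrt b) := by
  simp only [hh]
  exact lintegral_mul_le_sqrt hf hg hfa hgb

section

variable {d : ℕ} {α μm μp : ℝ} {μ : Space d → Space d → ℝ}

theorem lintegral_pair_diff {f : Space d → ℝ≥0∞} (hf : Measurable f) :
    ∫⁻ p, f (p.2 - p.1) ∂(pairMeasure d) = ∫⁻ z, f z := by
  rw [lintegral_pair (F := fun p => f (p.2 - p.1))
    (hf.comp (by fun_prop : Measurable fun p : Space d × Space d => p.2 - p.1)).aemeasurable]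
  simp

theorem rieszKernel_mul_ofReal (f : Space d → ℝ) (p : Space d × Space d) :
    rieszKernel α p * ENNReal.ofReal (f (p.2 - p.1)) =
      ENNReal.ofReal (f (p.2 - p.1) / ‖p.2 - p.1‖ ^ ((d : ℝ) + α)) := by
  rw [rieszKernel, norm_sub_rev, ← ENNReal.ofReal_mul (by positivity), one_div_mul_eq_div]

/-- The total mass of the kernel `min(|z|², |z|) / |z|^{d+α}`. -/
def levyMass (d : ℕ) (α : ℝ) : ℝ := ∫ z, radialMin d α 2 1 1 z

theorem levyMass_nonneg : 0 ≤ levyMass d α :=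
  integral_nonneg fun z => radialMin_nonneg α 2 1 zero_le_one z

variable [NeZero d]

theorem lintegral_div_le (h1 : 1 < α) (h2 : α < 2) {f : Space d → ℝ} {C R : ℝ} (hC : 0 ≤ C)
    (hR : 0 ≤ R) (hf : ∀ z, f z ≤ C * min ((R * ‖z‖) ^ 2) ((R * ‖z‖) ^ 1)) :
    ∫⁻ z, ENNReal.ofReal (f z / ‖z‖ ^ ((d : ℝ) + α)) ≤
      ENNReal.ofReal (C * (R ^ α * levyMass d α)) := by
  have hint := integrable_radialMin (d := d) (β := α) (p := 2) (q := 1) (by simpa using h1)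
    (by simpa using h2) hR
  have : ∫⁻ z, ENNReal.ofReal (C * radialMin d α 2 1 R z) =
      ENNReal.ofReal (C * (R ^ α * levyMass d α)) := by
    rw [← ofReal_integral_eq_lintegral_ofReal (hint.const_mul C)
      (Filter.Eventually.of_forall fun z => mul_nonneg hC (radialMin_nonneg α 2 1 hR z)),
      integral_const_mul, integral_radialMin (by simpa using h1) (by simpa using h2) hR, levyMass]
  rw [← this]
  refine lintegral_mono fun z => ENNReal.ofReal_le_ofReal ?_
  rw [radialMin, mul_div_assoc']
  exact div_le_div_of_nonneg_right (hf z) (by positivity)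

theorem IsAdmissible.lintegral_weight_le (hμ : IsAdmissible μm μp μ) (hμm : 0 < μm)
    (h1 : 1 < α) (h2 : α < 2) {f : Space d → ℝ}
    (hfm : Measurable f) {C R : ℝ} (hC : 0 ≤ C) (hR : 0 ≤ R)
    (hf : ∀ z, f z ≤ C * min ((R * ‖z‖) ^ 2) ((R * ‖z‖) ^ 1)) :
    ∫⁻ p, ENNReal.ofReal (f (p.2 - p.1)) ∂(levyMeasure α μ) ≤
      ENNReal.ofReal (μp * (C * (R ^ α * levyMass d α))) := by
  have hm : Measurable fun p : Space d × Space d => p.2 - p.1 := by fun_prop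
  refine (hμ.lintegral_levyMeasure_le hμm (hfm.comp hm).ennreal_ofReal.aemeasurable).trans ?_
  simp only [Function.comp_apply, rieszKernel_mul_ofReal]
  rw [lintegral_pair_diff (f := fun z => ENNReal.ofReal (f z / ‖z‖ ^ ((d : ℝ) + α)))
    (by fun_prop), ENNReal.ofReal_mul (hμm.le.trans hμ.le)]
  gcongr
  exact lintegral_div_le h1 h2 hC hR hf

/-- No smoothness of u is used: |u(x) - u(y)|² ≤ 2(|u(x)|² + |u(y)|²), and each half contributes the
mass of the weight times ‖u‖², hence the factor 4. -/
theorem IsAdmissible.lintegral_weight_mul_le (hμ : IsAdmissible μm μp μ) (hμm : 0 < μm)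
    (h1 : 1 < α) (h2 : α < 2) {f : Space d → ℝ}
    (hfm : Measurable f) {C R : ℝ} (hC : 0 ≤ C) (hR : 0 ≤ R)
    (hf : ∀ z, f z ≤ C * min ((R * ‖z‖) ^ 2) ((R * ‖z‖) ^ 1)) (u : L2Cell d) :
    ∫⁻ p, ENNReal.ofReal (f (p.2 - p.1)) * ‖twistDiff 0 u p‖ₑ ^ 2 ∂(levyMeasure α μ) ≤
      ENNReal.ofReal (4 * (μp * (C * (R ^ α * levyMass d α))) * ‖u‖ ^ 2) := by
  have hm : Measurable fun p : Space d × Space d => p.2 - p.1 := by fun_prop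
  set w : Space d → ℝ≥0∞ := fun z => ENNReal.ofReal (f z / ‖z‖ ^ ((d : ℝ) + α)) with hw
  have hwm : Measurable w := by fun_prop
  have hp := hμm.le.trans hμ.le
  have hJ := levyMass_nonneg (d := d) (α := α)
  refine (hμ.lintegral_levyMeasure_le hμm ((hfm.comp hm).ennreal_ofReal.aemeasurable.mul
    ((aestronglyMeasurable_twistDiff 0 u).enorm.pow_const 2))).trans ?_
  have hle : ∫⁻ p, rieszKernel α p * (ENNReal.ofReal (f (p.2 - p.1)) * ‖twistDiff 0 u p‖ₑ ^ 2)
      ∂(pairMeasure d) ≤ 2 * (2 * ((∫⁻ z, w z) * ENNReal.ofReal (‖u‖ ^ 2))) := by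
    calc _ ≤ ∫⁻ p, 2 * (w (p.2 - p.1) * ‖periodicExt u p.1‖ₑ ^ 2 +
          w (p.2 - p.1) * ‖periodicExt u p.2‖ₑ ^ 2) ∂(pairMeasure d) := by
          refine lintegral_mono fun p => ?_
          rw [← mul_assoc, rieszKernel_mul_ofReal, twistDiff_zero, ← mul_add, mul_left_comm]
          exact mul_le_mul_right (enorm_sub_sq_le _ _) _
      _ = _ := by
          rw [lintegral_const_mul' _ _ ENNReal.ofNat_ne_top,
            lintegral_add_left' (aemeasurable_mul_fst hwm u), lintegral_pair_mul_fst hwm,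
            lintegral_pair_mul_snd hwm, ← two_mul]
  calc _ ≤ ENNReal.ofReal μp * (2 * (2 * (ENNReal.ofReal (C * (R ^ α * levyMass d α)) *
          ENNReal.ofReal (‖u‖ ^ 2)))) := by
        refine mul_le_mul_right (hle.trans ?_) _
        gcongr
        exact lintegral_div_le h1 h2 hC hR hf
    _ = _ := by
        have two : ∀ x : ℝ, 2 * ENNReal.ofReal x = ENNReal.ofReal (2 * x) := fun x => by
          rw [ENNReal.ofReal_mul zero_le_two, ENNReal.ofReal_ofNat]
        rw [← ENNReal.ofReal_mul (by positivity), two, two, ← ENNReal.ofReal_mul (by positivity)]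
        congr 1; ring

/-- The constant in `IsAdmissible.lintegral_weight_twistDiff_le`. -/
def weightBound (d : ℕ) [NeZero d] (α μp a c R : ℝ) : ℝ :=
  Real.sqrt (μp * (a ^ 2 * levyMass d α)) * twistBound d α μp 0 +
    2 * (μp * (c * (R ^ α * levyMass d α)))

/-- Near the diagonal a weight O(|z|) is square integrable against the Lévy kernel, and
Cauchy–Schwarz with the energy applies. Far away a weight of linear growth is not square integrable
but, as α > 1, it is integrable; splitting it as √w · √w then requires only the L₂ norm of the
function. -/
theorem IsAdmissible.lintegral_weight_twistDiff_le (hμ : IsAdmissible μm μp μ) (hμm : 0 < μm)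
    (h0 : 0 < α) (h1 : 1 < α) (h2 : α < 2) {w : Space d → ℝ} (hwm : Measurable w)
    (hw0 : ∀ z, 0 ≤ w z) {a c R : ℝ} (hc : 0 ≤ c) (hR : 0 ≤ R)
    (hnear : ∀ z, ‖z‖ < 1 → w z ≤ a * ‖z‖)
    (hfar : ∀ z, 1 ≤ ‖z‖ → w z ≤ c * min ((R * ‖z‖) ^ 2) ((R * ‖z‖) ^ 1)) (f : L2Cell d) :
    ∫⁻ p, ENNReal.ofReal (w (p.2 - p.1)) * ‖twistDiff 0 (smoothing d h0 f) p‖ₑ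
      ∂(levyMeasure α μ) ≤ ENNReal.ofReal (weightBound d α μp a c R * ‖f‖) := by
  have hm : Measurable fun p : Space d × Space d => p.2 - p.1 := by fun_prop
  have hp := hμm.le.trans hμ.le
  have hJ := levyMass_nonneg (d := d) (α := α)
  have hc0 := (c0_pos (d := d) h0 h2).le
  set u := smoothing d h0 f with hu
  have hD : AEMeasurable (fun p => ‖twistDiff 0 u p‖ₑ) (levyMeasure α μ) :=
    ((aestronglyMeasurable_twistDiff 0 u).mono_ac levyMeasure_absolutelyContinuous).enorm
  have hms : MeasurableSet {z : Space d | ‖z‖ < 1} := measurableSet_lt measurable_norm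
    measurable_const
  set n : Space d → ℝ := {z : Space d | ‖z‖ < 1}.indicator w with hn
  set r : Space d → ℝ := {z : Space d | ‖z‖ < 1}ᶜ.indicator w with hr
  have hnm : Measurable n := hwm.indicator hms
  have hrm : Measurable r := hwm.indicator hms.compl
  have hn0 : ∀ z, 0 ≤ n z := fun z => Set.indicator_nonneg (fun _ _ => hw0 _) z
  have hr0 : ∀ z, 0 ≤ r z := fun z => Set.indicator_nonneg (fun _ _ => hw0 _) z
  have hsum : ∀ z, w z = n z + r z := fun z => by
    have := congrFun (Set.indicator_self_add_compl {z : Space d | ‖z‖ < 1} w) z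
    exact this.symm
  have hN : ∫⁻ p, ENNReal.ofReal (n (p.2 - p.1)) * ‖twistDiff 0 u p‖ₑ ∂(levyMeasure α μ) ≤
      ENNReal.ofReal (Real.sqrt (μp * (a ^ 2 * levyMass d α)) *
        Real.sqrt (μp * (2 * c0 d α * (‖(0 : Space d)‖ + 2 * Real.pi) ^ α) * ‖f‖ ^ 2)) := by
    refine lintegral_mul_le_sqrt (hnm.comp hm).ennreal_ofReal.aemeasurable hD ?_
      (hμ.lintegral_twistDiff_le hμm h0 h2 0 f)
    have := hμ.lintegral_weight_le hμm h1 h2 (hnm.pow_const 2) (sq_nonneg a) zero_le_one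
      (fun z => ?_)
    · simp only [Function.comp_apply, ← ENNReal.ofReal_pow (hn0 _)]
      simpa using this
    · rw [hn, one_mul]
      by_cases hz : ‖z‖ < 1
      · rw [Set.indicator_of_mem (by exact hz), min_eq_left
          (pow_le_pow_of_le_one (norm_nonneg z) hz.le one_le_two), ← mul_pow]
        exact pow_le_pow_left₀ (hw0 z) (hnear z hz) 2
      · rw [Set.indicator_of_notMem (by exact hz)]
        rw [zero_pow two_ne_zero]
        positivity
  have hrle : ∀ z, r z ≤ c * min ((R * ‖z‖) ^ 2) ((R * ‖z‖) ^ 1) := fun z => by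
    by_cases hz : ‖z‖ < 1
    · rw [hr, Set.indicator_of_notMem (by simpa using hz)]
      positivity
    · rw [hr, Set.indicator_of_mem (by exact hz)]
      exact hfar z (not_lt.1 hz)
  have hF : ∫⁻ p, ENNReal.ofReal (r (p.2 - p.1)) * ‖twistDiff 0 u p‖ₑ ∂(levyMeasure α μ) ≤
      ENNReal.ofReal (Real.sqrt (μp * (c * (R ^ α * levyMass d α))) *
        Real.sqrt (4 * (μp * (c * (R ^ α * levyMass d α))) * ‖u‖ ^ 2)) := by
    have hsq : ∀ z, ENNReal.ofReal (Real.sqrt (r z)) ^ 2 = ENNReal.ofReal (r z) := fun z => by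
      rw [← ENNReal.ofReal_pow (Real.sqrt_nonneg _), Real.sq_sqrt (hr0 z)]
    have hrs : AEMeasurable (fun p : Space d × Space d =>
        ENNReal.ofReal (Real.sqrt (r (p.2 - p.1)))) (levyMeasure α μ) :=
      (hrm.comp hm).sqrt.ennreal_ofReal.aemeasurable
    -- Cauchy–Schwarz with one factor √w and the other √w times the difference.
    refine lintegral_mul_le_sqrt_of_eq hrs (hrs.mul hD) ?_ ?_ (fun p => ?_)
    · simp only [hsq]
      exact hμ.lintegral_weight_le hμm h1 h2 hrm hc hR hrle
    · simp only [Pi.mul_apply, mul_pow, hsq]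
      exact hμ.lintegral_weight_mul_le hμm h1 h2 hrm hc hR hrle u
    · simp only [Pi.mul_apply]
      rw [← mul_assoc, ← pow_two, hsq]
  have hsplit : ∀ p : Space d × Space d, ENNReal.ofReal (w (p.2 - p.1)) * ‖twistDiff 0 u p‖ₑ =
      ENNReal.ofReal (n (p.2 - p.1)) * ‖twistDiff 0 u p‖ₑ +
        ENNReal.ofReal (r (p.2 - p.1)) * ‖twistDiff 0 u p‖ₑ := fun p => by
    rw [hsum, ENNReal.ofReal_add (hn0 _) (hr0 _), add_mul]
  simp only [hsplit]
  refine (lintegral_add_left' (f := fun p => ENNReal.ofReal (n (p.2 - p.1)) *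
    ‖twistDiff 0 u p‖ₑ) ((hnm.comp hm).ennreal_ofReal.aemeasurable.mul hD) _).le.trans
    ((add_le_add hN hF).trans ?_)
  rw [← ENNReal.ofReal_add (by positivity) (by positivity)]
  refine ENNReal.ofReal_le_ofReal ?_
  have hb : 0 ≤ μp * (c * (R ^ α * levyMass d α)) := by positivity
  rw [weightBound, add_mul, twistBound, norm_zero, Real.sqrt_mul (by positivity) (‖f‖ ^ 2),
    Real.sqrt_sq (norm_nonneg f), Real.sqrt_mul (by positivity) (‖u‖ ^ 2),
    Real.sqrt_sq (norm_nonneg u), Real.sqrt_mul (by norm_num) (μp * _),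
    show (4 : ℝ) = 2 ^ 2 by norm_num, Real.sqrt_sq zero_le_two]
  have h5 := Real.mul_self_sqrt hb
  have h6 : ‖u‖ ≤ ‖f‖ := norm_smoothing_le h0 f
  have h7 : Real.sqrt (μp * (c * (R ^ α * levyMass d α))) *
      (2 * Real.sqrt (μp * (c * (R ^ α * levyMass d α))) * ‖u‖) =
      2 * (μp * (c * (R ^ α * levyMass d α))) * ‖u‖ := by
    linear_combination 2 * ‖u‖ * h5
  rw [h7]
  have := mul_le_mul_of_nonneg_left h6 (mul_nonneg zero_le_two hb)
  linarith

end

end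

section

/-! ### Dependence of the forms on the quasimomentum -/

theorem norm_le_of_forall_inner_le {H : Type*} [NormedAddCommGroup H] [InnerProductSpace ℂ H]
    {m : H} {C : ℝ} (hC : 0 ≤ C) (h : ∀ g, ‖inner ℂ g m‖ ≤ C * ‖g‖) : ‖m‖ ≤ C := by
  have h1 := h m
  rw [inner_self_eq_norm_sq_to_K] at h1
  simp only [norm_pow, RCLike.norm_ofReal, abs_norm] at h1
  rcases (norm_nonneg m).eq_or_lt with h2 | h2
  · rwa [← h2]
  · nlinarith

theorem norm_one_sub_exp_add_le (t : ℝ) :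
    ‖1 - Complex.exp (Complex.I * t) + Complex.I * t‖ ≤ 2 * min (|t| ^ 2) (|t| ^ 1) := by
  have hn : ‖Complex.I * (t : ℂ)‖ = |t| := by simp
  rcases le_total |t| 1 with h | h
  · rw [min_eq_left (pow_le_pow_of_le_one (abs_nonneg t) h one_le_two)]
    have h1 := Complex.norm_exp_sub_one_sub_id_le (x := Complex.I * t) (by rw [hn]; exact h)
    rw [hn] at h1
    rw [show 1 - Complex.exp (Complex.I * t) + Complex.I * t =
      -(Complex.exp (Complex.I * t) - 1 - Complex.I * t) by ring, norm_neg]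
    nlinarith [sq_nonneg |t|]
  · rw [min_eq_right (pow_le_pow_right₀ h one_le_two), pow_one]
    have h1 := Real.norm_exp_I_mul_ofReal_sub_one_le (x := t)
    rw [Real.norm_eq_abs] at h1
    rw [show 1 - Complex.exp (Complex.I * t) + Complex.I * t =
      Complex.I * t - (Complex.exp (Complex.I * t) - 1) by ring]
    refine (norm_sub_le _ _).trans ?_
    rw [hn]; linarith

section

variable {d : ℕ} {α μm μp : ℝ} {μ : Space d → Space d → ℝ}

theorem periodicExt_oneCell : periodicExt (oneCell d) =ᵐ[volume] fun _ => 1 :=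
  (quasiMeasurePreserving_fracPart d).ae_eq (MemLp.coeFn_toLp _)

theorem twistDiff_oneCell (ξ : Space d) :
    twistDiff ξ (oneCell d) =ᵐ[pairMeasure d] fun p => 1 - expChar ξ (p.2 - p.1) := by
  filter_upwards [ae_pairMeasure (periodicExt_oneCell (d := d))] with p hp
  rw [twistDiff, hp.1, hp.2, mul_one]

theorem twistDiff_sub_zero (ξ : Space d) (u : Space d → ℂ) (p : Space d × Space d) :
    twistDiff ξ u p - twistDiff 0 u p = (1 - expChar ξ (p.2 - p.1)) * periodicExt u p.2 := by
  rw [twistDiff_zero, twistDiff]; ring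

theorem measurable_ofReal_inner (ζ : Space d) :
    Measurable fun z : Space d => ((inner ℝ ζ (-z) : ℝ) : ℂ) := by
  fun_prop

variable [NeZero d]

theorem IsAdmissible.weight_mul (hμ : IsAdmissible μm μp μ) (hμm : 0 < μm)
    (h0 : 0 < α) (h1 : 1 < α) (h2 : α < 2) {h : Space d → ℂ} (hm : Measurable h)
    {a c R : ℝ} (hc : 0 ≤ c) (hR : 0 ≤ R) (hnear : ∀ z, ‖z‖ < 1 → ‖h z‖ ≤ a * ‖z‖)
    (hfar : ∀ z, 1 ≤ ‖z‖ → ‖h z‖ ≤ c * min ((R * ‖z‖) ^ 2) ((R * ‖z‖) ^ 1)) (f : L2Cell d) :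
    Integrable (fun p => h (p.2 - p.1) * conj (twistDiff 0 (smoothing d h0 f) p))
      (levyMeasure α μ) ∧
    ‖∫ p, h (p.2 - p.1) * conj (twistDiff 0 (smoothing d h0 f) p) ∂(levyMeasure α μ)‖ ≤
      weightBound d α μp a c R * ‖f‖ := by
  have hb := hμ.lintegral_weight_twistDiff_le hμm h0 h1 h2 hm.norm (fun z => norm_nonneg _) hc hR
    hnear hfar f
  have hp := hμm.le.trans hμ.le
  have hJ := levyMass_nonneg (d := d) (α := α)
  have hW : 0 ≤ weightBound d α μp a c R * ‖f‖ := by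
    have : 0 ≤ twistBound d α μp 0 := Real.sqrt_nonneg _
    unfold weightBound; positivity
  have heq : ∀ p : Space d × Space d,
      ‖h (p.2 - p.1) * conj (twistDiff 0 (smoothing d h0 f) p)‖ₑ =
        ENNReal.ofReal ‖h (p.2 - p.1)‖ * ‖twistDiff 0 (smoothing d h0 f) p‖ₑ := fun p => by
    rw [enorm_mul, ofReal_norm, ← ofReal_norm (conj _), RCLike.norm_conj, ofReal_norm]
  simp only [← heq] at hb
  have hmeas : AEStronglyMeasurable
      (fun p => h (p.2 - p.1) * conj (twistDiff 0 (smoothing d h0 f) p)) (levyMeasure α μ) := by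
    refine AEStronglyMeasurable.mul ?_ ?_
    · exact (hm.comp (by fun_prop : Measurable fun p : Space d × Space d =>
        p.2 - p.1)).aestronglyMeasurable
    · exact Complex.continuous_conj.comp_aestronglyMeasurable
        ((aestronglyMeasurable_twistDiff 0 _).mono_ac levyMeasure_absolutelyContinuous)
  refine ⟨⟨hmeas, hb.trans_lt ENNReal.ofReal_lt_top⟩, ?_⟩
  have h3 := (enorm_integral_le_lintegral_enorm (μ := levyMeasure α μ)
    (fun p => h (p.2 - p.1) * conj (twistDiff 0 (smoothing d h0 f) p))).trans hb
  rw [← ofReal_norm] at h3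
  exact (ENNReal.ofReal_le_ofReal_iff hW).1 h3

theorem weightBound_smul {R : ℝ} (hR : 0 ≤ R) :
    weightBound d α μp R R 1 = weightBound d α μp 1 1 1 * R := by
  unfold weightBound
  rw [show μp * (R ^ 2 * levyMass d α) = R ^ 2 * (μp * (1 ^ 2 * levyMass d α)) by ring,
    Real.sqrt_mul (sq_nonneg R), Real.sqrt_sq hR]
  ring

theorem IsAdmissible.inner_weight_mul (hμ : IsAdmissible μm μp μ) (hμm : 0 < μm)
    (h0 : 0 < α) (h1 : 1 < α) (h2 : α < 2) (ζ : Space d) (f : L2Cell d) :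
    Integrable (fun p => ((inner ℝ ζ (p.1 - p.2) : ℝ) : ℂ) *
      conj (twistDiff 0 (smoothing d h0 f) p)) (levyMeasure α μ) ∧
    ‖∫ p, ((inner ℝ ζ (p.1 - p.2) : ℝ) : ℂ) * conj (twistDiff 0 (smoothing d h0 f) p)
      ∂(levyMeasure α μ)‖ ≤ weightBound d α μp 1 1 1 * ‖ζ‖ * ‖f‖ := by
  have hle : ∀ z : Space d, ‖((inner ℝ ζ (-z) : ℝ) : ℂ)‖ ≤ ‖ζ‖ * ‖z‖ := fun z => by
    rw [Complex.norm_real, Real.norm_eq_abs]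
    simpa using abs_real_inner_le_norm ζ (-z)
  have := hμ.weight_mul hμm h0 h1 h2 (measurable_ofReal_inner ζ) (norm_nonneg ζ)
    zero_le_one (fun z _ => hle z) (fun z hz => ?_) f
  · simpa only [neg_sub, weightBound_smul (norm_nonneg ζ)] using this
  · rw [one_mul, min_eq_right (pow_le_pow_right₀ hz one_le_two), pow_one]
    exact hle z

/-- The functional is antilinear and bounded in g, so the Riesz theorem is applied to its conjugate.
The factor ½ is that of the form, so that m and B(0) appear with equal weight in the cell problem.
-/
theorem IsAdmissible.exists_gradVec (hμ : IsAdmissible μm μp μ) (hμm : 0 < μm)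
    (h0 : 0 < α) (h1 : 1 < α) (h2 : α < 2) (ζ : Space d) :
    ∃ m : L2Cell d, ∀ g, inner ℂ g m = (1 / 2 : ℂ) *
      ∫ p, ((inner ℝ ζ (p.1 - p.2) : ℝ) : ℂ) * conj (twistDiff 0 (smoothing d h0 g) p)
        ∂(levyMeasure α μ) := by
  have hint : ∀ g, Integrable (fun p => ((inner ℝ ζ (p.1 - p.2) : ℝ) : ℂ) *
      twistDiff 0 (smoothing d h0 g) p) (levyMeasure α μ) := fun g => by
    have := Complex.conjCLE.toContinuousLinearMap.integrable_comp
      (hμ.inner_weight_mul hμm h0 h1 h2 ζ g).1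
    simpa using this
  have hconj : ∀ g, ∫ p, ((inner ℝ ζ (p.1 - p.2) : ℝ) : ℂ) * twistDiff 0 (smoothing d h0 g) p
      ∂(levyMeasure α μ) = conj (∫ p, ((inner ℝ ζ (p.1 - p.2) : ℝ) : ℂ) *
        conj (twistDiff 0 (smoothing d h0 g) p) ∂(levyMeasure α μ)) := fun g => by
    rw [← integral_conj]
    refine integral_congr_ae (Filter.Eventually.of_forall fun p => ?_)
    simp
  let L : L2Cell d →L[ℂ] ℂ := LinearMap.mkContinuous
    { toFun := fun g => (1 / 2 : ℂ) * ∫ p, ((inner ℝ ζ (p.1 - p.2) : ℝ) : ℂ) *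
        twistDiff 0 (smoothing d h0 g) p ∂(levyMeasure α μ)
      map_add' := fun f g => by
        rw [← mul_add, ← integral_add (hint f) (hint g)]
        congr 1
        refine integral_congr_ae ?_
        filter_upwards [levyMeasure_absolutelyContinuous.ae_le
          (twistDiff_add 0 (smoothing d h0 f) (smoothing d h0 g))] with p hp
        rw [map_add, hp, mul_add]
      map_smul' := fun c f => by
        rw [RingHom.id_apply, smul_eq_mul, mul_left_comm c]
        congr 1
        rw [← integral_const_mul]
        refine integral_congr_ae ?_
        filter_upwards [levyMeasure_absolutelyContinuous.ae_le
          (twistDiff_smul 0 c (smoothing d h0 f))] with p hp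
        rw [map_smul, hp, mul_left_comm] }
    (weightBound d α μp 1 1 1 * ‖ζ‖) (fun g => by
      change ‖(1 / 2 : ℂ) * ∫ p, _ ∂(levyMeasure α μ)‖ ≤ _
      rw [hconj, norm_mul, RCLike.norm_conj]
      have h3 := (hμ.inner_weight_mul hμm h0 h1 h2 ζ g).2
      have h4 : ‖(1 / 2 : ℂ)‖ = 1 / 2 := by simp
      rw [h4]
      linarith [norm_nonneg (∫ p, ((inner ℝ ζ (p.1 - p.2) : ℝ) : ℂ) *
        conj (twistDiff 0 (smoothing d h0 g) p) ∂(levyMeasure α μ))])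
  refine ⟨(InnerProductSpace.toDual ℂ (L2Cell d)).symm L, fun g => ?_⟩
  rw [← inner_conj_symm, InnerProductSpace.toDual_symm_apply]
  change conj ((1 / 2 : ℂ) * ∫ p, _ ∂(levyMeasure α μ)) = _
  rw [hconj, map_mul, Complex.conj_conj, map_div₀, map_one, Complex.conj_ofNat]

/-- The vector that represents `g ↦ ½ ∫ ⟨ζ, x-y⟩ conj((Sg)(x) - (Sg)(y))` with respect to the
weighted measure. -/
def IsAdmissible.gradVec (hμ : IsAdmissible μm μp μ) (hμm : 0 < μm)
    (h0 : 0 < α) (h1 : 1 < α) (h2 : α < 2) (ζ : Space d) : L2Cell d :=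
  (hμ.exists_gradVec hμm h0 h1 h2 ζ).choose

variable (hμ : IsAdmissible μm μp μ) (hμm : 0 < μm) (h0 : 0 < α) (h1 : 1 < α) (h2 : α < 2)
  (ξ : Space d)

theorem IsAdmissible.inner_gradVec (g : L2Cell d) :
    inner ℂ g (hμ.gradVec hμm h0 h1 h2 ξ) = (1 / 2 : ℂ) *
      ∫ p, ((inner ℝ ξ (p.1 - p.2) : ℝ) : ℂ) * conj (twistDiff 0 (smoothing d h0 g) p)
        ∂(levyMeasure α μ) :=
  (hμ.exists_gradVec hμm h0 h1 h2 ξ).choose_spec g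

theorem weightBound_nonneg (hp : 0 ≤ μp) {a c R : ℝ} (hc : 0 ≤ c) (hR : 0 ≤ R) :
    0 ≤ weightBound d α μp a c R := by
  have : 0 ≤ twistBound d α μp 0 := Real.sqrt_nonneg _
  have hJ := levyMass_nonneg (d := d) (α := α)
  unfold weightBound; positivity

theorem IsAdmissible.norm_gradVec_le :
    ‖hμ.gradVec hμm h0 h1 h2 ξ‖ ≤ weightBound d α μp 1 1 1 * ‖ξ‖ := by
  refine norm_le_of_forall_inner_le (mul_nonneg (weightBound_nonneg (hμm.le.trans hμ.le)
    zero_le_one zero_le_one) (norm_nonneg ξ)) fun g => ?_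
  rw [hμ.inner_gradVec, norm_mul]
  have h3 := (hμ.inner_weight_mul hμm h0 h1 h2 ξ g).2
  have h4 : ‖(1 / 2 : ℂ)‖ = 1 / 2 := by simp
  rw [h4]
  linarith [norm_nonneg (∫ p, ((inner ℝ ξ (p.1 - p.2) : ℝ) : ℂ) *
    conj (twistDiff 0 (smoothing d h0 g) p) ∂(levyMeasure α μ))]

theorem IsAdmissible.gradVec_eq_sum :
    hμ.gradVec hμm h0 h1 h2 ξ =
      ∑ k, (ξ k : ℂ) • hμ.gradVec hμm h0 h1 h2 (EuclideanSpace.single k 1) := by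
  refine ext_inner_left ℂ fun g => ?_
  simp only [inner_sum, inner_smul_right, hμ.inner_gradVec]
  simp only [mul_left_comm _ (1 / 2 : ℂ)]
  rw [← Finset.mul_sum]
  congr 1
  simp only [← integral_const_mul]
  rw [← integral_finsetSum _ fun k _ => (hμ.inner_weight_mul hμm h0 h1 h2 _ g).1.const_mul _]
  refine integral_congr_ae (Filter.Eventually.of_forall fun p => ?_)
  simp only [← mul_assoc, ← Finset.sum_mul]
  congr 1
  simp only [EuclideanSpace.inner_single_left]
  rw [PiLp.inner_apply]
  push_cast
  refine Finset.sum_congr rfl fun k _ => ?_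
  simp [mul_comm]

theorem IsAdmissible.twistOp_zero_oneCell : hμ.twistOp hμm h0 h2 0 (oneCell d) = 0 := by
  refine Lp.ext ?_
  filter_upwards [hμ.coeFn_twistOp hμm h0 h2 0 (oneCell d),
    levyMeasure_absolutelyContinuous.ae_le (twistDiff_oneCell (d := d) 0),
    Lp.coeFn_zero ℂ 2 (levyMeasure α μ)] with p h3 h4 h5
  rw [h3, h5, smoothing_oneCell, h4, expChar_zero_left, sub_self, Pi.zero_apply]

theorem IsAdmissible.formOp_zero_oneCell : hμ.formOp hμm h0 h2 0 (oneCell d) = 0 := by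
  refine ext_inner_left ℂ fun g => ?_
  rw [hμ.inner_formOp, hμ.twistOp_zero_oneCell, inner_zero_right, inner_zero_right, mul_zero]

/-- This is the solvability condition for B(0)f = -m, since constants are in the kernel of B(0). -/
theorem IsAdmissible.inner_oneCell_gradVec :
    inner ℂ (oneCell d) (hμ.gradVec hμm h0 h1 h2 ξ) = 0 := by
  rw [hμ.inner_gradVec, integral_eq_zero_of_ae, mul_zero]
  filter_upwards [levyMeasure_absolutelyContinuous.ae_le (twistDiff_oneCell (d := d) 0)] with p h4
  rw [smoothing_oneCell, h4, expChar_zero_left, sub_self, map_zero, mul_zero, Pi.zero_apply]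

/-- The bound for the dependence of the twisted differences on the quasimomentum. -/
def shiftBound (d : ℕ) [NeZero d] (α μp R : ℝ) : ℝ := Real.sqrt (μp * (2 * c0 d α * R ^ α))

/-- The difference is (1 - e^{i⟨ξ,y-x⟩})u(y), whose squared norm factors as ‖u‖² times ∫ |1 -
e^{i⟨ξ,z⟩}|²|z|^{-d-α} dz = 2c₀|ξ|^α, up to μ₊. The twisted differences are thus only Hölder
continuous at ξ = 0, of order α/2. -/
theorem IsAdmissible.norm_twistOp_sub_le (f : L2Cell d) :
    ‖hμ.twistOp hμm h0 h2 ξ f - hμ.twistOp hμm h0 h2 0 f‖ ≤ shiftBound d α μp ‖ξ‖ * ‖f‖ := by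
  have hc := (c0_pos (d := d) h0 h2).le
  have hp := hμm.le.trans hμ.le
  set u := smoothing d h0 f with hu
  have hwm : Measurable fun z : Space d => ENNReal.ofReal (‖1 - expChar ξ z‖ ^ 2 /
      ‖z‖ ^ ((d : ℝ) + α)) := by
    have := measurable_expChar ξ
    fun_prop
  refine le_of_sq_le_sq ?_ (mul_nonneg (Real.sqrt_nonneg _) (norm_nonneg _))
  rw [mul_pow, shiftBound, Real.sq_sqrt (by positivity)]
  refine norm_sq_le_of_ofReal_le (by positivity) ?_
  rw [← lintegral_sq_enorm]
  calc _ = ∫⁻ p, ENNReal.ofReal (‖1 - expChar ξ (p.2 - p.1)‖ ^ 2) * ‖periodicExt u p.2‖ₑ ^ 2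
        ∂(levyMeasure α μ) := by
        refine lintegral_congr_ae ?_
        filter_upwards [hμ.coeFn_twistOp hμm h0 h2 0 f, hμ.coeFn_twistOp hμm h0 h2 ξ f,
          Lp.coeFn_sub (hμ.twistOp hμm h0 h2 ξ f) (hμ.twistOp hμm h0 h2 0 f)] with p h3 h4 h5
        rw [h5, Pi.sub_apply, h3, h4, twistDiff_sub_zero, enorm_mul, mul_pow,
          ENNReal.ofReal_pow (norm_nonneg _), ofReal_norm]
    _ ≤ ENNReal.ofReal μp * ∫⁻ p, rieszKernel α p *
          (ENNReal.ofReal (‖1 - expChar ξ (p.2 - p.1)‖ ^ 2) * ‖periodicExt u p.2‖ₑ ^ 2)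
            ∂(pairMeasure d) := by
        refine hμ.lintegral_levyMeasure_le hμm ?_
        refine AEMeasurable.mul ?_ ((aestronglyMeasurable_periodicExt_snd u).enorm.pow_const 2)
        have := (measurable_expChar ξ).comp
          (by fun_prop : Measurable fun p : Space d × Space d => p.2 - p.1)
        exact (((measurable_const.sub this).norm.pow_const 2).ennreal_ofReal).aemeasurable
    _ = ENNReal.ofReal μp * (ENNReal.ofReal (2 * (c0 d α * ‖ξ‖ ^ α)) *
          ENNReal.ofReal (‖u‖ ^ 2)) := by
        congr 1
        simp only [← mul_assoc (rieszKernel α _)]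
        simp only [rieszKernel_mul_ofReal (fun z => ‖1 - expChar ξ z‖ ^ 2)]
        rw [lintegral_pair_mul_snd hwm]
        congr 1
        simp only [normSq_one_sub_expChar, mul_div_assoc]
        rw [← ofReal_integral_eq_lintegral_ofReal ((integrable_one_sub_cos_div h0 h2 ξ).const_mul 2)
          (Filter.Eventually.of_forall fun z => mul_nonneg zero_le_two
            (div_nonneg (by linarith [Real.cos_le_one (inner ℝ ξ z)]) (by positivity))),
          integral_const_mul, integral_one_sub_cos_div h0]
    _ ≤ _ := by
        rw [← ENNReal.ofReal_mul (by positivity), ← ENNReal.ofReal_mul hp]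
        refine ENNReal.ofReal_le_ofReal ?_
        have : ‖u‖ ≤ ‖f‖ := norm_smoothing_le h0 f
        have h3 : ‖u‖ ^ 2 ≤ ‖f‖ ^ 2 := by gcongr
        have h4 : 0 ≤ μp * (2 * c0 d α * ‖ξ‖ ^ α) := by positivity
        nlinarith

theorem IsAdmissible.norm_twistOp_oneCell_le :
    ‖hμ.twistOp hμm h0 h2 ξ (oneCell d)‖ ≤ shiftBound d α μp ‖ξ‖ := by
  have := hμ.norm_twistOp_sub_le hμm h0 h2 ξ (oneCell d)
  rwa [hμ.twistOp_zero_oneCell, sub_zero, norm_oneCell, mul_one] at this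

theorem shiftBound_sq (hp : 0 ≤ μp) (h0 : 0 < α) (h2 : α < 2) {R : ℝ} (hR : 0 ≤ R) :
    shiftBound d α μp R ^ 2 = μp * (2 * c0 d α * R ^ α) := by
  have hc := (c0_pos (d := d) h0 h2).le
  exact Real.sq_sqrt (by positivity)

theorem IsAdmissible.re_inner_formOp_oneCell_le :
    (inner ℂ (oneCell d) (hμ.formOp hμm h0 h2 ξ (oneCell d))).re ≤ μp * c0 d α * ‖ξ‖ ^ α := by
  rw [hμ.re_inner_formOp_self]
  have h3 := pow_le_pow_left₀ (norm_nonneg _) (hμ.norm_twistOp_oneCell_le hμm h0 h2 ξ) 2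
  rw [shiftBound_sq (hμm.le.trans hμ.le) h0 h2 (norm_nonneg ξ)] at h3
  linarith

/-- Telescoping the difference of G*G for the two quasimomenta leaves one factor of order |ξ|^{α/2}
in each term. -/
theorem IsAdmissible.norm_formOp_sub_le (f : L2Cell d) :
    ‖hμ.formOp hμm h0 h2 ξ f - hμ.formOp hμm h0 h2 0 f‖ ≤
      (twistBound d α μp ‖ξ‖ + twistBound d α μp 0) * shiftBound d α μp ‖ξ‖ * ‖f‖ := by
  refine norm_le_of_forall_inner_le (mul_nonneg (mul_nonneg (add_nonneg (Real.sqrt_nonneg _)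
    (Real.sqrt_nonneg _)) (Real.sqrt_nonneg _)) (norm_nonneg f)) fun g => ?_
  set G := hμ.twistOp hμm h0 h2 ξ with hG
  set G' := hμ.twistOp hμm h0 h2 0 with hG'
  have heq : inner ℂ g (hμ.formOp hμm h0 h2 ξ f - hμ.formOp hμm h0 h2 0 f) =
      (1 / 2 : ℂ) * (inner ℂ (G g) (G f - G' f) + inner ℂ (G g - G' g) (G' f)) := by
    rw [inner_sub_right, hμ.inner_formOp, hμ.inner_formOp, inner_sub_right, inner_sub_left]
    ring
  have b1 : ‖inner ℂ (G g) (G f - G' f)‖ ≤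
      (twistBound d α μp ‖ξ‖ * ‖g‖) * (shiftBound d α μp ‖ξ‖ * ‖f‖) :=
    (norm_inner_le_norm _ _).trans (mul_le_mul (G.le_of_opNorm_le
      (hμ.norm_twistOp_le hμm h0 h2 ξ) g) (hμ.norm_twistOp_sub_le hμm h0 h2 ξ f) (norm_nonneg _)
      (mul_nonneg (Real.sqrt_nonneg _) (norm_nonneg _)))
  have b2 : ‖inner ℂ (G g - G' g) (G' f)‖ ≤
      (shiftBound d α μp ‖ξ‖ * ‖g‖) * (twistBound d α μp 0 * ‖f‖) :=
    (norm_inner_le_norm _ _).trans (mul_le_mul (hμ.norm_twistOp_sub_le hμm h0 h2 ξ g)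
      (G'.le_of_opNorm_le (by simpa using hμ.norm_twistOp_le hμm h0 h2 0) f) (norm_nonneg _)
      (mul_nonneg (Real.sqrt_nonneg _) (norm_nonneg _)))
  have h4 : ‖(1 / 2 : ℂ)‖ = 1 / 2 := by simp
  rw [heq, norm_mul, h4]
  have b3 := norm_add_le (inner ℂ (G g) (G f - G' f)) (inner ℂ (G g - G' g) (G' f))
  have b4 := norm_nonneg (inner ℂ (G g) (G f - G' f) + inner ℂ (G g - G' g) (G' f))
  nlinarith

/-- First-order expansion of `B(ξ)1`. -/
theorem IsAdmissible.norm_formOp_oneCell_sub_le :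
    ‖hμ.formOp hμm h0 h2 ξ (oneCell d) - Complex.I • hμ.gradVec hμm h0 h1 h2 ξ‖ ≤
      weightBound d α μp (2 * ‖ξ‖ ^ 2) 2 ‖ξ‖ + shiftBound d α μp ‖ξ‖ ^ 2 := by
  refine norm_le_of_forall_inner_le (add_nonneg (weightBound_nonneg (hμm.le.trans hμ.le)
    zero_le_two (norm_nonneg ξ)) (sq_nonneg _)) fun g => ?_
  set e := oneCell d with he
  set G := hμ.twistOp hμm h0 h2 ξ with hG
  set G' := hμ.twistOp hμm h0 h2 0 with hG'
  -- The remainder after the linear term of e^{i⟨ξ,z⟩}. It is dominated by twice min(t², t) with t =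
  -- |ξ||z|, hence of quadratic size near the diagonal and linear size far away.
  set h : Space d → ℂ := fun z => 1 - expChar ξ z + Complex.I * ((inner ℝ ξ z : ℝ) : ℂ) with hh
  have hhm : Measurable h := by
    have := measurable_expChar ξ
    fun_prop
  have hle : ∀ z, ‖h z‖ ≤ 2 * min ((‖ξ‖ * ‖z‖) ^ 2) ((‖ξ‖ * ‖z‖) ^ 1) := fun z => by
    refine (norm_one_sub_exp_add_le (inner ℝ ξ z)).trans ?_
    have := min_pow_mono (p := 2) (q := 1) (abs_nonneg _) (abs_real_inner_le_norm ξ z)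
    linarith
  have hW := hμ.weight_mul hμm h0 h1 h2 hhm (a := 2 * ‖ξ‖ ^ 2) zero_le_two
    (norm_nonneg ξ) (fun z hz => (hle z).trans (by
      have h3 : (‖ξ‖ * ‖z‖) ^ 2 ≤ ‖ξ‖ ^ 2 * ‖z‖ := by
        rw [mul_pow]
        have : ‖z‖ ^ 2 ≤ ‖z‖ := by nlinarith [norm_nonneg z]
        gcongr
      have := min_le_left ((‖ξ‖ * ‖z‖) ^ 2) ((‖ξ‖ * ‖z‖) ^ 1)
      linarith)) (fun z _ => hle z) g
  have hI := hμ.inner_weight_mul hμm h0 h1 h2 ξ g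
  have hGe : inner ℂ (G' g) (G e) = (∫ p, h (p.2 - p.1) * conj (twistDiff 0 (smoothing d h0 g) p)
      ∂(levyMeasure α μ)) + Complex.I * ∫ p, ((inner ℝ ξ (p.1 - p.2) : ℝ) : ℂ) *
        conj (twistDiff 0 (smoothing d h0 g) p) ∂(levyMeasure α μ) := by
    rw [← integral_const_mul, ← integral_add hW.1 (hI.1.const_mul _), L2.inner_def]
    refine integral_congr_ae ?_
    filter_upwards [hμ.coeFn_twistOp hμm h0 h2 0 g, hμ.coeFn_twistOp hμm h0 h2 ξ e,
      levyMeasure_absolutelyContinuous.ae_le (twistDiff_oneCell (d := d) ξ)] with p h3 h4 h5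
    rw [h3, h4, smoothing_oneCell, h5, RCLike.inner_apply, hh, ← neg_sub p.2 p.1, inner_neg_right]
    push_cast; ring
  -- Replacing the twisted difference of the test function by the untwisted one costs a product of
  -- two quantities of order |ξ|^{α/2}; the rest is the pairing with the remainder h.
  have heq : inner ℂ g (hμ.formOp hμm h0 h2 ξ e - Complex.I • hμ.gradVec hμm h0 h1 h2 ξ) =
      (1 / 2 : ℂ) * (inner ℂ (G g - G' g) (G e) +
        ∫ p, h (p.2 - p.1) * conj (twistDiff 0 (smoothing d h0 g) p) ∂(levyMeasure α μ)) := by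
    rw [inner_sub_right, inner_smul_right, hμ.inner_formOp, hμ.inner_gradVec, inner_sub_left, hGe]
    ring
  have b1 : ‖inner ℂ (G g - G' g) (G e)‖ ≤ (shiftBound d α μp ‖ξ‖ * ‖g‖) * shiftBound d α μp ‖ξ‖ :=
    (norm_inner_le_norm _ _).trans (mul_le_mul (hμ.norm_twistOp_sub_le hμm h0 h2 ξ g)
      (hμ.norm_twistOp_oneCell_le hμm h0 h2 ξ) (norm_nonneg _)
      (mul_nonneg (Real.sqrt_nonneg _) (norm_nonneg _)))
  have h4 : ‖(1 / 2 : ℂ)‖ = 1 / 2 := by simp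
  rw [heq, norm_mul, h4]
  have b3 := norm_add_le (inner ℂ (G g - G' g) (G e)) (∫ p, h (p.2 - p.1) *
    conj (twistDiff 0 (smoothing d h0 g) p) ∂(levyMeasure α μ))
  have b4 := norm_nonneg (inner ℂ (G g - G' g) (G e) + ∫ p, h (p.2 - p.1) *
    conj (twistDiff 0 (smoothing d h0 g) p) ∂(levyMeasure α μ))
  nlinarith [hW.2]

end

end

section

/-! ### The cell problems -/

section

variable {d : ℕ} {α μm μp : ℝ} {μ : Space d → Space d → ℝ}

theorem integral_eq_inner_oneCell (v : L2Cell d) :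
    ∫ x, v x ∂(cellMeasure d) = inner ℂ (oneCell d) v := by
  rw [L2.inner_def]
  refine integral_congr_ae ?_
  filter_upwards [MemLp.coeFn_toLp (memLp_const (1 : ℂ) :
    MemLp (fun _ : Space d => (1 : ℂ)) 2 (cellMeasure d))] with x h
  have h' : oneCell d x = 1 := h
  rw [RCLike.inner_apply, h', map_one, mul_one]

theorem inner_single_sub (k : Fin d) (p : Space d × Space d) :
    inner ℝ (EuclideanSpace.single k (1 : ℝ)) (p.1 - p.2) = p.1 k - p.2 k := by
  simp [EuclideanSpace.inner_single_left]

theorem sum_re_inner_eq {H : Type*} [NormedAddCommGroup H] [InnerProductSpace ℂ H] (B : H →L[ℂ] H)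
    (f : Fin d → H) (ξ : Space d) :
    ∑ j, ∑ k, (inner ℂ (f j) (B (f k))).re * ξ k * ξ j =
      (inner ℂ (∑ k, (ξ k : ℂ) • f k) (B (∑ k, (ξ k : ℂ) • f k))).re := by
  rw [sum_inner, Complex.re_sum]
  refine Finset.sum_congr rfl fun j _ => ?_
  rw [map_sum, inner_sum, Complex.re_sum]
  refine Finset.sum_congr rfl fun k _ => ?_
  rw [map_smul, inner_smul_left, inner_smul_right, Complex.conj_ofReal, Complex.re_ofReal_mul,
    Complex.re_ofReal_mul]
  ring

variable [NeZero d] (hμ : IsAdmissible μm μp μ) (hμm : 0 < μm) (h0 : 0 < α) (h1 : 1 < α)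
  (h2 : α < 2)

theorem IsAdmissible.cellIntegrand_smoothing (k : Fin d) (f g : L2Cell d) :
    Integrable (cellIntegrand α μ k (smoothing d h0 f) (smoothing d h0 g)) (pairMeasure d) ∧
    ∫ p, cellIntegrand α μ k (smoothing d h0 f) (smoothing d h0 g) p ∂(pairMeasure d) =
      2 * inner ℂ g (hμ.formOp hμm h0 h2 0 f +
        hμ.gradVec hμm h0 h1 h2 (EuclideanSpace.single k 1)) := by
  have i1 := hμ.integrable_twistDiff_mul hμm h0 h2 0 0 f g
  have i2 := (hμ.inner_weight_mul hμm h0 h1 h2 (EuclideanSpace.single k 1) g).1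
  have heq : cellIntegrand α μ k (smoothing d h0 f) (smoothing d h0 g) = fun p =>
      (kernel α μ p : ℂ) * (twistDiff 0 (smoothing d h0 f) p *
        conj (twistDiff 0 (smoothing d h0 g) p) +
        ((inner ℝ (EuclideanSpace.single k (1 : ℝ)) (p.1 - p.2) : ℝ) : ℂ) *
          conj (twistDiff 0 (smoothing d h0 g) p)) := by
    funext p
    rw [cellIntegrand, inner_single_sub, twistDiff_zero, twistDiff_zero]
    ring
  rw [heq]
  refine ⟨(hμ.integrable_levyMeasure_iff hμm).1 (i1.add i2), ?_⟩
  rw [← hμ.integral_levyMeasure hμm, integral_add i1 i2, inner_add_right, hμ.inner_formOp,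
    hμ.inner_twistOp, hμ.inner_gradVec]
  ring

/-- Substituting v = Sf and η = Sg turns the variational identity into the operator equation B(0)f =
-m. The zero mean passes from v to f because S fixes constants. -/
theorem IsAdmissible.isCellSolution_iff (k : Fin d) (v : L2Cell d) :
    IsCellSolution α μ k v ↔ ∃ f, smoothing d h0 f = v ∧ inner ℂ (oneCell d) f = 0 ∧
      hμ.formOp hμm h0 h2 0 f = -hμ.gradVec hμm h0 h1 h2 (EuclideanSpace.single k 1) := by
  constructor
  · rintro ⟨hv, hmean, h⟩
    obtain ⟨f, rfl⟩ := (mem_periodicSobolev_iff_range h0 h2 v).1 hv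
    refine ⟨f, rfl, ?_, ?_⟩
    · rwa [integral_eq_inner_oneCell, inner_oneCell_smoothing] at hmean
    · rw [← add_eq_zero_iff_eq_neg]
      refine ext_inner_left ℂ fun g => ?_
      have h3 := (h (smoothing d h0 g) ((mem_periodicSobolev_iff_range h0 h2 _).2 ⟨g, rfl⟩)).2
      rw [(hμ.cellIntegrand_smoothing hμm h0 h1 h2 k f g).2] at h3
      rw [inner_zero_right]
      simpa using h3
  · rintro ⟨f, rfl, hmean, h⟩
    refine ⟨(mem_periodicSobolev_iff_range h0 h2 _).2 ⟨f, rfl⟩, ?_, fun η hη => ?_⟩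
    · rwa [integral_eq_inner_oneCell, inner_oneCell_smoothing]
    · obtain ⟨g, rfl⟩ := (mem_periodicSobolev_iff_range h0 h2 η).1 hη
      have h3 := hμ.cellIntegrand_smoothing hμm h0 h1 h2 k f g
      refine ⟨h3.1, ?_⟩
      rw [h3.2, h, neg_add_cancel, inner_zero_right, mul_zero]

/-- B(0) is coercive off the constants, and adding P supplies the missing direction. On vectors of
mean zero the sum agrees with B(0). -/
theorem IsAdmissible.exists_inverse_formOp_add_meanProj :
    ∃ N : L2Cell d →L[ℂ] L2Cell d,
      (∀ f, (hμ.formOp hμm h0 h2 0 + meanProj d) (N f) = f) ∧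
      ∀ f, N ((hμ.formOp hμm h0 h2 0 + meanProj d) f) = f := by
  have hgap := spectralGap_pos (d := d) hμm h0 h2
  refine exists_inverse_of_coercive _ (lt_min one_pos hgap) fun f => ?_
  have h3 := hμ.le_re_inner_formOp hμm h0 h2 0 (by simpa using Real.pi_pos.le) f
  have h4 : (inner ℂ f (meanProj d f)).re = ‖inner ℂ (oneCell d) f‖ ^ 2 := by
    rw [meanProj, InnerProductSpace.rankOne_apply, inner_smul_right, ← inner_conj_symm f,
      Complex.mul_conj']
    norm_cast
  have h5 : ‖inner ℂ (oneCell d) f‖ ≤ ‖f‖ := by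
    refine (norm_inner_le_norm _ _).trans ?_
    rw [norm_oneCell, one_mul]
  have h6 : ‖inner ℂ (oneCell d) f‖ ^ 2 ≤ ‖f‖ ^ 2 := by gcongr
  have h7 := min_le_left 1 (spectralGap d α μm)
  have h8 := min_le_right 1 (spectralGap d α μm)
  rw [add_apply, inner_add_right, Complex.add_re, h4]
  nlinarith [sq_nonneg ‖inner ℂ (oneCell d) f‖]

theorem IsAdmissible.existsUnique_isCellSolution (hμ : IsAdmissible μm μp μ) (hμm : 0 < μm)
    (h1 : 1 < α) (h2 : α < 2) (k : Fin d) :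
    ∃! v : L2Cell d, IsCellSolution α μ k v := by
  have h0 : 0 < α := one_pos.trans h1
  obtain ⟨N, hN1, hN2⟩ := hμ.exists_inverse_formOp_add_meanProj hμm h0 h2
  set m := hμ.gradVec hμm h0 h1 h2 (EuclideanSpace.single k 1) with hm
  have hP : ∀ f, meanProj d f = inner ℂ (oneCell d) f • oneCell d := fun f => by
    rw [meanProj, InnerProductSpace.rankOne_apply]
  -- Pairing the equation with 1 kills B(0), and m is orthogonal to 1, so the solution has mean zero
  -- and the P term drops out.
  have hmean : inner ℂ (oneCell d) (N (-m)) = 0 := by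
    have h3 := congrArg (inner ℂ (oneCell d)) (hN1 (-m))
    rw [add_apply, inner_add_right, ← hμ.inner_formOp_left, hμ.formOp_zero_oneCell,
      inner_zero_left, zero_add, hP, inner_smul_right, inner_self_eq_norm_sq_to_K, norm_oneCell,
      inner_neg_right, hm, hμ.inner_oneCell_gradVec] at h3
    simpa using h3
  refine ⟨smoothing d h0 (N (-m)), ?_, fun v hv => ?_⟩
  · refine (hμ.isCellSolution_iff hμm h0 h1 h2 k _).2 ⟨_, rfl, hmean, ?_⟩
    have h3 := hN1 (-m)
    rwa [add_apply, hP, hmean, zero_smul, add_zero] at h3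
  · obtain ⟨f, rfl, hf, hBf⟩ := (hμ.isCellSolution_iff hμm h0 h1 h2 k v).1 hv
    have h3 := hN2 f
    rw [add_apply, hP, hf, zero_smul, add_zero, hBf] at h3
    rw [h3]

theorem IsAdmissible.integral_inner_mul_twistDiff (ζ : Space d) (f : L2Cell d) :
    Integrable (fun p => ((inner ℝ ζ (p.1 - p.2) : ℝ) : ℂ) *
      twistDiff 0 (smoothing d h0 f) p) (levyMeasure α μ) ∧
    ∫ p, ((inner ℝ ζ (p.1 - p.2) : ℝ) : ℂ) * twistDiff 0 (smoothing d h0 f) p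
      ∂(levyMeasure α μ) = 2 * inner ℂ (hμ.gradVec hμm h0 h1 h2 ζ) f := by
  constructor
  · have := Complex.conjCLE.toContinuousLinearMap.integrable_comp
      (hμ.inner_weight_mul hμm h0 h1 h2 ζ f).1
    simpa using this
  · rw [← inner_conj_symm, hμ.inner_gradVec, map_mul, map_div₀, map_one, Complex.conj_ofNat,
      ← integral_conj, ← mul_assoc, mul_one_div_cancel two_ne_zero, one_mul]
    refine integral_congr_ae (Filter.Eventually.of_forall fun p => ?_)
    simp

/-- The two halves of the integral are 2(f_k, m_j) and 2(f_j, m_k) with m = -B(0)f. By symmetry of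
B(0) they are complex conjugates, so their sum is real and the factor ¼ leaves -Re (B(0)f_k, f_j).
-/
theorem IsAdmissible.correctorIntegrand_smoothing {f : Fin d → L2Cell d}
    (hf : ∀ k, hμ.formOp hμm h0 h2 0 (f k) =
      -hμ.gradVec hμm h0 h1 h2 (EuclideanSpace.single k 1)) (j k : Fin d) :
    Integrable (correctorIntegrand α μ (fun k => smoothing d h0 (f k)) j k) (pairMeasure d) ∧
    (1 / 4 : ℂ) * ∫ p, correctorIntegrand α μ (fun k => smoothing d h0 (f k)) j k p
      ∂(pairMeasure d) = ((-(inner ℂ (f j) (hμ.formOp hμm h0 h2 0 (f k))).re : ℝ) : ℂ) := by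
  obtain ⟨i1, e1⟩ := hμ.integral_inner_mul_twistDiff hμm h0 h1 h2 (EuclideanSpace.single j 1) (f k)
  obtain ⟨i2, e2⟩ := hμ.integral_inner_mul_twistDiff hμm h0 h1 h2 (EuclideanSpace.single k 1) (f j)
  have heq : correctorIntegrand α μ (fun k => smoothing d h0 (f k)) j k = fun p =>
      (kernel α μ p : ℂ) *
        (((inner ℝ (EuclideanSpace.single j (1 : ℝ)) (p.1 - p.2) : ℝ) : ℂ) *
          twistDiff 0 (smoothing d h0 (f k)) p +
        ((inner ℝ (EuclideanSpace.single k (1 : ℝ)) (p.1 - p.2) : ℝ) : ℂ) *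
          twistDiff 0 (smoothing d h0 (f j)) p) := by
    funext p
    rw [correctorIntegrand, inner_single_sub, inner_single_sub, twistDiff_zero, twistDiff_zero]
  rw [heq]
  refine ⟨(hμ.integrable_levyMeasure_iff hμm).1 (i1.add i2), ?_⟩
  rw [← hμ.integral_levyMeasure hμm, integral_add i1 i2, e1, e2,
    ← neg_eq_iff_eq_neg.2 (hf j), ← neg_eq_iff_eq_neg.2 (hf k), inner_neg_left, inner_neg_left,
    hμ.inner_formOp_left, ← inner_conj_symm (hμ.formOp hμm h0 h2 0 (f k)) (f j)]
  push_cast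
  rw [Complex.re_eq_add_conj]
  ring

theorem IsAdmissible.formOp_sum_smul {f : Fin d → L2Cell d}
    (hf : ∀ k, hμ.formOp hμm h0 h2 0 (f k) =
      -hμ.gradVec hμm h0 h1 h2 (EuclideanSpace.single k 1)) (ξ : Space d) :
    hμ.formOp hμm h0 h2 0 (∑ k, (ξ k : ℂ) • f k) = -hμ.gradVec hμm h0 h1 h2 ξ := by
  rw [map_sum, hμ.gradVec_eq_sum, ← Finset.sum_neg_distrib]
  refine Finset.sum_congr rfl fun k _ => ?_
  rw [map_smul, hf, smul_neg]

theorem IsAdmissible.norm_le_of_formOp_eq {f m : L2Cell d} (hf : inner ℂ (oneCell d) f = 0)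
    (h : hμ.formOp hμm h0 h2 0 f = -m) : ‖f‖ ≤ (spectralGap d α μm)⁻¹ * ‖m‖ := by
  have hgap := spectralGap_pos (d := d) hμm h0 h2
  have h3 := hμ.le_re_inner_formOp hμm h0 h2 0 (by simpa using Real.pi_pos.le) f
  rw [hf, norm_zero, h, inner_neg_right] at h3
  have h4 : -(inner ℂ f m).re ≤ ‖f‖ * ‖m‖ :=
    ((neg_le_abs _).trans (Complex.abs_re_le_norm _)).trans (norm_inner_le_norm _ _)
  rw [Complex.neg_re] at h3
  rw [inv_mul_eq_div, le_div_iff₀ hgap]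
  rcases (norm_nonneg f).eq_or_lt with h5 | h5
  · rw [← h5, zero_mul]; positivity
  · nlinarith

end

end

section

/-! ### Perturbation of a simple eigenvalue -/

section

variable {H : Type*} [NormedAddCommGroup H] [InnerProductSpace ℂ H]

/-- An eigenvector is close to the unperturbed one. -/
theorem norm_sub_smul_le {S B : H →L[ℂ] H} {e ψ : H} {lam γ : ℝ} (hγ : 0 < γ)
    (hS : ∀ x y, inner ℂ (S x) y = inner ℂ x (S y))
    (hS1 : ∀ x, ‖S x‖ ≤ ‖x‖) (he : ‖e‖ = 1) (hSe : S e = e)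
    (hψ : ‖S ψ‖ = 1) (heig : B ψ = (lam : ℂ) • S (S ψ)) (hlam : lam ≤ γ / 3)
    (hgap : ∀ x, γ * (‖x‖ ^ 2 - ‖inner ℂ e x‖ ^ 2) ≤ (inner ℂ x (B x)).re) :
    ‖ψ - inner ℂ e ψ • e‖ ≤ 3 / (2 * γ) * ‖B e‖ := by
  set c := inner ℂ e ψ with hc
  set ω := ψ - c • e with hω
  have hee : inner ℂ e e = 1 := by rw [inner_self_eq_norm_sq_to_K, he]; simp
  have heω : inner ℂ e ω = 0 := by
    rw [hω, inner_sub_right, inner_smul_right, hee, mul_one, ← hc, sub_self]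
  have hc1 : ‖c‖ ≤ 1 := by
    have : c = inner ℂ e (S ψ) := by rw [← hS, hSe]
    rw [this]
    refine (norm_inner_le_norm _ _).trans ?_
    rw [he, hψ, one_mul]
  have hψeq : ψ = c • e + ω := by rw [hω]; abel
  -- The gap inequality is tested on ω itself: ω is orthogonal to e, and Bω = λS²ψ - cBe.
  have hBω : inner ℂ ω (B ω) = (lam : ℂ) * inner ℂ (S ω) (S ω) - c * inner ℂ ω (B e) := by
    have h1 : B ω = (lam : ℂ) • S (S ψ) - c • B e := by rw [hω, map_sub, map_smul, heig]
    have h2 : inner ℂ ω (S (S ψ)) = inner ℂ (S ω) (S ω) := by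
      rw [hψeq, map_add, map_smul, hSe, map_add, map_smul, hSe, inner_add_right, inner_smul_right,
        ← inner_conj_symm ω e, heω, map_zero, mul_zero, zero_add, ← hS]
    rw [h1, inner_sub_right, inner_smul_right, inner_smul_right, h2]
  have h3 := hgap ω
  rw [heω, norm_zero, hBω, inner_self_eq_norm_sq_to_K, Complex.sub_re, Complex.re_ofReal_mul] at h3
  have h4 : ‖c * inner ℂ ω (B e)‖ ≤ ‖ω‖ * ‖B e‖ := by
    rw [norm_mul]
    have := norm_inner_le_norm (𝕜 := ℂ) ω (B e)
    have h5 := norm_nonneg (inner ℂ ω (B e))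
    nlinarith
  have h5 := (abs_le.1 (Complex.abs_re_le_norm (c * inner ℂ ω (B e)))).1
  have h6 : ((((‖S ω‖ : ℝ) : ℂ) ^ 2).re : ℝ) = ‖S ω‖ ^ 2 := by norm_cast
  have h7 : ‖S ω‖ ^ 2 ≤ ‖ω‖ ^ 2 := pow_le_pow_left₀ (norm_nonneg _) (hS1 ω) 2
  have h8 : (((‖S ω‖ : ℝ) : ℂ) ^ 2).re = ‖S ω‖ ^ 2 := h6
  -- Since λ ≤ γ/3, two thirds of γ survive on the left; hence the constant 3/(2γ).
  have h9 : γ * ‖ω‖ ^ 2 ≤ γ / 3 * ‖ω‖ ^ 2 + ‖ω‖ * ‖B e‖ := by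
    have h10 : lam * ‖S ω‖ ^ 2 ≤ γ / 3 * ‖ω‖ ^ 2 :=
      mul_le_mul hlam h7 (sq_nonneg _) (by positivity)
    have h11 : γ * (‖ω‖ ^ 2 - 0 ^ 2) ≤ lam * ‖S ω‖ ^ 2 - (c * inner ℂ ω (B e)).re := by
      rw [← h8]; exact h3
    linarith
  rw [div_mul_eq_mul_div, le_div_iff₀ (by positivity)]
  rcases (norm_nonneg ω).eq_or_lt with h10 | h10
  · rw [← h10, zero_mul]; positivity
  · have : ‖ω‖ * (2 * γ * ‖ω‖) ≤ ‖ω‖ * (3 * ‖B e‖) := by nlinarith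
    have := le_of_mul_le_mul_left this h10
    linarith

/-- The rank-one projections onto nearby unit vectors are close. -/
theorem norm_rankOne_sub_le {e φ χ : H} {c : ℂ} (he : ‖e‖ = 1) (hφ : ‖φ‖ = 1)
    (hdec : φ = c • e + χ) (horth : inner ℂ e χ = 0) :
    ‖InnerProductSpace.rankOne ℂ φ φ - InnerProductSpace.rankOne ℂ e e‖ ≤ 4 * ‖χ‖ := by
  have hpyth : ‖c‖ ^ 2 + ‖χ‖ ^ 2 = 1 := by
    have h1 := norm_add_sq_eq_norm_sq_add_norm_sq_of_inner_eq_zero (𝕜 := ℂ) (c • e) χ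
      (by rw [inner_smul_left, horth, mul_zero])
    rw [← hdec, hφ, norm_smul, he] at h1
    nlinarith
  have hχ1 : ‖χ‖ ≤ 1 := by nlinarith [norm_nonneg χ, sq_nonneg ‖c‖]
  have hc1 : ‖c‖ ≤ 1 := by nlinarith [norm_nonneg c, sq_nonneg ‖χ‖]
  refine ContinuousLinearMap.opNorm_le_bound _ (by positivity) fun u => ?_
  have heu : ‖inner ℂ e u‖ ≤ ‖u‖ := by
    refine (norm_inner_le_norm _ _).trans ?_
    rw [he, one_mul]
  have hχu : ‖inner ℂ χ u‖ ≤ ‖χ‖ * ‖u‖ := norm_inner_le_norm _ _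
  have hcc : conj c * c = ((‖c‖ ^ 2 : ℝ) : ℂ) := by rw [Complex.conj_mul']; norm_cast
  -- Because 1 - |c|² = ‖χ‖², the difference consists of four terms, each at most ‖χ‖‖u‖.
  have heq : (InnerProductSpace.rankOne ℂ φ φ - InnerProductSpace.rankOne ℂ e e) u =
      (-((‖χ‖ ^ 2 : ℝ) : ℂ) * inner ℂ e u) • e + (conj c * inner ℂ e u) • χ +
        (c * inner ℂ χ u) • e + inner ℂ χ u • χ := by
    have h1 : ((‖c‖ ^ 2 : ℝ) : ℂ) - 1 = -((‖χ‖ ^ 2 : ℝ) : ℂ) := by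
      have : ‖c‖ ^ 2 = 1 - ‖χ‖ ^ 2 := by linarith
      rw [this]; push_cast; ring
    rw [← h1, ← hcc, sub_apply, InnerProductSpace.rankOne_apply,
      InnerProductSpace.rankOne_apply, hdec, inner_add_left, inner_smul_left]
    module
  rw [heq]
  have n1 : ‖(-((‖χ‖ ^ 2 : ℝ) : ℂ) * inner ℂ e u) • e‖ ≤ ‖χ‖ * ‖u‖ := by
    rw [norm_smul, he, mul_one, norm_mul, norm_neg, Complex.norm_real, Real.norm_eq_abs, abs_sq]
    have : ‖χ‖ ^ 2 ≤ ‖χ‖ := by nlinarith [norm_nonneg χ]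
    exact mul_le_mul this heu (norm_nonneg _) (norm_nonneg _)
  have n2 : ‖(conj c * inner ℂ e u) • χ‖ ≤ ‖χ‖ * ‖u‖ := by
    rw [norm_smul, norm_mul, RCLike.norm_conj, mul_comm]
    refine mul_le_mul_of_nonneg_left ?_ (norm_nonneg _)
    nlinarith [norm_nonneg c, norm_nonneg (inner ℂ e u)]
  have n3 : ‖(c * inner ℂ χ u) • e‖ ≤ ‖χ‖ * ‖u‖ := by
    rw [norm_smul, norm_mul, he, mul_one]
    nlinarith [norm_nonneg c, norm_nonneg (inner ℂ χ u)]
  have n4 : ‖inner ℂ χ u • χ‖ ≤ ‖χ‖ * ‖u‖ := by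
    rw [norm_smul]
    nlinarith [norm_nonneg χ, norm_nonneg (inner ℂ χ u)]
  have t1 := norm_add_le ((-((‖χ‖ ^ 2 : ℝ) : ℂ) * inner ℂ e u) • e + (conj c * inner ℂ e u) • χ +
        (c * inner ℂ χ u) • e) (inner ℂ χ u • χ)
  have t2 := norm_add_le ((-((‖χ‖ ^ 2 : ℝ) : ℂ) * inner ℂ e u) • e + (conj c * inner ℂ e u) • χ)
        ((c * inner ℂ χ u) • e)
  have t3 := norm_add_le ((-((‖χ‖ ^ 2 : ℝ) : ℂ) * inner ℂ e u) • e) ((conj c * inner ℂ e u) • χ)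
  linarith

/-- The main estimate controls only c·X, and no lower bound for c is available. Writing X = c²X +
σ²X, the second term is harmless: σ² = O(R²), so the crude bound X = O(s) is enough. -/
theorem le_of_decomposition {c σ X A D R K s : ℝ} (hc : 0 ≤ c) (hσ : 0 ≤ σ) (hX : 0 ≤ X)
    (h : c ^ 2 + σ ^ 2 = 1) (hσD : σ ≤ D * R) (hcX : c * X ≤ A * (R * s))
    (hXK : X ≤ 2 * K * s + K ^ 2 * (R * R)) (hRR : R * R ≤ K * s) (hRK : R ≤ K) (hK : 0 ≤ K)
    (hR : 0 ≤ R) :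
    X ≤ (A + D ^ 2 * K * (2 * K + K ^ 3)) * (R * s) := by
  have hc1 : c ≤ 1 := by nlinarith [sq_nonneg σ]
  have h1 : c ^ 2 * X ≤ A * (R * s) := by
    have : c * (c * X) ≤ 1 * (c * X) := mul_le_mul_of_nonneg_right hc1 (mul_nonneg hc hX)
    linarith
  have h2 : σ ^ 2 ≤ D ^ 2 * (R * K) := by
    have h3 : σ ^ 2 ≤ (D * R) ^ 2 := pow_le_pow_left₀ hσ hσD 2
    have h4 : D ^ 2 * (R * R) ≤ D ^ 2 * (R * K) := by gcongr
    linarith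
  have h3 : X ≤ (2 * K + K ^ 3) * s := by
    have : K ^ 2 * (R * R) ≤ K ^ 2 * (K * s) := by gcongr
    linarith
  have h4 : σ ^ 2 * X ≤ D ^ 2 * (R * K) * ((2 * K + K ^ 3) * s) :=
    mul_le_mul h2 h3 hX (by positivity)
  have h5 : X = c ^ 2 * X + σ ^ 2 * X := by rw [← add_mul, h, one_mul]
  linarith

set_option maxHeartbeats 800000 in
/-- Second-order expansion of a simple eigenvalue of the pencil `B - λ S²`, in terms of the
scales `R`, `s` and `r`. -/
theorem abs_eigenvalue_sub_le {S B B₀ : H →L[ℂ] H} {e ψ f m : H} {lam K R r s D : ℝ}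
    (hB : ∀ x y, inner ℂ (B x) y = inner ℂ x (B y)) (hS : ∀ x y, inner ℂ (S x) y = inner ℂ x (S y))
    (hB₀ : ∀ x y, inner ℂ (B₀ x) y = inner ℂ x (B₀ y))
    (hS1 : ∀ x, ‖S x‖ ≤ ‖x‖) (he : ‖e‖ = 1) (hSe : S e = e)
    (hψ : ‖S ψ‖ = 1) (heig : B ψ = (lam : ℂ) • S (S ψ)) (hlam0 : 0 ≤ lam)
    (hef : inner ℂ e f = 0) (hf : B₀ f = -m)
    (hR : 0 ≤ R) (hs : 0 ≤ s) (hr : 0 ≤ r) (hK : 0 ≤ K)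
    (hlam : lam ≤ K * s) (hm : ‖m‖ ≤ K * R) (hfK : ‖f‖ ≤ K * R)
    (hBe : ‖B e - Complex.I • m‖ ≤ K * s) (hBB : ‖B f - B₀ f‖ ≤ K * r * ‖f‖)
    (hBee : (inner ℂ e (B e)).re ≤ K * s) (hBee0 : 0 ≤ (inner ℂ e (B e)).re)
    (hD : 0 ≤ D) (hω : ‖ψ - inner ℂ e ψ • e‖ ≤ D * R)
    (hrR : r * R ≤ K * s) (hRR : R * R ≤ K * s) (hRK : R ≤ K) :
    |lam - ((inner ℂ e (B e)).re - (inner ℂ f (B₀ f)).re)| ≤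
      (K ^ 2 + K * D + 2 * K ^ 3 * D + D ^ 2 * K * (2 * K + K ^ 3)) * (R * s) := by
  set c := inner ℂ e ψ with hc
  set ω := ψ - c • e with hωdef
  set a := (inner ℂ e (B e)).re with ha
  set b := (inner ℂ f (B₀ f)).re with hb
  have hee : inner ℂ e e = 1 := by rw [inner_self_eq_norm_sq_to_K, he]; simp
  have heω : inner ℂ e ω = 0 := by
    rw [hωdef, inner_sub_right, inner_smul_right, hee, mul_one, ← hc, sub_self]
  have hψeq : ψ = c • e + ω := by rw [hωdef]; abel
  have hSωorth : inner ℂ e (S ω) = 0 := by rw [← hS, hSe, heω]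
  have hpyth : ‖c‖ ^ 2 + ‖S ω‖ ^ 2 = 1 := by
    have h1 := norm_add_sq_eq_norm_sq_add_norm_sq_of_inner_eq_zero (𝕜 := ℂ) (c • e) (S ω)
      (by rw [inner_smul_left, hSωorth, mul_zero])
    have h3 : c • e + S ω = S ψ := by rw [hψeq, map_add, map_smul, hSe]
    rw [h3, hψ, norm_smul, he] at h1
    nlinarith
  have hc1 : ‖c‖ ≤ 1 := by nlinarith [norm_nonneg c, sq_nonneg ‖S ω‖]
  have hreal : ∀ (T : H →L[ℂ] H) (_ : ∀ x y, inner ℂ (T x) y = inner ℂ x (T y)) (x : H),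
      inner ℂ x (T x) = (((inner ℂ x (T x)).re : ℝ) : ℂ) := fun T hT x => by
    refine (Complex.conj_eq_iff_re.1 ?_).symm
    rw [inner_conj_symm, hT]
  have haC : inner ℂ e (B e) = (a : ℂ) := hreal B hB e
  have hbC : inner ℂ f (B₀ f) = (b : ℂ) := hreal B₀ hB₀ f
  set E1 := B e - Complex.I • m with hE1
  set E2 := B f - B₀ f with hE2
  have hBe' : B e = Complex.I • m + E1 := by rw [hE1]; abel
  have hBf' : B f = -m + E2 := by rw [hE2, hf]; abel
  have hfe : inner ℂ f e = 0 := by rw [← inner_conj_symm, hef, map_zero]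
  -- The corrected trial vector: Be = im + E1 and B(if) = -im + iE2, so the first-order terms
  -- cancel.
  set q := e + Complex.I • f with hq
  have hBq : B q = E1 + Complex.I • E2 := by
    rw [hq, map_add, map_smul, hBe', hBf']; module
  have hfm : inner ℂ f m = -(b : ℂ) := by
    rw [← hbC, hf, inner_neg_right, neg_neg]
  have hleft : inner ℂ (B q) e = (a : ℂ) - b - Complex.I * inner ℂ f E1 := by
    rw [hB, hq, inner_add_left, inner_smul_left, haC, hBe', inner_add_right, inner_smul_right, hfm,
      Complex.conj_I]
    linear_combination (b : ℂ) * Complex.I_mul_I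
  have hSSψ : inner ℂ q (B ψ) = (lam : ℂ) * (c - Complex.I * inner ℂ (S f) (S ω)) := by
    have h1 : inner ℂ e (S (S ψ)) = c := by rw [← hS, hSe, ← hS, hSe]
    have h3 : inner ℂ f (S (S ψ)) = inner ℂ (S f) (S ω) := by
      rw [← hS, hψeq, map_add, map_smul, hSe, inner_add_right, inner_smul_right, hS f e, hSe, hfe,
        mul_zero, zero_add]
    rw [heig, inner_smul_right, hq, inner_add_left, inner_smul_left, h1, h3, Complex.conj_I]
    ring
  -- The pairing of Bq with ψ is computed twice: through Bψ = λS²ψ, and through ψ = ce + ω. Every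
  -- remaining term is a product of a quantity O(R) and one O(s).
  have hmain : c * ((lam - (a - b) : ℝ) : ℂ) =
      -(c * Complex.I * inner ℂ f E1) + inner ℂ (B q) ω +
        Complex.I * lam * inner ℂ (S f) (S ω) := by
    have h1 : inner ℂ (B q) ψ = c * inner ℂ (B q) e + inner ℂ (B q) ω := by
      conv_lhs => rw [hψeq, inner_add_right, inner_smul_right]
    rw [hleft, hB, hSSψ] at h1
    push_cast
    linear_combination h1
  set X := |lam - (a - b)| with hX
  have hXn : ‖((lam - (a - b) : ℝ) : ℂ)‖ = X := by rw [Complex.norm_real, Real.norm_eq_abs]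
  have hEE : ‖B q‖ ≤ K * s + K * r * (K * R) := by
    rw [hBq]
    refine (norm_add_le _ _).trans (add_le_add hBe ?_)
    rw [norm_smul, Complex.norm_I, one_mul]
    exact hBB.trans (mul_le_mul_of_nonneg_left hfK (by positivity))
  have hEE' : ‖B q‖ ≤ K * s + K ^ 3 * s := by nlinarith [mul_nonneg hK hK]
  have p1 : ‖c * Complex.I * inner ℂ f E1‖ ≤ K ^ 2 * (R * s) := by
    rw [norm_mul, norm_mul, Complex.norm_I, mul_one]
    have h1 : ‖inner ℂ f E1‖ ≤ (K * R) * (K * s) :=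
      (norm_inner_le_norm _ _).trans (mul_le_mul hfK hBe (norm_nonneg _) (by positivity))
    nlinarith [norm_nonneg (inner ℂ f E1), norm_nonneg c]
  have p2 : ‖inner ℂ (B q) ω‖ ≤ (K * D + K ^ 3 * D) * (R * s) := by
    have h1 : ‖inner ℂ (B q) ω‖ ≤ (K * s + K ^ 3 * s) * (D * R) :=
      (norm_inner_le_norm _ _).trans (mul_le_mul hEE' hω (norm_nonneg _) (by positivity))
    linarith
  have hSω : ‖S ω‖ ≤ D * R := (hS1 ω).trans hω
  have p3 : ‖Complex.I * lam * inner ℂ (S f) (S ω)‖ ≤ K ^ 2 * D * K * (R * s) := by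
    rw [norm_mul, norm_mul, Complex.norm_I, one_mul, Complex.norm_real,
      Real.norm_of_nonneg hlam0]
    have h1 : ‖inner ℂ (S f) (S ω)‖ ≤ (K * R) * (D * R) :=
      (norm_inner_le_norm _ _).trans (mul_le_mul ((hS1 f).trans hfK) hSω (norm_nonneg _)
        (by positivity))
    have h3 : lam * ‖inner ℂ (S f) (S ω)‖ ≤ (K * s) * ((K * R) * (D * R)) :=
      mul_le_mul hlam h1 (norm_nonneg _) (by positivity)
    have h4 : (K * s) * ((K * R) * (D * R)) ≤ (K * s) * ((K * R) * (D * K)) := by gcongr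
    linarith
  have hcX : ‖c‖ * X ≤ (K ^ 2 + K * D + 2 * K ^ 3 * D) * (R * s) := by
    rw [← hXn, ← norm_mul, hmain]
    have t1 := norm_add_le (-(c * Complex.I * inner ℂ f E1) + inner ℂ (B q) ω)
      (Complex.I * lam * inner ℂ (S f) (S ω))
    have t2 := norm_add_le (-(c * Complex.I * inner ℂ f E1)) (inner ℂ (B q) ω)
    rw [norm_neg] at t2
    linarith
  -- The crude bound: λ and (Be, e) are each O(s), and (B₀f, f) is O(R²).
  have hXbound : X ≤ 2 * K * s + K ^ 2 * (R * R) := by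
    have h1 : |b| ≤ (K * R) * (K * R) := by
      have h3 := Complex.abs_re_le_norm (inner ℂ f (B₀ f))
      refine h3.trans ((norm_inner_le_norm _ _).trans ?_)
      rw [hf, norm_neg]
      exact mul_le_mul hfK hm (norm_nonneg _) (by positivity)
    obtain ⟨h4, h5⟩ := abs_le.1 h1
    rw [hX, abs_le]
    constructor <;> linarith
  exact le_of_decomposition (norm_nonneg c) (norm_nonneg (S ω)) (abs_nonneg _) hpyth hSω hcX hXbound
    hRR hRK hK hR

end

end

section

/-! ### The averaged coefficient -/

section

variable {d : ℕ} {α μm μp : ℝ} {μ : Space d → Space d → ℝ}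

/-- Periodicity is assumed almost everywhere for each lattice vector. There are countably many, so
one null set serves all, and the vector may then depend on the point. -/
theorem IsAdmissible.ae_fracPart (hμ : IsAdmissible μm μp μ) :
    ∀ᵐ p : Space d × Space d, μ p.1 (fracPart p.2) = μ p.1 p.2 := by
  have h : ∀ᵐ p : Space d × Space d, ∀ n : Fin d → ℤ,
      μ (p.1 + latticePoint 0) (p.2 + latticePoint n) = μ p.1 p.2 :=
    ae_all_iff.2 fun n => hμ.periodic 0 n
  filter_upwards [h] with p hp
  have h1 : fracPart p.2 = p.2 + latticePoint (fun i => -⌊p.2 i⌋) := by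
    ext i
    simp [latticePoint, fracPart, Int.fract, sub_eq_add_neg]
  have h2 := hp fun i => -⌊p.2 i⌋
  rwa [latticePoint_zero, add_zero, ← h1] at h2

theorem measurePreserving_shear :
    MeasurePreserving (fun p : Space d × Space d => (p.1, p.1 + p.2)) (pairMeasure d)
      (pairMeasure d) :=
  measurePreserving_prod_add (cellMeasure d) volume

/-- The exactly periodic representative of the function `μ_*`. -/
def periodicStar (μ : Space d → Space d → ℝ) (z : Space d) : ℝ :=
  (∫ x, μ x (fracPart (x + z)) ∂(cellMeasure d)) - muMean μ

theorem periodicStar_add_latticePoint (z : Space d) (n : Fin d → ℤ) :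
    periodicStar μ (z + latticePoint n) = periodicStar μ z := by
  simp only [periodicStar, ← add_assoc, fracPart_add_latticePoint]

theorem IsAdmissible.aestronglyMeasurable_shear (hμ : IsAdmissible μm μp μ) :
    AEStronglyMeasurable (fun p : Space d × Space d => μ p.1 (p.1 + p.2)) (pairMeasure d) :=
  hμ.aestronglyMeasurable_pair.comp_measurePreserving measurePreserving_shear

theorem IsAdmissible.ae_shear (hμ : IsAdmissible μm μp μ) :
    ∀ᵐ p ∂(pairMeasure d), μ p.1 (fracPart (p.1 + p.2)) = μ p.1 (p.1 + p.2) ∧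
      μm ≤ μ p.1 (p.1 + p.2) ∧ μ p.1 (p.1 + p.2) ≤ μp :=
  measurePreserving_shear.quasiMeasurePreserving.ae
    ((ae_pairMeasure_of_ae hμ.ae_fracPart).and (ae_pairMeasure_of_ae hμ.bounds))

theorem IsAdmissible.ae_ae_shear (hμ : IsAdmissible μm μp μ) :
    ∀ᵐ z : Space d, ∀ᵐ x ∂(cellMeasure d), μ x (fracPart (x + z)) = μ x (x + z) ∧
      μm ≤ μ x (x + z) ∧ μ x (x + z) ≤ μp :=
  Measure.ae_ae_of_ae_prod ((Measure.measurePreserving_swap (μ := (volume : Measure (Space d)))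
    (ν := cellMeasure d)).quasiMeasurePreserving.ae hμ.ae_shear)

theorem IsAdmissible.muStar_ae_eq (hμ : IsAdmissible μm μp μ) :
    muStar μ =ᵐ[volume] periodicStar μ := by
  filter_upwards [hμ.ae_ae_shear] with z hz
  rw [muStar, periodicStar]
  congr 1
  refine integral_congr_ae ?_
  filter_upwards [hz] with x hx
  rw [hx.1, add_comm]

theorem IsAdmissible.aestronglyMeasurable_average (hμ : IsAdmissible μm μp μ) :
    AEStronglyMeasurable (fun z => ∫ x, μ x (x + z) ∂(cellMeasure d)) volume :=
  hμ.aestronglyMeasurable_shear.prod_swap.integral_prod_right'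

theorem muStar_eq (z : Space d) :
    muStar μ z = (∫ x, μ x (x + z) ∂(cellMeasure d)) - muMean μ := by
  simp only [muStar, add_comm z]

theorem IsAdmissible.aestronglyMeasurable_muStar (hμ : IsAdmissible μm μp μ) :
    AEStronglyMeasurable (muStar μ) volume := by
  have : muStar μ = fun z => (∫ x, μ x (x + z) ∂(cellMeasure d)) - muMean μ :=
    funext muStar_eq
  rw [this]
  exact hμ.aestronglyMeasurable_average.sub aestronglyMeasurable_const

theorem integral_mem_Icc {X : Type*} {_ : MeasurableSpace X} {ν : Measure X}
    [IsProbabilityMeasure ν] {f : X → ℝ} {a b : ℝ} (hf : AEStronglyMeasurable f ν)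
    (h : ∀ᵐ x ∂ν, a ≤ f x ∧ f x ≤ b) : a ≤ ∫ x, f x ∂ν ∧ ∫ x, f x ∂ν ≤ b := by
  have hi : Integrable f ν := by
    refine Integrable.of_bound hf (max |a| |b|) ?_
    filter_upwards [h] with x hx
    exact abs_le_max_abs_abs hx.1 hx.2
  constructor
  · simpa using integral_mono_ae (integrable_const a) hi (h.mono fun x hx => hx.1)
  · simpa using integral_mono_ae hi (integrable_const b) (h.mono fun x hx => hx.2)

theorem cellMeasure_prod_le : (cellMeasure d).prod (cellMeasure d) ≤ pairMeasure d :=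
  Measure.prod_mono le_rfl Measure.restrict_le_self

theorem IsAdmissible.muMean_mem (hμ : IsAdmissible μm μp μ) : μm ≤ muMean μ ∧ muMean μ ≤ μp :=
  integral_mem_Icc (hμ.aestronglyMeasurable_pair.mono_measure cellMeasure_prod_le)
    (ae_mono cellMeasure_prod_le (ae_pairMeasure_of_ae hμ.bounds))

theorem IsAdmissible.abs_muStar_le (hμ : IsAdmissible μm μp μ) (hμm : 0 < μm) :
    ∀ᵐ z : Space d, |muStar μ z| ≤ μp := by
  have hm : ∀ᵐ z : Space d, AEStronglyMeasurable (fun x => μ x (x + z)) (cellMeasure d) :=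
    hμ.aestronglyMeasurable_shear.prod_swap.prodMk_left
  filter_upwards [hμ.ae_ae_shear, hm] with z hz hmz
  have h1 := integral_mem_Icc hmz (hz.mono fun x hx => hx.2)
  have h2 := hμ.muMean_mem
  rw [muStar_eq, abs_le]
  constructor <;> linarith [h1.1, h1.2, h2.1, h2.2]

/-- By Fubini the integral over z may be taken first; for fixed x the translation by x preserves the
measure on the torus, so the average is μ⁰. -/
theorem IsAdmissible.integral_periodicStar (hμ : IsAdmissible μm μp μ) :
    ∫ z, periodicStar μ z ∂(cellMeasure d) = 0 := by
  have hle := cellMeasure_prod_le (d := d)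
  have hmeas : AEStronglyMeasurable (fun p : Space d × Space d => μ p.1 (fracPart (p.1 + p.2)))
      ((cellMeasure d).prod (cellMeasure d)) := by
    refine (hμ.aestronglyMeasurable_shear.mono_measure hle).congr ?_
    filter_upwards [ae_mono hle hμ.ae_shear] with p hp
    exact hp.1.symm
  have hint : Integrable (fun p : Space d × Space d => μ p.1 (fracPart (p.1 + p.2)))
      ((cellMeasure d).prod (cellMeasure d)) := by
    refine Integrable.of_bound hmeas (max |μm| |μp|) ?_
    filter_upwards [ae_mono hle hμ.ae_shear] with p hp
    rw [hp.1]
    exact abs_le_max_abs_abs hp.2.1 hp.2.2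
  have hint2 : Integrable (fun p : Space d × Space d => μ p.1 p.2)
      ((cellMeasure d).prod (cellMeasure d)) := by
    refine Integrable.of_bound (hμ.aestronglyMeasurable_pair.mono_measure hle) (max |μm| |μp|) ?_
    filter_upwards [ae_mono hle (ae_pairMeasure_of_ae hμ.bounds)] with p hp
    exact abs_le_max_abs_abs hp.1 hp.2
  have hm2 : ∀ᵐ x ∂(cellMeasure d), AEStronglyMeasurable (fun y => μ x y) (cellMeasure d) :=
    (hμ.aestronglyMeasurable_pair.mono_measure hle).prodMk_left
  have h1 : ∫ z, ∫ x, μ x (fracPart (x + z)) ∂(cellMeasure d) ∂(cellMeasure d) = muMean μ := by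
    rw [← integral_integral_swap hint, muMean, integral_prod _ hint2]
    refine integral_congr_ae ?_
    filter_upwards [hm2] with x hx
    have hmp := measurePreserving_fracPart_add (d := d) x
    have h3 := integral_map hmp.measurable.aemeasurable
      (f := fun y => μ x y) (by rw [hmp.map_eq]; exact hx)
    rw [hmp.map_eq] at h3
    rw [h3]
    simp only [add_comm x]
  simp only [periodicStar]
  rw [integral_sub hint.integral_prod_right (integrable_const _), h1]
  simp

theorem IsAdmissible.integral_shiftedCell_muStar (hμ : IsAdmissible μm μp μ) (n : Fin d → ℤ) :
    ∫ z in shiftedCell n, muStar μ z = 0 := by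
  rw [integral_congr_ae (ae_restrict_of_ae hμ.muStar_ae_eq),
    ← (measurePreserving_add_shiftedCell n).integral_comp (measurableEmbedding_addRight _)]
  simp only [periodicStar_add_latticePoint]
  exact hμ.integral_periodicStar

end

end

section

/-! ### Sums over the lattice against a periodic function of mean value zero -/

theorem abs_rpow_neg_sub_le {s m x y : ℝ} (hs : 0 < s) (hm : 0 < m) (hx : m ≤ x) (hy : m ≤ y) :
    |x ^ (-s) - y ^ (-s)| ≤ s * m ^ (-s - 1) * |x - y| := by
  have h := Convex.norm_image_sub_le_of_norm_hasDerivWithin_le (𝕜 := ℝ) (s := Set.Ici m)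
    (f := fun t : ℝ => t ^ (-s)) (f' := fun t : ℝ => -s * t ^ (-s - 1)) (C := s * m ^ (-s - 1))
    (fun t ht => (Real.hasDerivAt_rpow_const (Or.inl (hm.trans_le ht).ne')).hasDerivWithinAt)
    (fun t ht => ?_) (convex_Ici m) (Set.mem_Ici.2 hy) (Set.mem_Ici.2 hx)
  · simpa [Real.norm_eq_abs] using h
  · have ht' : m ≤ t := ht
    have ht0 : 0 < t := hm.trans_le ht'
    rw [norm_mul, norm_neg, Real.norm_of_nonneg hs.le,
      Real.norm_of_nonneg (Real.rpow_nonneg ht0.le _)]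
    exact mul_le_mul_of_nonneg_left (Real.rpow_le_rpow_of_nonpos hm ht' (by linarith)) hs.le

section

variable {d : ℕ} {α μm μp : ℝ} {μ : Space d → Space d → ℝ}

theorem norm_sub_latticePoint_le {n : Fin d → ℤ} {z : Space d} (hz : z ∈ shiftedCell n) :
    ‖z - latticePoint n‖ ≤ Real.sqrt d :=
  norm_le_sqrt_of_mem_cell hz

/-- The hypotheses on the numerator of a kernel `q(z) / |z|^{d+α}` that is summed over the
lattice. -/
structure LatticeNumerator (d : ℕ) (p : ℕ) (R C : ℝ) (q : Space d → ℝ) : Prop where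
  measurable : Measurable q
  near : ∀ z, ‖z‖ ≤ 3 * Real.sqrt d → |q z| * ‖z‖ ≤ C * min ((R * ‖z‖) ^ p) ((R * ‖z‖) ^ 2)
  far : ∀ z, 1 ≤ ‖z‖ → |q z| ≤ C * min ((R * ‖z‖) ^ p) ((R * ‖z‖) ^ 2)
  sub : ∀ z w, 1 ≤ ‖z‖ → ‖w‖ ≤ 2 * ‖z‖ → ‖z - w‖ ≤ Real.sqrt d →
    |q z - q w| * ‖z‖ ≤ C * min ((R * ‖z‖) ^ p) ((R * ‖z‖) ^ 2)

/-- The constant in the bounds for lattice sums. -/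
def latticeConst (d p : ℕ) (α C : ℝ) : ℝ :=
  C + C * 2 ^ p * (((d : ℝ) + α) * (1 / 2) ^ (-((d : ℝ) + α) - 1) * Real.sqrt d)

variable {p : ℕ} {R C : ℝ} {q : Space d → ℝ}

/-- On cells near the origin the kernel itself obeys the bound. On the others its oscillation does:
the mean value theorem for |z|^{-d-α} and the Lipschitz bound for q each gain a factor 1/|z|, which
raises the exponent to d + α + 1. -/
theorem LatticeNumerator.near_or_far [NeZero d] (hq : LatticeNumerator d p R C q) (h0 : 0 < α)
    (hp : 2 ≤ p) (hR : 0 ≤ R) (hC : 0 ≤ C) (n : Fin d → ℤ) :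
    (∀ z ∈ shiftedCell n, |q z / ‖z‖ ^ ((d : ℝ) + α)| ≤
      latticeConst d p α C * radialMin d (α + 1) p 2 R z) ∨
    (∀ z ∈ shiftedCell n, |q z / ‖z‖ ^ ((d : ℝ) + α) -
      q (latticePoint n) / ‖(latticePoint n : Space d)‖ ^ ((d : ℝ) + α)| ≤
        latticeConst d p α C * radialMin d (α + 1) p 2 R z) := by
  have hd1 : (1 : ℝ) ≤ d := by exact_mod_cast NeZero.one_le
  have hs : 0 < (d : ℝ) + α := by linarith
  set s := (d : ℝ) + α with hsdef
  have hsd : 1 ≤ Real.sqrt d := Real.one_le_sqrt.2 hd1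
  set D := s * (1 / 2 : ℝ) ^ (-s - 1) * Real.sqrt d with hD
  have hD0 : 0 ≤ D := by positivity
  have hpow : ∀ z : Space d, z ≠ 0 → ‖z‖ ^ ((d : ℝ) + (α + 1)) = ‖z‖ ^ s * ‖z‖ := fun z hz => by
    rw [← add_assoc, ← hsdef, Real.rpow_add (norm_pos_iff.2 hz), Real.rpow_one]
  have hrad : ∀ z : Space d, z ≠ 0 → radialMin d (α + 1) p 2 R z =
      min ((R * ‖z‖) ^ p) ((R * ‖z‖) ^ 2) / (‖z‖ ^ s * ‖z‖) := fun z hz => by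
    rw [radialMin, hpow z hz]
  -- The cell has diameter at most √d. Beyond 2√d every z in the cell has |z| ≥ √d ≥ 1 and is
  -- comparable with n; below it |z| ≤ 3√d.
  rcases lt_or_ge ‖(latticePoint n : Space d)‖ (2 * Real.sqrt d) with hn | hn
  · left
    intro z hz
    have h1 := norm_sub_latticePoint_le hz
    have h2 : ‖z‖ ≤ 3 * Real.sqrt d := by
      have := norm_le_norm_add_norm_sub' z (latticePoint n)
      linarith
    rcases eq_or_ne z 0 with rfl | hz0
    · have h3 : (0 : ℝ) ^ s = 0 := Real.zero_rpow hs.ne'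
      rw [norm_zero, h3, div_zero, abs_zero]
      exact mul_nonneg (by unfold latticeConst; positivity) (radialMin_nonneg _ _ _ hR _)
    · have hz' := norm_pos_iff.2 hz0
      have hzs : 0 < ‖z‖ ^ s := Real.rpow_pos_of_pos hz' s
      rw [hrad z hz0, abs_div, abs_of_pos hzs, mul_div_assoc', div_le_div_iff₀ hzs (by positivity)]
      have h4 := hq.near z h2
      have h5 : C * min ((R * ‖z‖) ^ p) ((R * ‖z‖) ^ 2) ≤
          latticeConst d p α C * min ((R * ‖z‖) ^ p) ((R * ‖z‖) ^ 2) := by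
        refine mul_le_mul_of_nonneg_right ?_ (by positivity)
        rw [latticeConst, ← hsdef, ← hD]
        have : 0 ≤ C * 2 ^ p * D := by positivity
        linarith
      calc |q z| * (‖z‖ ^ s * ‖z‖) = (|q z| * ‖z‖) * ‖z‖ ^ s := by ring
        _ ≤ _ := mul_le_mul_of_nonneg_right (h4.trans h5) hzs.le
  · right
    intro z hz
    set w : Space d := latticePoint n with hw
    have h1 := norm_sub_latticePoint_le hz
    rw [← hw] at h1
    have h2 : ‖w‖ ≤ ‖z‖ + Real.sqrt d := by
      have := norm_le_norm_add_norm_sub z w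
      linarith
    have h3 : ‖z‖ ≤ ‖w‖ + Real.sqrt d := by
      have := norm_le_norm_add_norm_sub' z w
      linarith
    have hz1 : 1 ≤ ‖z‖ := by linarith
    have hw1 : 1 ≤ ‖w‖ := by linarith
    have hwz : ‖w‖ ≤ 2 * ‖z‖ := by linarith
    have hzw : 1 / 2 * ‖z‖ ≤ ‖w‖ := by linarith
    have hz' : 0 < ‖z‖ := by linarith
    have hw' : 0 < ‖w‖ := by linarith
    have hzs : 0 < ‖z‖ ^ s := Real.rpow_pos_of_pos hz' s
    set M := min ((R * ‖z‖) ^ p) ((R * ‖z‖) ^ 2) with hM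
    have hM0 : 0 ≤ M := by positivity
    have e1 : |q w| ≤ C * (2 ^ p * M) := by
      refine (hq.far w hw1).trans (mul_le_mul_of_nonneg_left ?_ hC)
      have h4 : min ((R * ‖w‖) ^ p) ((R * ‖w‖) ^ 2) ≤
          min ((2 * (R * ‖z‖)) ^ p) ((2 * (R * ‖z‖)) ^ 2) :=
        min_pow_mono (by positivity) (by nlinarith)
      refine h4.trans ?_
      rw [hM, mul_min_of_nonneg _ _ (pow_nonneg zero_le_two p), mul_pow 2 _ p,
        mul_pow 2 _ 2]
      have h5 : (2 : ℝ) ^ 2 * (R * ‖z‖) ^ 2 ≤ 2 ^ p * (R * ‖z‖) ^ 2 :=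
        mul_le_mul_of_nonneg_right (pow_le_pow_right₀ one_le_two hp) (sq_nonneg _)
      exact min_le_min le_rfl h5
    have e2 : |‖z‖ ^ (-s) - ‖w‖ ^ (-s)| ≤ D * (‖z‖ ^ s * ‖z‖)⁻¹ := by
      have h4 := abs_rpow_neg_sub_le (m := 1 / 2 * ‖z‖) (x := ‖z‖) hs (by positivity)
        (by linarith) hzw
      have h5 : |‖z‖ - ‖w‖| ≤ Real.sqrt d := (abs_norm_sub_norm_le z w).trans h1
      have h6 : (1 / 2 * ‖z‖) ^ (-s - 1) = (1 / 2) ^ (-s - 1) * (‖z‖ ^ s * ‖z‖)⁻¹ := by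
        rw [Real.mul_rpow (by norm_num) hz'.le]
        congr 1
        rw [show -s - 1 = -(s + 1) by ring, Real.rpow_neg hz'.le, Real.rpow_add hz', Real.rpow_one]
      rw [h6] at h4
      refine h4.trans ?_
      have h7 : 0 ≤ s * ((1 / 2) ^ (-s - 1) * (‖z‖ ^ s * ‖z‖)⁻¹) := by positivity
      calc _ ≤ s * ((1 / 2) ^ (-s - 1) * (‖z‖ ^ s * ‖z‖)⁻¹) * Real.sqrt d :=
            mul_le_mul_of_nonneg_left h5 h7
        _ = _ := by rw [hD]; ring
    have e3 : |q z - q w| * ‖z‖ ^ (-s) ≤ C * M * (‖z‖ ^ s * ‖z‖)⁻¹ := by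
      have h4 := hq.sub z w hz1 hwz h1
      rw [mul_inv, Real.rpow_neg hz'.le, mul_comm (‖z‖ ^ s)⁻¹, ← mul_assoc]
      refine mul_le_mul_of_nonneg_right ?_ (by positivity)
      rwa [← div_eq_mul_inv, le_div_iff₀ hz']
    have heq : q z / ‖z‖ ^ s - q w / ‖w‖ ^ s =
        (q z - q w) * ‖z‖ ^ (-s) + q w * (‖z‖ ^ (-s) - ‖w‖ ^ (-s)) := by
      rw [Real.rpow_neg hz'.le, Real.rpow_neg hw'.le]; ring
    rw [heq, hrad z (norm_pos_iff.1 hz')]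
    refine (abs_add_le _ _).trans ?_
    rw [abs_mul, abs_mul, abs_of_pos (Real.rpow_pos_of_pos hz' (-s))]
    have e4 : |q w| * |‖z‖ ^ (-s) - ‖w‖ ^ (-s)| ≤
        C * (2 ^ p * M) * (D * (‖z‖ ^ s * ‖z‖)⁻¹) :=
      mul_le_mul e1 e2 (abs_nonneg _) (by positivity)
    refine (add_le_add e3 e4).trans (le_of_eq ?_)
    rw [latticeConst, ← hsdef, ← hD, div_eq_mul_inv]
    ring

theorem volume_shiftedCell_ne_top (n : Fin d → ℤ) : volume (shiftedCell n : Set (Space d)) ≠ ∞ := by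
  rw [← Measure.restrict_apply_univ, ← (measurePreserving_add_shiftedCell n).map_eq,
    Measure.map_apply (by fun_prop) MeasurableSet.univ]
  simp

/-- Because μ_* has mean zero on each shifted cell, a constant c may be subtracted from the kernel
without changing the integral; the first alternative is c = 0. -/
theorem IsAdmissible.integral_shiftedCell_le (hμ : IsAdmissible μm μp μ) (hμm : 0 < μm)
    {h Φ : Space d → ℝ} {n : Fin d → ℤ} (hh : Measurable h) (hΦ : Integrable Φ)
    (hle : (∀ z ∈ shiftedCell n, |h z| ≤ Φ z) ∨
      ∃ c : ℝ, ∀ z ∈ shiftedCell n, |h z - c| ≤ Φ z) :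
    IntegrableOn (fun z => muStar μ z * h z) (shiftedCell n) ∧
      |∫ z in shiftedCell n, muStar μ z * h z| ≤ μp * ∫ z in shiftedCell n, Φ z := by
  obtain ⟨c, hc⟩ : ∃ c : ℝ, ∀ z ∈ shiftedCell n, |h z - c| ≤ Φ z := by
    rcases hle with h1 | h1
    · exact ⟨0, fun z hz => by rw [sub_zero]; exact h1 z hz⟩
    · exact h1
  have hσ := hμ.aestronglyMeasurable_muStar.restrict (s := shiftedCell n)
  have hb : ∀ᵐ z ∂(volume.restrict (shiftedCell n)), |muStar μ z| ≤ μp :=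
    ae_restrict_of_ae (hμ.abs_muStar_le hμm)
  have : IsFiniteMeasure (volume.restrict (shiftedCell n : Set (Space d))) :=
    ⟨by rw [Measure.restrict_apply_univ]; exact (volume_shiftedCell_ne_top n).lt_top⟩
  have hσi : IntegrableOn (muStar μ) (shiftedCell n) :=
    Integrable.of_bound hσ μp (hb.mono fun z hz => hz)
  have hle' : ∀ᵐ z ∂(volume.restrict (shiftedCell n)), |muStar μ z * (h z - c)| ≤ μp * Φ z := by
    filter_upwards [hb, ae_restrict_mem (measurableSet_shiftedCell n)] with z h1 h2
    rw [abs_mul]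
    exact mul_le_mul h1 (hc z h2) (abs_nonneg _) (hμm.le.trans hμ.le)
  have hΦ' : IntegrableOn (fun z => μp * Φ z) (shiftedCell n) := (hΦ.const_mul μp).integrableOn
  have hi : IntegrableOn (fun z => muStar μ z * (h z - c)) (shiftedCell n) :=
    Integrable.mono' hΦ' (hσ.mul (hh.sub_const c).aestronglyMeasurable) hle'
  have heq : (fun z => muStar μ z * h z) =
      fun z => muStar μ z * (h z - c) + muStar μ z * c := funext fun z => by ring
  rw [heq]
  refine ⟨hi.add (hσi.mul_const c), ?_⟩
  rw [integral_add hi (hσi.mul_const c), integral_mul_const, hμ.integral_shiftedCell_muStar,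
    zero_mul, add_zero, ← integral_const_mul]
  exact (abs_integral_le_integral_abs).trans (integral_mono_ae hi.abs hΦ' hle')

theorem hasSum_integral_shiftedCell {Φ : Space d → ℝ} (hΦ : Integrable Φ) :
    HasSum (fun n : Fin d → ℤ => ∫ z in shiftedCell n, Φ z) (∫ z, Φ z) := by
  have := hasSum_integral_iUnion (f := Φ) (μ := volume)
    (fun n : Fin d → ℤ => measurableSet_shiftedCell n) pairwise_disjoint_shiftedCell
    (by rw [iUnion_shiftedCell]; exact hΦ.integrableOn)
  rwa [iUnion_shiftedCell, setIntegral_univ] at this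

/-- The cell bounds add up to the integral of the radial majorant, finite because 2 < α + 1 < p, and
scaling turns it into R^{α+1}. Summing by cells matters: for quadratic q the kernel alone is not
integrable at infinity. -/
theorem IsAdmissible.lattice_sum [NeZero d] (hμ : IsAdmissible μm μp μ) (hμm : 0 < μm)
    (h1 : 1 < α) (hp : α + 1 < p) (hR : 0 ≤ R) (hC : 0 ≤ C) (hq : LatticeNumerator d p R C q) :
    (∀ n, IntegrableOn (fun z => muStar μ z * (q z / ‖z‖ ^ ((d : ℝ) + α))) (shiftedCell n)) ∧
    (Summable fun n => ∫ z in shiftedCell n, muStar μ z * (q z / ‖z‖ ^ ((d : ℝ) + α))) ∧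
    |∑' n, ∫ z in shiftedCell n, muStar μ z * (q z / ‖z‖ ^ ((d : ℝ) + α))| ≤
      μp * (latticeConst d p α C * (R ^ (α + 1) * ∫ z, radialMin d (α + 1) p 2 1 z)) := by
  have h2 : ((2 : ℕ) : ℝ) < α + 1 := by push_cast; linarith
  have hp2 : 2 ≤ p := by
    have : ((2 : ℕ) : ℝ) < p := h2.trans hp
    exact_mod_cast this.le
  have hi := (integrable_radialMin (d := d) h2 hp hR).const_mul (latticeConst d p α C)
  have hqm := hq.measurable
  have hn := fun n => hμ.integral_shiftedCell_le hμm
    (h := fun z => q z / ‖z‖ ^ ((d : ℝ) + α)) (n := n) (by fun_prop) hi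
    ((hq.near_or_far (one_pos.trans h1) hp2 hR hC n).imp_right fun h => ⟨_, h⟩)
  have hs := (hasSum_integral_shiftedCell hi).mul_left μp
  refine ⟨fun n => (hn n).1, Summable.of_norm_bounded hs.summable fun n => (hn n).2, ?_⟩
  have := tsum_of_norm_bounded (f := fun n => ∫ z in shiftedCell n,
    muStar μ z * (q z / ‖z‖ ^ ((d : ℝ) + α))) hs fun n => (hn n).2
  rw [integral_const_mul, integral_radialMin h2 hp hR] at this
  exact this

end

end

/-! ### Taylor expansion of the form on the constants -/

section

theorem abs_one_sub_cos_sub_le (t : ℝ) :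
    |1 - Real.cos t - t ^ 2 / 2| ≤ min (|t| ^ 4) (|t| ^ 2) := by
  have h1 := Real.one_sub_sq_div_two_le_cos (x := t)
  have h2 := Real.cos_le_one t
  have h3 : |1 - Real.cos t - t ^ 2 / 2| ≤ |t| ^ 2 := by
    rw [sq_abs, abs_le]
    constructor <;> nlinarith [sq_nonneg t]
  refine le_min ?_ h3
  rcases le_total |t| 1 with h | h
  · have h4 := Real.cos_bound h
    rw [← abs_neg, show -(1 - Real.cos t - t ^ 2 / 2) = Real.cos t - (1 - t ^ 2 / 2) by ring]
    have : 0 ≤ |t| ^ 4 := by positivity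
    linarith
  · exact h3.trans (pow_le_pow_right₀ h (by norm_num))

theorem abs_sin_sub_le (t : ℝ) : |Real.sin t - t| ≤ 2 * min (|t| ^ 3) (|t| ^ 1) := by
  have h3 : |Real.sin t - t| ≤ 2 * |t| ^ 1 := by
    have := abs_sub (Real.sin t) t
    have h4 : |Real.sin t| ≤ |t| := Real.abs_sin_le_abs
    rw [pow_one]; linarith
  rw [mul_min_of_nonneg _ _ zero_le_two]
  refine le_min ?_ h3
  rcases le_total |t| 1 with h | h
  · have h4 := Real.sin_bound h
    have h5 : Real.sin t - t = (Real.sin t - (t - t ^ 3 / 6)) - t ^ 3 / 6 := by ring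
    rw [h5]
    refine (abs_sub _ _).trans ?_
    have h6 : |t ^ 3 / 6| = |t| ^ 3 / 6 := by rw [abs_div, abs_pow]; norm_num
    have h7 : |t| ^ 5 ≤ |t| ^ 3 := pow_le_pow_of_le_one (abs_nonneg t) h (by norm_num)
    have : 0 ≤ |t| ^ 3 := by positivity
    rw [h6]; linarith
  · exact h3.trans (mul_le_mul_of_nonneg_left (pow_le_pow_right₀ h (by norm_num)) zero_le_two)

theorem abs_one_sub_cos_sub_sub_le {t t' T : ℝ} (ht : |t| ≤ T) (ht' : |t'| ≤ T) :
    |(1 - Real.cos t - t ^ 2 / 2) - (1 - Real.cos t' - t' ^ 2 / 2)| ≤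
      2 * min (T ^ 3) (T ^ 1) * |t - t'| := by
  have h := Convex.norm_image_sub_le_of_norm_hasDerivWithin_le (𝕜 := ℝ) (s := Set.Icc (-T) T)
    (f := fun t : ℝ => 1 - Real.cos t - t ^ 2 / 2) (f' := fun t : ℝ => Real.sin t - t)
    (C := 2 * min (T ^ 3) (T ^ 1)) (fun x hx => ?_) (fun x hx => ?_) (convex_Icc (-T) T)
    (abs_le.1 ht') (abs_le.1 ht)
  · simpa [Real.norm_eq_abs] using h
  · have h1 := ((Real.hasDerivAt_cos x).const_sub 1).sub ((hasDerivAt_pow 2 x).div_const 2)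
    have h2 : - -Real.sin x - ((2 : ℕ) : ℝ) * x ^ (2 - 1) / 2 = Real.sin x - x := by
      push_cast; ring
    rw [h2] at h1
    exact h1.hasDerivWithinAt
  · refine (abs_sin_sub_le x).trans ?_
    exact mul_le_mul_of_nonneg_left (min_pow_mono (abs_nonneg x) (abs_le.2 hx)) zero_le_two

section

variable {d : ℕ} {α μm μp : ℝ} {μ : Space d → Space d → ℝ}

/-- A quadratic numerator times |z| is cubic, hence p = 3 near the origin. At infinity its
increments over distance √d grow only linearly, so after multiplication by |z| the exponent 2
suffices. -/
theorem latticeNumerator_mul [NeZero d] (j k : Fin d) :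
    LatticeNumerator d 3 1 (3 * Real.sqrt d) fun z => z j * z k / 2 := by
  have hsd : 1 ≤ Real.sqrt d := Real.one_le_sqrt.2 (by exact_mod_cast NeZero.one_le)
  have hle : ∀ z : Space d, |z j * z k / 2| ≤ ‖z‖ ^ 2 / 2 := fun z => by
    have h1 : |z j| ≤ ‖z‖ := PiLp.norm_apply_le z j
    have h2 : |z k| ≤ ‖z‖ := PiLp.norm_apply_le z k
    rw [abs_div, abs_mul, abs_two, pow_two]
    gcongr
  refine ⟨by fun_prop, fun z hz => ?_, fun z hz => ?_, fun z w hz hw hzw => ?_⟩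
  · rw [one_mul, mul_min_of_nonneg _ _ (by positivity)]
    have h1 : |z j * z k / 2| * ‖z‖ ≤ ‖z‖ ^ 2 / 2 * ‖z‖ :=
      mul_le_mul_of_nonneg_right (hle z) (norm_nonneg z)
    refine le_min (h1.trans ?_) (h1.trans ?_)
    · have : 0 ≤ ‖z‖ ^ 3 := by positivity
      nlinarith
    · nlinarith [sq_nonneg ‖z‖]
  · rw [one_mul, mul_min_of_nonneg _ _ (by positivity)]
    have h1 : ‖z‖ ^ 2 ≤ ‖z‖ ^ 3 := pow_le_pow_right₀ hz (by norm_num)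
    have h2 := sq_nonneg ‖z‖
    refine le_min ((hle z).trans ?_) ((hle z).trans ?_) <;> nlinarith
  · rw [one_mul, mul_min_of_nonneg _ _ (by positivity)]
    have h1 : ‖z‖ ^ 2 ≤ ‖z‖ ^ 3 := pow_le_pow_right₀ hz (by norm_num)
    have h2 := sq_nonneg ‖z‖
    have a1 : |z j| ≤ ‖z‖ := PiLp.norm_apply_le z j
    have a2 : |w k| ≤ 2 * ‖z‖ := (PiLp.norm_apply_le w k).trans hw
    have a3 : |z k - w k| ≤ Real.sqrt d := (PiLp.norm_apply_le (z - w) k).trans hzw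
    have a4 : |z j - w j| ≤ Real.sqrt d := (PiLp.norm_apply_le (z - w) j).trans hzw
    have h3 : |z j * z k / 2 - w j * w k / 2| ≤ 3 / 2 * (Real.sqrt d * ‖z‖) := by
      have h4 : z j * z k / 2 - w j * w k / 2 = (z j * (z k - w k) + (z j - w j) * w k) / 2 := by
        ring
      have h5 : |z j * (z k - w k)| ≤ ‖z‖ * Real.sqrt d := by
        rw [abs_mul]; gcongr
      have h6 : |(z j - w j) * w k| ≤ Real.sqrt d * (2 * ‖z‖) := by
        rw [abs_mul]; gcongr
      rw [h4, abs_div, abs_two]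
      have := abs_add_le (z j * (z k - w k)) ((z j - w j) * w k)
      linarith
    have h4 : |z j * z k / 2 - w j * w k / 2| * ‖z‖ ≤ 3 * Real.sqrt d * ‖z‖ ^ 2 := by
      have := mul_le_mul_of_nonneg_right h3 (norm_nonneg z)
      have h5 : 0 ≤ Real.sqrt d * ‖z‖ ^ 2 := by positivity
      linarith
    refine le_min (h4.trans ?_) h4
    exact mul_le_mul_of_nonneg_left h1 (by positivity)

/-- The remainder of the cosine is quartic near zero and quadratic at infinity. All bounds are kept
in terms of |ξ||z|, so that scaling produces |ξ|^{α+1}. -/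
theorem latticeNumerator_cos [NeZero d] (ξ : Space d) :
    LatticeNumerator d 4 ‖ξ‖ (16 * Real.sqrt d)
      fun z => 1 - Real.cos (inner ℝ ξ z) - inner ℝ ξ z ^ 2 / 2 := by
  have hsd : 1 ≤ Real.sqrt d := Real.one_le_sqrt.2 (by exact_mod_cast NeZero.one_le)
  have hle : ∀ z : Space d, |1 - Real.cos (inner ℝ ξ z) - inner ℝ ξ z ^ 2 / 2| ≤
      min ((‖ξ‖ * ‖z‖) ^ 4) ((‖ξ‖ * ‖z‖) ^ 2) := fun z =>
    (abs_one_sub_cos_sub_le _).trans (min_pow_mono (abs_nonneg _) (abs_real_inner_le_norm ξ z))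
  refine ⟨by fun_prop, fun z hz => ?_, fun z hz => ?_, fun z w hz hw hzw => ?_⟩
  · have h1 : 0 ≤ min ((‖ξ‖ * ‖z‖) ^ 4) ((‖ξ‖ * ‖z‖) ^ 2) := by positivity
    have h2 : ‖z‖ ≤ 16 * Real.sqrt d := by linarith
    have := mul_le_mul (hle z) h2 (norm_nonneg z) h1
    linarith
  · have h1 : 0 ≤ min ((‖ξ‖ * ‖z‖) ^ 4) ((‖ξ‖ * ‖z‖) ^ 2) := by positivity
    refine (hle z).trans ?_
    nlinarith
  · have hT := abs_real_inner_le_norm ξ z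
    have hT' := abs_real_inner_le_norm ξ w
    have h1 : |inner ℝ ξ z| ≤ 2 * (‖ξ‖ * ‖z‖) := by
      have : 0 ≤ ‖ξ‖ * ‖z‖ := by positivity
      linarith
    have h2 : |inner ℝ ξ w| ≤ 2 * (‖ξ‖ * ‖z‖) := by
      have := mul_le_mul_of_nonneg_left hw (norm_nonneg ξ)
      linarith
    have h3 : |inner ℝ ξ z - inner ℝ ξ w| ≤ ‖ξ‖ * Real.sqrt d := by
      rw [← inner_sub_right]
      exact (abs_real_inner_le_norm _ _).trans (mul_le_mul_of_nonneg_left hzw (norm_nonneg ξ))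
    set y := ‖ξ‖ * ‖z‖ with hy
    have hy0 : 0 ≤ y := by positivity
    have h4 := (abs_one_sub_cos_sub_sub_le h1 h2).trans
      (mul_le_mul_of_nonneg_left h3 (by positivity))
    have h5 := mul_le_mul_of_nonneg_right h4 (norm_nonneg z)
    refine h5.trans ?_
    -- The increment |ξ|√d times |z| supplies one more power of y; 16 arises as 2·2³ from the
    -- derivative bound at 2y.
    rw [mul_min_of_nonneg (y ^ 4) _ (by positivity)]
    refine le_min ?_ ?_
    · calc 2 * min ((2 * y) ^ 3) ((2 * y) ^ 1) * (‖ξ‖ * Real.sqrt d) * ‖z‖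
          ≤ 2 * (2 * y) ^ 3 * (‖ξ‖ * Real.sqrt d) * ‖z‖ := by
            gcongr
            exact min_le_left _ _
        _ = 16 * Real.sqrt d * y ^ 4 := by rw [hy]; ring
    · calc 2 * min ((2 * y) ^ 3) ((2 * y) ^ 1) * (‖ξ‖ * Real.sqrt d) * ‖z‖
          ≤ 2 * (2 * y) ^ 1 * (‖ξ‖ * Real.sqrt d) * ‖z‖ := by
            gcongr
            exact min_le_right _ _
        _ = 4 * Real.sqrt d * y ^ 2 := by rw [hy]; ring
        _ ≤ 16 * Real.sqrt d * y ^ 2 := by gcongr; norm_num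

/-- The bound for the entries of the lattice part of `g⁰`. -/
def latticeBound (d : ℕ) (α μp : ℝ) : ℝ :=
  μp * (latticeConst d 3 α (3 * Real.sqrt d) * (1 ^ (α + 1) * ∫ z, radialMin d (α + 1) 3 2 1 z))

theorem latticeIntegrand_eq (j k : Fin d) :
    latticeIntegrand α μ j k = fun z => muStar μ z * ((z j * z k / 2) / ‖z‖ ^ ((d : ℝ) + α)) := by
  funext z
  rw [latticeIntegrand]
  ring

theorem inner_sq_eq_sum (ξ z : Space d) :
    inner ℝ ξ z ^ 2 = ∑ j, ∑ k, z j * z k * (ξ k * ξ j) := by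
  rw [pow_two, PiLp.inner_apply, Finset.sum_mul_sum]
  refine Finset.sum_congr rfl fun j _ => Finset.sum_congr rfl fun k _ => ?_
  simp
  ring

variable [NeZero d]

theorem IsAdmissible.lattice_entry (hμ : IsAdmissible μm μp μ) (hμm : 0 < μm) (h1 : 1 < α)
    (h2 : α < 2) (j k : Fin d) :
    (∀ n, IntegrableOn (latticeIntegrand α μ j k) (shiftedCell n)) ∧
    (Summable fun n => ∫ z in shiftedCell n, latticeIntegrand α μ j k z) ∧
    |∑' n, ∫ z in shiftedCell n, latticeIntegrand α μ j k z| ≤ latticeBound d α μp := by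
  simp only [latticeIntegrand_eq]
  exact hμ.lattice_sum hμm h1 (by push_cast; linarith) zero_le_one (by positivity)
    (latticeNumerator_mul j k)

variable (hμ : IsAdmissible μm μp μ) (hμm : 0 < μm) (h0 : 0 < α) (h2 : α < 2) (ξ : Space d)

theorem IsAdmissible.integrable_muStar_cos (hμ : IsAdmissible μm μp μ) (hμm : 0 < μm) (h0 : 0 < α)
    (h2 : α < 2) (ξ : Space d) :
    Integrable fun z => muStar μ z * ((1 - Real.cos (inner ℝ ξ z)) / ‖z‖ ^ ((d : ℝ) + α)) :=
  (integrable_one_sub_cos_div h0 h2 ξ).bdd_mul hμ.aestronglyMeasurable_muStar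
    (hμ.abs_muStar_le hμm)

/-- The exact value of the form on the constants. -/
theorem IsAdmissible.re_inner_formOp_oneCell :
    (inner ℂ (oneCell d) (hμ.formOp hμm h0 h2 ξ (oneCell d))).re =
      muMean μ * c0 d α * ‖ξ‖ ^ α +
        ∫ z, muStar μ z * ((1 - Real.cos (inner ℝ ξ z)) / ‖z‖ ^ ((d : ℝ) + α)) := by
  have i1 := hμ.integrable_twistDiff_mul hμm h0 h2 ξ ξ (oneCell d) (oneCell d)
  have hae : (fun p => twistDiff ξ (smoothing d h0 (oneCell d)) p *
      conj (twistDiff ξ (smoothing d h0 (oneCell d)) p)) =ᵐ[levyMeasure α μ]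
      fun p => ((2 * (1 - Real.cos (inner ℝ ξ (p.2 - p.1))) : ℝ) : ℂ) := by
    filter_upwards [levyMeasure_absolutelyContinuous.ae_le (twistDiff_oneCell (d := d) ξ)] with p hp
    rw [smoothing_oneCell, hp, Complex.mul_conj', ← normSq_one_sub_expChar]
    norm_cast
  set F : Space d × Space d → ℝ := fun p =>
    kernel α μ p * (2 * (1 - Real.cos (inner ℝ ξ (p.2 - p.1)))) with hF
  have hFi : Integrable F (pairMeasure d) := by
    have h3 := (hμ.integrable_levyMeasure_iff hμm).1 (i1.congr hae)
    have h4 : Integrable (fun p => ((F p : ℝ) : ℂ)) (pairMeasure d) := by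
      refine h3.congr (Filter.Eventually.of_forall fun p => ?_)
      simp [hF]
    exact h4.re.congr (Filter.Eventually.of_forall fun p => by simp)
  have hval : inner ℂ (oneCell d) (hμ.formOp hμm h0 h2 ξ (oneCell d)) =
      ((1 / 2 * ∫ p, F p ∂(pairMeasure d) : ℝ) : ℂ) := by
    rw [hμ.inner_formOp, hμ.inner_twistOp, integral_congr_ae hae, hμ.integral_levyMeasure hμm]
    push_cast
    rw [← integral_complex_ofReal]
    congr 1
    refine integral_congr_ae (Filter.Eventually.of_forall fun p => ?_)
    simp [hF]
  have hshear : Integrable (fun p : Space d × Space d => F (p.1, p.1 + p.2)) (pairMeasure d) :=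
    measurePreserving_shear.integrable_comp_of_integrable hFi
  have hint : ∫ p, F p ∂(pairMeasure d) = ∫ z, ∫ x, F (x, x + z) ∂(cellMeasure d) := by
    have h3 := integral_map (measurePreserving_shear (d := d)).measurable.aemeasurable (f := F)
      (by rw [measurePreserving_shear.map_eq]; exact hFi.aestronglyMeasurable)
    rw [measurePreserving_shear.map_eq] at h3
    rw [h3, integral_prod_symm _ hshear]
  rw [hval, Complex.ofReal_re, hint, ← integral_const_mul]
  -- Averaging over x at fixed z replaces μ(x, x + z) by μ⁰ + μ_*(z).
  have h3 : ∀ z : Space d, 1 / 2 * ∫ x, F (x, x + z) ∂(cellMeasure d) =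
      muMean μ * ((1 - Real.cos (inner ℝ ξ z)) / ‖z‖ ^ ((d : ℝ) + α)) +
        muStar μ z * ((1 - Real.cos (inner ℝ ξ z)) / ‖z‖ ^ ((d : ℝ) + α)) := fun z => by
    rw [muStar_eq, ← add_mul, add_sub_cancel, ← integral_mul_const, ← integral_const_mul]
    refine integral_congr_ae (Filter.Eventually.of_forall fun x => ?_)
    have h4 : x - (x + z) = -z := by abel
    simp only [hF, kernel, add_sub_cancel_left, h4, norm_neg]
    ring
  simp only [h3]
  rw [integral_add ((integrable_one_sub_cos_div h0 h2 ξ).const_mul _)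
    (hμ.integrable_muStar_cos hμm h0 h2 ξ), integral_const_mul, integral_one_sub_cos_div h0,
    mul_assoc]

/-- The bound for the remainder in the expansion of the form on the constants. -/
def expansionBound (d : ℕ) (α μp : ℝ) : ℝ :=
  μp * (latticeConst d 4 α (16 * Real.sqrt d) * ∫ z, radialMin d (α + 1) 4 2 1 z)

/-- On each cell the cosine is split into its quadratic Taylor term, which sums to the lattice part
of g⁰, and a remainder estimated by `IsAdmissible.lattice_sum` with R = |ξ|. -/
theorem IsAdmissible.abs_re_inner_formOp_oneCell_sub_le (hμ : IsAdmissible μm μp μ) (hμm : 0 < μm)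
    (h0 : 0 < α) (h1 : 1 < α) (h2 : α < 2) (ξ : Space d) :
    |(inner ℂ (oneCell d) (hμ.formOp hμm h0 h2 ξ (oneCell d))).re -
      (muMean μ * c0 d α * ‖ξ‖ ^ α +
        ∑ j, ∑ k, (∑' n, ∫ z in shiftedCell n, latticeIntegrand α μ j k z) * ξ k * ξ j)| ≤
      expansionBound d α μp * ‖ξ‖ ^ (α + 1) := by
  obtain ⟨j1, j2, j3⟩ := hμ.lattice_sum hμm h1 (p := 4) (by push_cast; linarith) (norm_nonneg ξ)
    (by positivity) (latticeNumerator_cos ξ)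
  have hL := fun j k => hμ.lattice_entry hμm h1 h2 j k
  have hsum1 : HasSum (fun n : Fin d → ℤ => ∑ j, ∑ k,
      (∫ z in shiftedCell n, latticeIntegrand α μ j k z) * (ξ k * ξ j))
      (∑ j, ∑ k, (∑' n, ∫ z in shiftedCell n, latticeIntegrand α μ j k z) * (ξ k * ξ j)) :=
    hasSum_sum fun j _ => hasSum_sum fun k _ => (hL j k).2.1.hasSum.mul_right _
  have hsum := j2.hasSum.add hsum1
  have heq : ∀ n : Fin d → ℤ, (∫ z in shiftedCell n, muStar μ z *
      ((1 - Real.cos (inner ℝ ξ z) - inner ℝ ξ z ^ 2 / 2) / ‖z‖ ^ ((d : ℝ) + α))) + ∑ j, ∑ k,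
      (∫ z in shiftedCell n, latticeIntegrand α μ j k z) * (ξ k * ξ j) =
      ∫ z in shiftedCell n, muStar μ z *
        ((1 - Real.cos (inner ℝ ξ z)) / ‖z‖ ^ ((d : ℝ) + α)) := fun n => by
    have hi : ∀ j k, Integrable (fun z => latticeIntegrand α μ j k z * (ξ k * ξ j))
        (volume.restrict (shiftedCell n)) := fun j k => ((hL j k).1 n).mul_const _
    simp only [← integral_mul_const]
    have e1 : ∀ j, ∑ k, ∫ z in shiftedCell n, latticeIntegrand α μ j k z * (ξ k * ξ j) =
        ∫ z in shiftedCell n, ∑ k, latticeIntegrand α μ j k z * (ξ k * ξ j) := fun j =>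
      (integral_finsetSum _ fun k _ => hi j k).symm
    simp only [e1]
    rw [← integral_finsetSum _ fun j _ => integrable_finsetSum _ fun k _ => hi j k,
      ← integral_add (j1 n) (integrable_finsetSum _ fun j _ =>
        integrable_finsetSum _ fun k _ => hi j k)]
    refine integral_congr_ae (Filter.Eventually.of_forall fun z => ?_)
    have e2 : ∑ j, ∑ k, latticeIntegrand α μ j k z * (ξ k * ξ j) =
        muStar μ z / (2 * ‖z‖ ^ ((d : ℝ) + α)) * inner ℝ ξ z ^ 2 := by
      rw [inner_sq_eq_sum, Finset.mul_sum]
      refine Finset.sum_congr rfl fun j _ => ?_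
      rw [Finset.mul_sum]
      refine Finset.sum_congr rfl fun k _ => ?_
      rw [latticeIntegrand]; ring
    simp only [e2]
    ring
  simp only [heq] at hsum
  -- The unsplit integrand is integrable, so its cell integrals sum to the full integral; uniqueness
  -- of sums equates this with the two split series.
  have htot := (hasSum_integral_shiftedCell (hμ.integrable_muStar_cos hμm h0 h2 ξ)).unique hsum
  rw [hμ.re_inner_formOp_oneCell hμm h0 h2 ξ, htot]
  simp only [mul_assoc _ (ξ _) (ξ _)]
  rw [show ∀ a b c : ℝ, a + (b + c) - (a + c) = b from fun a b c => by ring]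
  refine j3.trans (le_of_eq ?_)
  rw [expansionBound]
  ring

end

end

section

/-! ### The threshold expansion -/

theorem rpow_le_pi {R β : ℝ} (hR : 0 ≤ R) (hRπ : R ≤ Real.pi) (hβ : 0 ≤ β) (hβ1 : β ≤ 1) :
    R ^ β ≤ Real.pi := by
  rcases le_total R 1 with h | h
  · exact (Real.rpow_le_one hR h hβ).trans (by linarith [Real.pi_gt_three])
  · calc R ^ β ≤ R ^ (1 : ℝ) := Real.rpow_le_rpow_of_exponent_le h hβ1
      _ = R := Real.rpow_one R
      _ ≤ _ := hRπ

theorem rpow_le_pi_mul {R β γ : ℝ} (hR : 0 ≤ R) (hRπ : R ≤ Real.pi) (hβ : 0 ≤ β) (hγ : β ≤ γ)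
    (hγ1 : γ ≤ β + 1) : R ^ γ ≤ Real.pi * R ^ β := by
  calc R ^ γ = R ^ (γ - β) * R ^ β := by
        rw [← Real.rpow_add_of_nonneg hR (by linarith) hβ, sub_add_cancel]
    _ ≤ _ := mul_le_mul_of_nonneg_right (rpow_le_pi hR hRπ (by linarith) (by linarith))
        (Real.rpow_nonneg hR _)

section

variable {d : ℕ} {α μm μp : ℝ} {μ : Space d → Space d → ℝ} [NeZero d]

/-- The constant in the perturbation bounds. -/
def perturbConst (d : ℕ) [NeZero d] (α μm μp : ℝ) : ℝ :=
  Real.pi + μp * c0 d α + weightBound d α μp 1 1 1 +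
    (spectralGap d α μm)⁻¹ * weightBound d α μp 1 1 1 +
    (2 * Real.pi * (Real.sqrt (μp * levyMass d α) * twistBound d α μp 0) +
      4 * (μp * levyMass d α) + μp * (2 * c0 d α)) +
    2 * twistBound d α μp Real.pi * Real.sqrt (μp * (2 * c0 d α))

theorem twistBound_mono (hp : 0 ≤ μp) (h0 : 0 < α) (h2 : α < 2) {R R' : ℝ} (hR : 0 ≤ R)
    (h : R ≤ R') : twistBound d α μp R ≤ twistBound d α μp R' := by
  have hc := (c0_pos (d := d) h0 h2).le
  have := Real.pi_pos
  refine Real.sqrt_le_sqrt (mul_le_mul_of_nonneg_left ?_ hp)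
  refine mul_le_mul_of_nonneg_left (Real.rpow_le_rpow (by positivity) ?_ h0.le) (by positivity)
  linarith

theorem shiftBound_eq (hp : 0 ≤ μp) (h0 : 0 < α) (h2 : α < 2) {R : ℝ} (hR : 0 ≤ R) :
    shiftBound d α μp R = Real.sqrt (μp * (2 * c0 d α)) * R ^ (α / 2) := by
  have hc := (c0_pos (d := d) h0 h2).le
  have h1 : R ^ α = (R ^ (α / 2)) ^ 2 := by
    rw [← Real.rpow_natCast, ← Real.rpow_mul hR]
    congr 1; push_cast; ring
  rw [shiftBound, ← mul_assoc μp, Real.sqrt_mul (by positivity), h1,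
    Real.sqrt_sq (Real.rpow_nonneg hR _)]

theorem weightBound_le (hp : 0 ≤ μp) (h1 : 1 < α) (h2 : α < 2) {R : ℝ} (hR : 0 ≤ R)
    (hRπ : R ≤ Real.pi) :
    weightBound d α μp (2 * R ^ 2) 2 R ≤
      (2 * Real.pi * (Real.sqrt (μp * levyMass d α) * twistBound d α μp 0) +
        4 * (μp * levyMass d α)) * R ^ α := by
  have ht : 0 ≤ twistBound d α μp 0 := Real.sqrt_nonneg _
  have hRR : R ^ 2 ≤ Real.pi * R ^ α := by
    rw [← Real.rpow_two]
    exact rpow_le_pi_mul hR hRπ (by linarith) h2.le (by linarith)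
  have heq : Real.sqrt (μp * ((2 * R ^ 2) ^ 2 * levyMass d α)) =
      2 * R ^ 2 * Real.sqrt (μp * levyMass d α) := by
    rw [show μp * ((2 * R ^ 2) ^ 2 * levyMass d α) = (2 * R ^ 2) ^ 2 * (μp * levyMass d α) by ring,
      Real.sqrt_mul (by positivity), Real.sqrt_sq (by positivity)]
  rw [weightBound, heq]
  have h3 : 0 ≤ 2 * (Real.sqrt (μp * levyMass d α) * twistBound d α μp 0) := by positivity
  have h4 := mul_le_mul_of_nonneg_left hRR h3
  linarith

theorem delta0_le_pi (hμm : 0 < μm) (hle : μm ≤ μp) (h0 : 0 < α) :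
    delta0 α μm μp ≤ Real.pi := by
  have hp : 0 < μp := hμm.trans_le hle
  unfold delta0
  refine mul_le_of_le_one_right Real.pi_pos.le (Real.rpow_le_one (by positivity) ?_ (by positivity))
  rw [div_le_one (by positivity)]
  linarith

/-- This is where δ₀ comes from: μ₊c₀δ₀^α equals μ₋c₀π^α/3 = d₀/3. -/
theorem mul_rpow_le_of_le_delta0 (hμm : 0 < μm) (hle : μm ≤ μp) (h0 : 0 < α) (h2 : α < 2) {R : ℝ}
    (hR : 0 ≤ R) (h : R ≤ delta0 α μm μp) : μp * c0 d α * R ^ α ≤ spectralGap d α μm / 3 := by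
  have hp : 0 < μp := hμm.trans_le hle
  have hc := (c0_pos (d := d) h0 h2).le
  have h1 : R ^ α ≤ Real.pi ^ α * (μm / (3 * μp)) := by
    refine (Real.rpow_le_rpow hR h h0.le).trans (le_of_eq ?_)
    rw [delta0, Real.mul_rpow Real.pi_pos.le (by positivity), ← Real.rpow_mul (by positivity),
      one_div_mul_cancel h0.ne', Real.rpow_one]
  refine (mul_le_mul_of_nonneg_left h1 (by positivity)).trans (le_of_eq ?_)
  unfold spectralGap
  field_simp

/-- The constant in the bound for the eigenvectors. -/
def eigenvectorConst (d : ℕ) [NeZero d] (α μm μp : ℝ) : ℝ :=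
  3 / (2 * spectralGap d α μm) * (perturbConst d α μm μp * (Real.pi + 1))

/-- The constant in the bound for the eigenvalues. -/
def eigenvalueConst (d : ℕ) [NeZero d] (α μm μp : ℝ) : ℝ :=
  (perturbConst d α μm μp ^ 2 + perturbConst d α μm μp * eigenvectorConst d α μm μp +
    2 * perturbConst d α μm μp ^ 3 * eigenvectorConst d α μm μp +
    eigenvectorConst d α μm μp ^ 2 * perturbConst d α μm μp *
      (2 * perturbConst d α μm μp + perturbConst d α μm μp ^ 3)) + expansionBound d α μp

variable (hμ : IsAdmissible μm μp μ) (hμm : 0 < μm) (h0 : 0 < α) (h1 : 1 < α) (h2 : α < 2)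
  {ξ : Space d}

/-- Expansion of the eigenvalue near the bottom of the spectrum, and of the eigenvector. -/
theorem IsAdmissible.eigenvalue_expansion (hξ : ‖ξ‖ ≤ delta0 α μm μp) {f : L2Cell d}
    (hfe : inner ℂ (oneCell d) f = 0)
    (hf : hμ.formOp hμm h0 h2 0 f = -hμ.gradVec hμm h0 h1 h2 ξ) :
    ∃ (lam : ℝ) (ψ : L2Cell d), ‖smoothing d h0 ψ‖ = 1 ∧
      hμ.formOp hμm h0 h2 ξ ψ = (lam : ℂ) • smoothing d h0 (smoothing d h0 ψ) ∧ 0 ≤ lam ∧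
      lam ≤ spectralGap d α μm / 3 ∧
      |lam - (muMean μ * c0 d α * ‖ξ‖ ^ α + (-(inner ℂ f (hμ.formOp hμm h0 h2 0 f)).re +
        ∑ j, ∑ k, (∑' n, ∫ z in shiftedCell n, latticeIntegrand α μ j k z) * ξ k * ξ j))| ≤
        eigenvalueConst d α μm μp * ‖ξ‖ ^ (1 + α) ∧
      lam * ‖InnerProductSpace.rankOne ℂ (smoothing d h0 ψ) (smoothing d h0 ψ) - meanProj d‖ ≤
        4 * perturbConst d α μm μp * eigenvectorConst d α μm μp * ‖ξ‖ ^ (1 + α) := by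
  have hle := hμ.le
  have hp : 0 ≤ μp := hμm.le.trans hle
  have hξπ : ‖ξ‖ ≤ Real.pi := hξ.trans (delta0_le_pi hμm hle h0)
  have hγ := spectralGap_pos (d := d) hμm h0 h2
  have hc := (c0_pos (d := d) h0 h2).le
  have hJ := levyMass_nonneg (d := d) (α := α)
  have hW : 0 ≤ weightBound d α μp 1 1 1 := weightBound_nonneg hp zero_le_one zero_le_one
  have hT0 : 0 ≤ twistBound d α μp 0 := Real.sqrt_nonneg _
  have hTπ : 0 ≤ twistBound d α μp Real.pi := Real.sqrt_nonneg _
  have hπ := Real.pi_pos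
  obtain ⟨lam, ψ, hψ, heig, hlam0, hlam⟩ := hμ.exists_eigenvector hμm h0 h2 hξπ
  set S := smoothing d h0 with hS
  set B := hμ.formOp hμm h0 h2 ξ with hB
  set B₀ := hμ.formOp hμm h0 h2 0 with hB₀
  set m := hμ.gradVec hμm h0 h1 h2 ξ with hm
  set e := oneCell d with he
  set R := ‖ξ‖ with hR
  have hR0 : 0 ≤ R := norm_nonneg ξ
  set s := R ^ α with hs
  set r := R ^ (α / 2) with hr
  have hs0 : 0 ≤ s := Real.rpow_nonneg hR0 _
  have hr0 : 0 ≤ r := Real.rpow_nonneg hR0 _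
  set K := perturbConst d α μm μp with hK
  set D := eigenvectorConst d α μm μp with hD
  have hKdef := hK
  rw [perturbConst] at hKdef
  have q1 : 0 ≤ μp * c0 d α := by positivity
  have q2 : 0 ≤ (spectralGap d α μm)⁻¹ * weightBound d α μp 1 1 1 := by positivity
  have q3 : 0 ≤ 2 * Real.pi * (Real.sqrt (μp * levyMass d α) * twistBound d α μp 0) := by positivity
  have q4 : 0 ≤ μp * levyMass d α := by positivity
  have q5 : 0 ≤ 2 * twistBound d α μp Real.pi * Real.sqrt (μp * (2 * c0 d α)) := by positivity
  -- K is a sum of nonnegative terms, one for each hypothesis of the perturbation lemma, so it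
  -- dominates every one of them.
  have hKπ : Real.pi ≤ K := by linarith
  have hK0 : 0 ≤ K := hπ.le.trans hKπ
  have hD0 : 0 ≤ D := by rw [hD, eigenvectorConst, ← hK]; positivity
  have hBee0 : 0 ≤ (inner ℂ e (B e)).re := by
    rw [hB, hμ.re_inner_formOp_self]; positivity
  have hBee' := hμ.re_inner_formOp_oneCell_le hμm h0 h2 ξ
  have hBee : (inner ℂ e (B e)).re ≤ K * s :=
    hBee'.trans (mul_le_mul_of_nonneg_right (by linarith) hs0)
  have hm' : ‖m‖ ≤ weightBound d α μp 1 1 1 * R := hμ.norm_gradVec_le hμm h0 h1 h2 ξ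
  have hmK : ‖m‖ ≤ K * R := hm'.trans (mul_le_mul_of_nonneg_right (by linarith) hR0)
  have hfK : ‖f‖ ≤ K * R := by
    have h3 := hμ.norm_le_of_formOp_eq hμm h0 h2 hfe hf
    have h4 := mul_le_mul_of_nonneg_left hm' (inv_nonneg.2 hγ.le)
    rw [← mul_assoc] at h4
    exact h3.trans (h4.trans (mul_le_mul_of_nonneg_right (by linarith) hR0))
  have hBe : ‖B e - Complex.I • m‖ ≤ K * s := by
    have h3 := hμ.norm_formOp_oneCell_sub_le hμm h0 h1 h2 ξ
    rw [shiftBound_sq hp h0 h2 hR0] at h3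
    have h4 := weightBound_le (d := d) hp h1 h2 hR0 hξπ
    refine (h3.trans (add_le_add_left h4 _)).trans ?_
    have h5 : 2 * Real.pi * (Real.sqrt (μp * levyMass d α) * twistBound d α μp 0) +
        4 * (μp * levyMass d α) + μp * (2 * c0 d α) ≤ K := by linarith
    have h6 := mul_le_mul_of_nonneg_right h5 hs0
    rw [hs] at h6 ⊢
    linarith
  have hBB : ‖B f - B₀ f‖ ≤ K * r * ‖f‖ := by
    refine (hμ.norm_formOp_sub_le hμm h0 h2 ξ f).trans
      (mul_le_mul_of_nonneg_right ?_ (norm_nonneg f))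
    rw [shiftBound_eq hp h0 h2 hR0, ← mul_assoc]
    refine mul_le_mul_of_nonneg_right ?_ hr0
    have h3 := twistBound_mono (d := d) hp h0 h2 hR0 hξπ
    have h4 := twistBound_mono (d := d) hp h0 h2 le_rfl hπ.le
    have h5 := mul_le_mul_of_nonneg_right (add_le_add h3 h4)
      (Real.sqrt_nonneg (μp * (2 * c0 d α)))
    rw [← two_mul] at h5
    linarith
  have hrR : r * R ≤ K * s := by
    have h3 : r * R = R ^ (α / 2 + 1) := by
      rw [Real.rpow_add_of_nonneg hR0 (by linarith) zero_le_one, Real.rpow_one]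
    rw [h3]
    exact (rpow_le_pi_mul hR0 hξπ h0.le (by linarith) (by linarith)).trans
      (mul_le_mul_of_nonneg_right hKπ hs0)
  have hRR : R * R ≤ K * s := by
    rw [← pow_two, ← Real.rpow_two]
    exact (rpow_le_pi_mul hR0 hξπ h0.le h2.le (by linarith)).trans
      (mul_le_mul_of_nonneg_right hKπ hs0)
  have hsR : s ≤ Real.pi * R := by
    have := rpow_le_pi_mul hR0 hξπ zero_le_one h1.le (by linarith : α ≤ 1 + 1)
    rwa [Real.rpow_one] at this
  have hlamγ : lam ≤ spectralGap d α μm / 3 :=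
    hlam.trans (hBee'.trans (mul_rpow_le_of_le_delta0 hμm hle h0 h2 hR0 hξ))
  have hBsymm : ∀ x y, inner ℂ (B x) y = inner ℂ x (B y) := hμ.inner_formOp_left hμm h0 h2 ξ
  have hB₀symm : ∀ x y, inner ℂ (B₀ x) y = inner ℂ x (B₀ y) := hμ.inner_formOp_left hμm h0 h2 0
  have hSsymm : ∀ x y, inner ℂ (S x) y = inner ℂ x (S y) := inner_smoothing_left h0
  have hS1 : ∀ x, ‖S x‖ ≤ ‖x‖ := norm_smoothing_le h0
  have hSe : S e = e := smoothing_oneCell h0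
  have hω : ‖ψ - inner ℂ e ψ • e‖ ≤ D * R := by
    have h3 := norm_sub_smul_le hγ hSsymm hS1 norm_oneCell hSe hψ heig hlamγ
      (hμ.le_re_inner_formOp hμm h0 h2 ξ hξπ)
    refine h3.trans ?_
    rw [hD, eigenvectorConst, mul_assoc, ← hK]
    refine mul_le_mul_of_nonneg_left ?_ (by positivity)
    -- Here Be has norm at most Ks + KR, and s ≤ πR; hence the factor π + 1 in the eigenvector
    -- constant.
    have h4 : B e = (B e - Complex.I • m) + Complex.I • m := by abel
    have h5 := norm_add_le (B e - Complex.I • m) (Complex.I • m)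
    rw [← h4, norm_smul, Complex.norm_I, one_mul] at h5
    have h6 := mul_le_mul_of_nonneg_left hsR hK0
    linarith
  have hsR' : R * s = R ^ (1 + α) := by
    rw [Real.rpow_add_of_nonneg hR0 zero_le_one h0.le, Real.rpow_one]
  refine ⟨lam, ψ, hψ, heig, hlam0, hlamγ, ?_, ?_⟩
  · have h3 := abs_eigenvalue_sub_le hBsymm hSsymm hB₀symm hS1 norm_oneCell hSe hψ heig hlam0 hfe hf
      hR0 hs0 hr0 hK0 (hlam.trans hBee) hmK hfK hBe hBB hBee hBee0 hD0 hω hrR hRR (hξπ.trans hKπ)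
    have h4 := hμ.abs_re_inner_formOp_oneCell_sub_le hμm h0 h1 h2 ξ
    rw [add_comm α 1] at h4
    rw [hsR'] at h3
    rw [eigenvalueConst, ← hK, ← hD, add_mul]
    refine le_trans ?_ (add_le_add h3 h4)
    refine le_trans (le_of_eq ?_) (abs_add_le _ _)
    congr 1
    ring
  · have hee : inner ℂ e e = 1 := by rw [inner_self_eq_norm_sq_to_K, norm_oneCell]; simp
    have hdec : S ψ = inner ℂ e ψ • e + S (ψ - inner ℂ e ψ • e) := by
      rw [map_sub, map_smul, hSe]; abel
    have horth : inner ℂ e (S (ψ - inner ℂ e ψ • e)) = 0 := by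
      rw [← hSsymm, hSe, inner_sub_right, inner_smul_right, hee, mul_one, sub_self]
    have h3 := norm_rankOne_sub_le norm_oneCell hψ hdec horth
    have h4 : ‖S (ψ - inner ℂ e ψ • e)‖ ≤ D * R := (hS1 _).trans hω
    rw [meanProj, ← hsR']
    calc _ ≤ (K * s) * (4 * (D * R)) :=
          mul_le_mul (hlam.trans hBee) (h3.trans (by linarith)) (norm_nonneg _) (by positivity)
      _ = _ := by ring

/-- The operator cut off by the spectral projection has rank one. -/
theorem IsAdmissible.levyOperator_proj {E : ProjectionValuedMeasure (L2Cell d)}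
    (hE : E.IsSpectralMeasureOf (levyOperator α μ ξ)) (hξ : ‖ξ‖ ≤ Real.pi) {lam : ℝ}
    {ψ : L2Cell d} (hψ : ‖smoothing d h0 ψ‖ = 1)
    (heig : hμ.formOp hμm h0 h2 ξ ψ = (lam : ℂ) • smoothing d h0 (smoothing d h0 ψ))
    (hlam0 : 0 ≤ lam) (hlam : lam ≤ spectralGap d α μm / 3) (u : L2Cell d) :
    ∃ h : E.proj (Set.Icc 0 (spectralGap d α μm / 3)) u ∈ (levyOperator α μ ξ).domain,
      levyOperator α μ ξ ⟨E.proj (Set.Icc 0 (spectralGap d α μm / 3)) u, h⟩ =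
        ((lam : ℂ) • InnerProductSpace.rankOne ℂ (smoothing d h0 ψ) (smoothing d h0 ψ)) u := by
  obtain ⟨hdom, hA⟩ := (hμ.levyOperator_iff hμm h0 h2 ξ (smoothing d h0 ψ)
    ((lam : ℂ) • smoothing d h0 ψ)).2 ⟨ψ, rfl, by rw [heig, map_smul]⟩
  rw [hE.proj_Icc_eq hdom hψ hA hlam0 hlam (hμ.eq_zero_of_re_inner_le hμm h0 h2 hξ) u,
    hμ.levyOperator_iff hμm h0 h2]
  refine ⟨inner ℂ (smoothing d h0 ψ) u • ψ, map_smul _ _ _, ?_⟩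
  rw [map_smul, heig, smul_apply, InnerProductSpace.rankOne_apply, map_smul, map_smul,
    smul_comm]

end

end

end LevyType

end

open LevyType
theorem proposition3p7 (d : ℕ) [NeZero d] (α : ℝ) (hα1 : 1 < α) (hα2 : α < 2)
    (μm μp : ℝ) (hμm : 0 < μm) :
    ∃ C₁₁ C₁₂ : ℝ, ∀ μ : Space d → Space d → ℝ, IsAdmissible μm μp μ →
      (∀ k : Fin d, ∃! v : L2Cell d, IsCellSolution α μ k v) ∧
      ∀ v : Fin d → L2Cell d, (∀ k, IsCellSolution α μ k (v k)) →
        ∃ g : Matrix (Fin d) (Fin d) ℝ,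
          (∀ j k, G0EntryConverges α μ v j k ∧ ((g j k : ℝ) : ℂ) = g0Entry α μ v j k) ∧
          g.IsSymm ∧
          (∀ ξ : Space d, |∑ j, ∑ k, g j k * ξ k * ξ j| ≤ C₁₂ * ‖ξ‖ ^ 2) ∧
          ∀ ξ : Space d, ‖ξ‖ ≤ delta0 α μm μp →
            (∃ E : ProjectionValuedMeasure (L2Cell d),
              E.IsSpectralMeasureOf (levyOperator α μ ξ)) ∧
            ∀ E : ProjectionValuedMeasure (L2Cell d),
              E.IsSpectralMeasureOf (levyOperator α μ ξ) →
              ∃ T : L2Cell d →L[ℂ] L2Cell d,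
                (∀ u : L2Cell d,
                  ∃ h : E.proj (Set.Icc 0 (spectralGap d α μm / 3)) u ∈
                      (levyOperator α μ ξ).domain,
                    levyOperator α μ ξ
                      ⟨E.proj (Set.Icc 0 (spectralGap d α μm / 3)) u, h⟩ = T u) ∧
                ‖T - ((muMean μ * c0 d α * ‖ξ‖ ^ α + ∑ j, ∑ k, g j k * ξ k * ξ j : ℝ) : ℂ) •
                    meanProj d‖ ≤ C₁₁ * ‖ξ‖ ^ (1 + α) := by
  have h0 : 0 < α := one_pos.trans hα1
  -- C₁₁ adds the error of the eigenvalue and that of λ(Q - P). C₁₂ adds the bound d₀⁻¹‖m‖² for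
  -- (B(0)f, f) and the d² bounded lattice entries.
  refine ⟨eigenvalueConst d α μm μp +
    4 * perturbConst d α μm μp * eigenvectorConst d α μm μp,
    (spectralGap d α μm)⁻¹ * weightBound d α μp 1 1 1 ^ 2 + d * d * latticeBound d α μp,
    fun μ hμ => ⟨hμ.existsUnique_isCellSolution hμm hα1 hα2, fun v hv => ?_⟩⟩
  choose f hfv hfe hf using fun k => (hμ.isCellSolution_iff hμm h0 hα1 hα2 k (v k)).1 (hv k)
  obtain rfl : (fun k => smoothing d h0 (f k)) = v := funext hfv
  set B₀ := hμ.formOp hμm h0 hα2 0 with hB₀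
  set L : Fin d → Fin d → ℝ :=
    fun j k => ∑' n, ∫ z in shiftedCell n, latticeIntegrand α μ j k z with hL
  have hlat := fun j k => hμ.lattice_entry hμm hα1 hα2 j k
  have hcor := fun j k => hμ.correctorIntegrand_smoothing hμm h0 hα1 hα2 hf j k
  -- By sesquilinearity the corrector part of the quadratic form is -(B(0)f, f) for the single
  -- vector f = Σ ξ_k f_k, which solves the cell equation in the direction ξ.
  have hsum : ∀ ξ : Space d,
      ∑ j, ∑ k, (-(inner ℂ (f j) (B₀ (f k))).re + L j k) * ξ k * ξ j =
        -(inner ℂ (∑ k, (ξ k : ℂ) • f k) (B₀ (∑ k, (ξ k : ℂ) • f k))).re +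
          ∑ j, ∑ k, L j k * ξ k * ξ j := fun ξ => by
    rw [← sum_re_inner_eq]
    simp only [add_mul, Finset.sum_add_distrib, neg_mul, Finset.sum_neg_distrib]
  have hfξ := fun ξ : Space d => hμ.formOp_sum_smul hμm h0 hα1 hα2 hf ξ
  have hfξe : ∀ ξ : Space d, inner ℂ (oneCell d) (∑ k, (ξ k : ℂ) • f k) = 0 := fun ξ => by
    rw [inner_sum]
    exact Finset.sum_eq_zero fun k _ => by rw [inner_smul_right, hfe, mul_zero]
  refine ⟨Matrix.of fun j k => -(inner ℂ (f j) (B₀ (f k))).re + L j k, fun j k => ⟨⟨(hcor j k).1,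
    (hlat j k).1, (hlat j k).2.1⟩, ?_⟩, ?_, fun ξ => ?_, fun ξ hξ => ?_⟩
  · rw [g0Entry, (hcor j k).2, Matrix.of_apply, Complex.ofReal_add]
  · refine Matrix.IsSymm.ext fun j k => ?_
    simp only [Matrix.of_apply, hL]
    congr 1
    -- Exchanging j and k conjugates the inner product, and the real part is unaffected.
    · rw [← hμ.inner_formOp_left, ← inner_conj_symm, Complex.conj_re]
    · refine tsum_congr fun n => ?_
      congr 1
      funext z
      simp only [latticeIntegrand]
      ring
  · simp only [Matrix.of_apply]
    rw [hsum]
    have hγ := spectralGap_pos (d := d) hμm h0 hα2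
    have hW : 0 ≤ weightBound d α μp 1 1 1 :=
      weightBound_nonneg (hμm.le.trans hμ.le) zero_le_one zero_le_one
    have hm := hμ.norm_gradVec_le hμm h0 hα1 hα2 ξ
    have h1 : |-(inner ℂ (∑ k, (ξ k : ℂ) • f k) (B₀ (∑ k, (ξ k : ℂ) • f k))).re| ≤
        (spectralGap d α μm)⁻¹ * weightBound d α μp 1 1 1 ^ 2 * ‖ξ‖ ^ 2 := by
      rw [abs_neg]
      refine (Complex.abs_re_le_norm _).trans ((norm_inner_le_norm _ _).trans ?_)
      have h3 := hμ.norm_le_of_formOp_eq hμm h0 hα2 (hfξe ξ) (hfξ ξ)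
      rw [hfξ, norm_neg]
      refine (mul_le_mul_of_nonneg_right h3 (norm_nonneg _)).trans ?_
      rw [mul_assoc, mul_assoc, ← mul_pow, ← pow_two]
      exact mul_le_mul_of_nonneg_left (pow_le_pow_left₀ (norm_nonneg _) hm 2) (inv_nonneg.2 hγ.le)
    have h2 : |∑ j, ∑ k, L j k * ξ k * ξ j| ≤ d * d * latticeBound d α μp * ‖ξ‖ ^ 2 := by
      have h3 : ∀ j k, |L j k * ξ k * ξ j| ≤ latticeBound d α μp * ‖ξ‖ ^ 2 := fun j k => by
        have h4 : |ξ j| ≤ ‖ξ‖ := PiLp.norm_apply_le ξ j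
        have h5 : |ξ k| ≤ ‖ξ‖ := PiLp.norm_apply_le ξ k
        have h6 := (abs_nonneg _).trans (hlat j k).2.2
        rw [abs_mul, abs_mul, pow_two, ← mul_assoc]
        exact mul_le_mul (mul_le_mul (hlat j k).2.2 h5 (abs_nonneg _) h6) h4 (abs_nonneg _)
          (mul_nonneg h6 (norm_nonneg _))
      calc |∑ j, ∑ k, L j k * ξ k * ξ j| ≤ ∑ j : Fin d, ∑ k : Fin d, latticeBound d α μp * ‖ξ‖ ^ 2 :=
            (Finset.abs_sum_le_sum_abs _ _).trans (Finset.sum_le_sum fun j _ =>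
              (Finset.abs_sum_le_sum_abs _ _).trans (Finset.sum_le_sum fun k _ => h3 j k))
        _ = _ := by simp; ring
    rw [add_mul]
    exact (abs_add_le _ _).trans (add_le_add h1 h2)
  · have hξπ := hξ.trans (delta0_le_pi hμm hμ.le h0)
    refine ⟨hμ.exists_spectralMeasure hμm h0 hα2 hξπ, fun E hE => ?_⟩
    obtain ⟨lam, ψ, hψ, heig, hlam0, hlam, hval, hvec⟩ :=
      hμ.eigenvalue_expansion hμm h0 hα1 hα2 hξ (hfξe ξ) (hfξ ξ)
    refine ⟨_, hμ.levyOperator_proj hμm h0 hα2 hE hξπ hψ heig hlam0 hlam, ?_⟩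
    simp only [Matrix.of_apply]
    rw [hsum]
    set Λ : ℝ := muMean μ * c0 d α * ‖ξ‖ ^ α +
      (-(inner ℂ (∑ k, (ξ k : ℂ) • f k) (B₀ (∑ k, (ξ k : ℂ) • f k))).re +
        ∑ j, ∑ k, L j k * ξ k * ξ j) with hΛ
    have hP : ‖meanProj d‖ = 1 := by
      rw [meanProj, InnerProductSpace.norm_rankOne, norm_oneCell, one_mul]
    set Q := InnerProductSpace.rankOne ℂ (smoothing d h0 ψ) (smoothing d h0 ψ) with hQ
    -- The eigenvalue error is carried by P, of norm one; the eigenvector error keeps the factor λ =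
    -- O(|ξ|^α), which supplies the missing power.
    have heq : (lam : ℂ) • Q - (Λ : ℂ) • meanProj d =
        ((lam - Λ : ℝ) : ℂ) • meanProj d + (lam : ℂ) • (Q - meanProj d) := by
      push_cast; module
    rw [heq, add_mul]
    refine (norm_add_le _ _).trans (add_le_add ?_ ?_)
    · rw [norm_smul, hP, mul_one, Complex.norm_real, Real.norm_eq_abs]
      exact hval
    · rw [norm_smul, Complex.norm_real, Real.norm_of_nonneg hlam0]
      exact hvec
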